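/- Let $n\ge 0$, let $X_1,\dots,X_r\subset\mathbf P^n=\mathbf P^n_{\mathbf C}$ ($r\ge 1$) be distinct hyperplanes with defining linear forms $\ell_1,\dots,\ell_r$, let $m_1,\dots,m_r\ge 1$ be integers, and let $X\subset\mathbf P^n$ be the hypersurface $\prod_j\ell_j^{m_j}=0$. Let $\Sigma=\operatorname{Sing}X$ be the common zero locus of $\prod_j\ell_j^{m_j}$ and its partial derivatives, and put $$\Sigma_1:=\bigcup_{X_j\subset\Sigma}X_j,\qquad \Sigma_2:=\overline{\Sigma\setminus\Sigma_1}.$$ Let $X'\subset\mathbf P^n$ be a general hyperplane, i.e. one that contains no nonempty intersection of some of the $X_j$. Let $\mathcal S$ be the set of strata of $\Sigma\setminus X'$, i.e. of the nonempty subsets $S\subset\Sigma$ with $$S=\bigcap_{j\in I(S)}X_j\setminus\Bigl(\bigcup_{j\notin I(S)}X_j\cup X'\Bigr),\qquad I(S):=\{j\mid X_j\supset S\},$$ and let $\overline S$ be the closure of $S$ (an edge of the arrangement). Put $\mathcal S^{(i)}:=\{S\in\mathcal S\mid \operatorname{codim}_{\mathbf P^n}S=i\}$ and $\mathcal S_a^{(i)}:=\{S\in\mathcal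 S^{(i)}\mid S\subset\Sigma_a\}$ for $a=1,2$. For closed $Z\subset\mathbf P^n$ let $\mathrm{CH}_k(Z)_{\mathbf Q}$ be the Chow group of $k$-dimensional cycles on $Z$ modulo rational equivalence, with rational coefficients ($k\ge 0$). Then: 1. $\mathrm{CH}_{n-1}(X)_{\mathbf Q}=\bigoplus_{j=1}^r\mathbf Q[X_j]$ if $n\ge1$, and $\mathrm{CH}_k(X)_{\mathbf Q}\cong\mathbf Q$ for $0\le k\le n-2$. 2. $\mathrm{CH}_{n-1}(\Sigma)_{\mathbf Q}=\bigoplus_{S\in\mathcal S_1^{(1)}}\mathbf Q[\overline S]$ if $n\ge 1$. If $n\ge2$ and $\Sigma_1\ne\emptyset$, then $$\mathrm{CH}_{n-2}(\Sigma)_{\mathbf Q}=\bigoplus_{S\in\mathcal S_2^{(2)}}\mathbf Q[\overline S]\;\oplus\;\operatorname{Im}\bigl(\mathrm{CH}_{n-2}(\Sigma_1)_{\mathbf Q}\to\mathrm{CH}_{n-2}(\Sigma)_{\mathbf Q}\bigr),$$ where the push-forward $\mathrm{CH}_{n-2}(\Sigma_1)_{\mathbf Q}\to\mathrm{CH}_{n-2}(\Sigma)_{\mathbf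 Q}$ is injective with image isomorphic to $\mathbf Q$, and $\mathrm{CH}_{n-2}(\Sigma_1)_{\mathbf Q}\to\mathrm{CH}_{n-2}(\mathbf P^n)_{\mathbf Q}$ is an isomorphism. If $n\ge 2$ and $\Sigma_1=\emptyset$, then $\mathrm{CH}_{n-2}(\Sigma)_{\mathbf Q}=\bigoplus_{S\in\mathcal S_2^{(2)}}\mathbf Q[\overline S]$. If $\Sigma\neq\emptyset$, then $\mathrm{CH}_k(\Sigma)_{\mathbf Q}\cong\mathbf Q$ for $0\le k\le n-3$. 3. For $S\in\mathcal S^{(i)}$ with $i\ge3$ we have $\dim\overline S\le n-3$, and for $0\le k\le\dim\overline S$ the push-forwards by the inclusions are isomorphisms $$\mathrm{CH}_k(\overline S)_{\mathbf Q}\xrightarrow{\ \sim\ }\mathrm{CH}_k(\Sigma)_{\mathbf Q}\xrightarrow{\ \sim\ }\mathrm{CH}_k(\mathbf P^n)_{\mathbf Q}.$$ 4. If $n\ge2$, then for $S\in\mathcal S_1^{(2)}$ the push-forwards by the inclusions are isomorphisms $$\mathrm{CH}_{n-2}(\overline S)_{\mathbf Q}\xrightarrow{\ \sim\ }\mathrm{CH}_{n-2}(\Sigma_1)_{\mathbf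 Q}\xrightarrow{\ \sim\ }\mathrm{CH}_{n-2}(\mathbf P^n)_{\mathbf Q}.$$ -/

import Mathlib

open AlgebraicGeometry TopologicalSpace CategoryTheory
open scoped Topology

noncomputable section

/-! ### Rational Chow groups

`Y` is a scheme (below: projective space over `ℂ`). A subvariety of `Y` is given by its generic
point; in the order of `Y` (`x ≤ y` iff `x` lies in the closure of `y`) the dimension of the
subvariety with generic point `x` is `Order.height x`. -/

namespace Chow

variable {Y : Scheme.{0}}

/-- For `z` in the subvariety `W` with generic point `w`: the map from the local ring of `Y` at `z`
to the function field `κ(w)` of `W`. -/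
def toFunctionField {w z : Y} (h : w ⤳ z) : Y.presheaf.stalk z →+* Y.residueField w :=
  (Y.presheaf.stalkSpecializes h ≫ Y.residue w).hom

/-- The local ring `𝒪_{W,z}` of the (reduced) subvariety `W` with generic point `w`,
as a subring of its function field `κ(w)`. -/
abbrev localRing {w z : Y} (h : w ⤳ z) : Subring (Y.residueField w) :=
  (toFunctionField h).range

/-- `ord_z(f) = m` for a rational function `f` on `W`: writing `f = a / b` with `a, b ∈ 𝒪_{W,z}`,
`m` is the difference of the lengths of `𝒪_{W,z}/(a)` and `𝒪_{W,z}/(b)`. -/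
def HasOrder {w z : Y} (h : w ⤳ z) (f : Y.residueField w) (m : ℤ) : Prop :=
  ∃ (a b : localRing h) (p q : ℕ), b ≠ 0 ∧ f * (b : Y.residueField w) = a ∧
    Ring.ord (localRing h) a = p ∧ Ring.ord (localRing h) b = q ∧ m = (p : ℤ) - q

/-- The `k`-dimensional subvarieties of the closed subset `Z`, through their generic points. -/
abbrev Subvariety (k : ℕ) (Z : Closeds Y) : Type :=
  {z : Y // z ∈ Z ∧ Order.height z = (k : ℕ∞)}

/-- `k`-dimensional cycles on `Z` with rational coefficients. -/
abbrev Cycle (k : ℕ) (Z : Closeds Y) : Type := Subvariety k Z →₀ ℚ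

/-- The cycle `c` is the divisor of the rational function `f` on the `(k+1)`-dimensional
subvariety with generic point `w`. -/
def IsDivisor {k : ℕ} {Z : Closeds Y} (w : Y) (f : Y.residueField w) (c : Cycle k Z) : Prop :=
  ∀ z : Subvariety k Z,
    (∀ h : w ⤳ z.1, ∃ m : ℤ, HasOrder h f m ∧ c z = m) ∧ (¬ w ⤳ z.1 → c z = 0)

/-- Cycles rationally equivalent to zero on `Z`: the span of the divisors of the nonzero rational
functions on the `(k+1)`-dimensional subvarieties of `Z`. -/
def ratEquivZero (k : ℕ) (Z : Closeds Y) : Submodule ℚ (Cycle k Z) :=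
  Submodule.span ℚ {c | ∃ w : Subvariety (k + 1) Z, ∃ f : Y.residueField w.1,
    f ≠ 0 ∧ IsDivisor w.1 f c}

/-- The rational Chow group `CH_k(Z)_ℚ` of a closed subset `Z` of `Y`. -/
abbrev CH (k : ℕ) (Z : Closeds Y) : Type := Cycle k Z ⧸ ratEquivZero k Z

/-- The inclusion of subvarieties of `Z` into those of `Z'`, for `Z ⊆ Z'`. -/
def Subvariety.incl {k : ℕ} {Z Z' : Closeds Y} (h : Z ≤ Z') (z : Subvariety k Z) :
    Subvariety k Z' :=
  ⟨z.1, h z.2.1, z.2.2⟩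

theorem Subvariety.incl_injective {k : ℕ} {Z Z' : Closeds Y} (h : Z ≤ Z') :
    Function.Injective (Subvariety.incl (k := k) h) := fun _ _ hxy =>
  Subtype.ext (congrArg (fun t : Subvariety k Z' => t.1) hxy)

theorem ratEquivZero_le_comap {k : ℕ} {Z Z' : Closeds Y} (h : Z ≤ Z') :
    ratEquivZero k Z ≤
      (ratEquivZero k Z').comap (Finsupp.lmapDomain ℚ ℚ (Subvariety.incl h)) := by
  refine Submodule.span_le.2 ?_
  rintro c ⟨w, f, hf, hc⟩
  refine Submodule.subset_span ⟨Subvariety.incl h w, f, hf, fun z => ?_⟩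
  by_cases hz : z.1 ∈ Z
  · obtain ⟨z, rfl⟩ : ∃ y : Subvariety k Z, Subvariety.incl h y = z := ⟨⟨z.1, hz, z.2.2⟩, rfl⟩
    rw [Finsupp.lmapDomain_apply, Finsupp.mapDomain_apply (Subvariety.incl_injective h)]
    exact hc z
  · have h0 : Finsupp.lmapDomain ℚ ℚ (Subvariety.incl h) c z = 0 := by
      rw [Finsupp.lmapDomain_apply]
      refine Finsupp.mapDomain_of_notMem_range _ _ ?_
      rintro ⟨y, rfl⟩
      exact hz y.2.1
    refine ⟨fun hwz => absurd (hwz.mem_closed Z.isClosed w.2.1) hz, fun _ => h0⟩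

/-- The push-forward `CH_k(Z)_ℚ → CH_k(Z')_ℚ` by a closed inclusion `Z ⊆ Z'`. -/
def pushforward (k : ℕ) {Z Z' : Closeds Y} (h : Z ≤ Z') : CH k Z →ₗ[ℚ] CH k Z' :=
  Submodule.mapQ _ _ (Finsupp.lmapDomain ℚ ℚ (Subvariety.incl h)) (ratEquivZero_le_comap h)

open Classical in
/-- The class `[V] ∈ CH_k(Z)_ℚ` of an irreducible closed `V ⊆ Z` of dimension `k`
(zero if `V` is not of this kind). -/
def cls (k : ℕ) (Z : Closeds Y) (V : Set Y) : CH k Z :=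
  if h : ∃ z : Subvariety k Z, IsGenericPoint z.1 V then
    (ratEquivZero k Z).mkQ (Finsupp.single h.choose 1)
  else 0

/-- The codimension in `Y` of a subset `S`. -/
def codim (S : Set Y) : ℕ∞ := ⨅ x ∈ S, Order.coheight x

end Chow

/-! ### Projective hyperplane arrangements -/

attribute [local instance] MvPolynomial.gradedAlgebra

/-- Complex projective space of dimension `n`. -/
abbrev PP (n : ℕ) : Scheme.{0} := Proj (MvPolynomial.homogeneousSubmodule (Fin (n + 1)) ℂ)

/-- The closed subset of projective space defined by a set of polynomials. -/
def zeros {n : ℕ} (s : Set (MvPolynomial (Fin (n + 1)) ℂ)) : Closeds (PP n) :=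
  ⟨ProjectiveSpectrum.zeroLocus (MvPolynomial.homogeneousSubmodule (Fin (n + 1)) ℂ) s,
    ProjectiveSpectrum.isClosed_zeroLocus _ s⟩

/-- A projective hyperplane arrangement in `ℙⁿ` with `r` distinct components, given by linear
forms, and with multiplicities `mult j ≥ 1`. -/
structure Arrangement (n r : ℕ) where
  form : Fin r → MvPolynomial (Fin (n + 1)) ℂ
  isHomogeneous : ∀ j, (form j).IsHomogeneous 1
  ne_zero : ∀ j, form j ≠ 0
  distinct : ∀ i j, i ≠ j → ¬ Associated (form i) (form j)
  mult : Fin r → ℕ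
  mult_pos : ∀ j, 0 < mult j

namespace Arrangement

variable {n r : ℕ} (A : Arrangement n r)

/-- The component `X_j`. -/
def comp (j : Fin r) : Closeds (PP n) := zeros {A.form j}

/-- The defining polynomial of `X`. -/
def poly : MvPolynomial (Fin (n + 1)) ℂ := ∏ j, A.form j ^ A.mult j

/-- The underlying closed subset of the hypersurface `X`. -/
def X : Closeds (PP n) := zeros {A.poly}

/-- `Σ = Sing X`, by the Jacobian criterion for the (possibly non-reduced) hypersurface `X`. -/
def sing : Closeds (PP n) :=
  zeros (insert A.poly (Set.range fun i => MvPolynomial.pderiv i A.poly))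

/-- `Σ₁`, the union of the components `X_j` contained in `Σ`. -/
def sing₁ : Closeds (PP n) :=
  ⟨⋃ j ∈ {j | A.comp j ≤ A.sing}, (A.comp j : Set (PP n)),
    (Set.toFinite _).isClosed_biUnion fun j _ => (A.comp j).isClosed⟩

/-- `Σ₂`, the closure of `Σ ∖ Σ₁`. -/
def sing₂ : Closeds (PP n) := Closeds.closure ((A.sing : Set (PP n)) \ A.sing₁)

theorem sing₁_le : A.sing₁ ≤ A.sing := Set.iUnion₂_subset fun _ hj => hj

/-- The hyperplane `X' = {ℓ = 0}` is general with respect to `X`: it contains no nonempty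
intersection of components `X_j` (in particular `X' ≠ ℙⁿ`, from the empty family). -/
def IsGeneral (l : MvPolynomial (Fin (n + 1)) ℂ) : Prop :=
  l.IsHomogeneous 1 ∧ ∀ I : Set (Fin r),
    (⋂ j ∈ I, (A.comp j : Set (PP n))).Nonempty →
      ¬ (⋂ j ∈ I, (A.comp j : Set (PP n))) ⊆ zeros {l}

/-- `I(S) = {j | X_j ⊇ S}`. -/
def indexSet (S : Set (PP n)) : Set (Fin r) := {j | S ⊆ A.comp j}

/-- The strata of the canonical stratification of `Σ ∖ X'`, where `X' = {ℓ = 0}`. -/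
def strata (l : MvPolynomial (Fin (n + 1)) ℂ) : Set (Set (PP n)) :=
  {S | S.Nonempty ∧ S ⊆ A.sing ∧
    S = (⋂ j ∈ A.indexSet S, (A.comp j : Set (PP n))) \
      ((⋃ j ∈ (A.indexSet S)ᶜ, (A.comp j : Set (PP n))) ∪ zeros {l})}

/-- Strata of codimension `i`. -/
def strataCodim (l : MvPolynomial (Fin (n + 1)) ℂ) (i : ℕ) : Set (Set (PP n)) :=
  {S ∈ A.strata l | Chow.codim S = i}

/-- Strata of codimension `i` contained in `Σ₁`. -/
def strata₁ (l : MvPolynomial (Fin (n + 1)) ℂ) (i : ℕ) : Set (Set (PP n)) :=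
  {S ∈ A.strataCodim l i | S ⊆ A.sing₁}

/-- Strata of codimension `i` contained in `Σ₂`. -/
def strata₂ (l : MvPolynomial (Fin (n + 1)) ℂ) (i : ℕ) : Set (Set (PP n)) :=
  {S ∈ A.strataCodim l i | S ⊆ A.sing₂}

variable {A} in
theorem closure_le_sing {l : MvPolynomial (Fin (n + 1)) ℂ} {i : ℕ} {S : Set (PP n)}
    (hS : S ∈ A.strataCodim l i) : Closeds.closure S ≤ A.sing :=
  closure_minimal hS.1.2.1 A.sing.isClosed

variable {A} in
theorem closure_le_sing₁ {l : MvPolynomial (Fin (n + 1)) ℂ} {i : ℕ} {S : Set (PP n)}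
    (hS : S ∈ A.strata₁ l i) : Closeds.closure S ≤ A.sing₁ :=
  closure_minimal hS.2 A.sing₁.isClosed

end Arrangement

end

/-! Two facts about cycles on a closed `Z` in projective space carry the proof. First, the degree of
a cycle is invariant under rational equivalence. It gives a linear map `degree` from `CH k Z` to ℚ
that is nonzero on every `k`-dimensional subvariety and commutes with push-forward
(`degree_pt_ne_zero`, `degree_pushforward`), and on a linear subspace of dimension at least `k` it
is bijective (`degree_lin_bijective`). Second, a `k`-dimensional subvariety lying in no
`(k+1)`-dimensional subvariety of `Z` occurs in no divisor, so such subvarieties generate a free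
direct summand (`linearIndependent_isCompl`).

The closed sets in question are unions of linear subspaces: X of the hyperplanes, Σ₁ of the multiple
hyperplanes (`mem_sing₁`), Σ of these and of the intersections of two distinct hyperplanes
(`mem_sing`). If two linear pieces meet in dimension at least `k`, their `k`-dimensional
subvarieties have proportional classes (`pt_mem_span_of_lin_lin`). Hyperplanes meet in dimension at
least n-2. The pieces X_a ∩ X_b and X_a ∩ X_c meet in dimension at least n-3, and X_a ∩ X_c links
X_a ∩ X_b to X_c ∩ X_d. So `degree` is bijective on X and Σ₁ for k ≤ n-2 and on Σ for k ≤ n-3, and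
the push-forwards between such groups are isomorphisms because they preserve degree. In the
remaining dimensions the second fact gives the bases and the direct summand.

Invariance of degree is commutative algebra over the polynomial ring S. A homogeneous ideal I has a
filtration of S/I with quotients shifted copies of S/Q, Q prime. For I = P_w + (a), the number of
occurrences of a prime of codimension one on W is the order of vanishing of a there
(`length_locIdeal`), and the top coefficient of the Hilbert polynomial is additive along the
filtration. The Hilbert polynomial of S/(P_w + (a)) is p(t) - p(t-d), which depends on a only
through its degree d, so a/b has a divisor of degree zero.

For a linear subspace, a subvariety V is moved into a hyperplane section (`pt_mem_span_of_core`): on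
the cone over a projection of V, a form that cuts out V, up to components with a smaller projection,
is compared with a power of a coordinate. -/

noncomputable section

attribute [local instance] MvPolynomial.gradedAlgebra
open MvPolynomial

/-! ### Points of projective space as homogeneous primes; local rings and residue fields as
fractions. -/

namespace PP
variable {n : ℕ}

/-- The homogeneous prime ideal of a point of projective space. -/
def ideal (x : PP n) : Ideal (MvPolynomial (Fin (n + 1)) ℂ) :=
  (show ProjectiveSpectrum (homogeneousSubmodule (Fin (n + 1)) ℂ) from x).asHomogeneousIdeal.toIdeal

instance (x : PP n) : (ideal x).IsPrime :=
  (show ProjectiveSpectrum (homogeneousSubmodule (Fin (n + 1)) ℂ) from x).isPrime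

theorem ideal_isHomogeneous (x : PP n) :
    (ideal x).IsHomogeneous (homogeneousSubmodule (Fin (n + 1)) ℂ) :=
  (show ProjectiveSpectrum (homogeneousSubmodule (Fin (n + 1)) ℂ) from
    x).asHomogeneousIdeal.isHomogeneous

theorem specializes_iff {w z : PP n} : w ⤳ z ↔ ideal w ≤ ideal z := by
  rw [specializes_iff_mem_closure]
  exact (ProjectiveSpectrum.le_iff_mem_closure
    (𝒜 := homogeneousSubmodule (Fin (n + 1)) ℂ) w z).symm

theorem le_iff {w z : PP n} : z ≤ w ↔ ideal w ≤ ideal z := specializes_iff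

theorem ideal_injective : Function.Injective (ideal (n := n)) := by
  intro x y h
  exact ProjectiveSpectrum.ext (HomogeneousIdeal.toIdeal_injective h)

theorem mem_zeros {s : Set (MvPolynomial (Fin (n + 1)) ℂ)} {x : PP n} :
    x ∈ zeros s ↔ s ⊆ ideal x := Iff.rfl

theorem X_mem_irrelevant (i : Fin (n + 1)) :
    (X i : MvPolynomial (Fin (n + 1)) ℂ) ∈
      HomogeneousIdeal.irrelevant (homogeneousSubmodule (Fin (n + 1)) ℂ) := by
  rw [HomogeneousIdeal.mem_irrelevant_iff, GradedRing.proj_apply,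
    DirectSum.decompose_of_mem_ne (ℳ := homogeneousSubmodule (Fin (n + 1)) ℂ)
      (show X i ∈ homogeneousSubmodule (Fin (n + 1)) ℂ 1 from isHomogeneous_X _ i) one_ne_zero]

theorem irrelevant_le_span_X :
    (HomogeneousIdeal.irrelevant (homogeneousSubmodule (Fin (n + 1)) ℂ)).toIdeal ≤
      Ideal.span (Set.range X) := by
  intro f hf
  rw [HomogeneousIdeal.mem_iff, HomogeneousIdeal.mem_irrelevant_iff, GradedRing.proj_apply,
    show DirectSum.decompose (homogeneousSubmodule (Fin (n + 1)) ℂ) f 0 = homogeneousComponent 0 f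
      from decomposition.decompose'_apply f 0] at hf
  rw [homogeneousComponent_zero, C_eq_zero] at hf
  rw [← Set.image_univ, mem_ideal_span_X_image]
  intro m hm
  by_contra! h
  have : m = 0 := by ext i; simpa using h i
  exact (mem_support_iff.1 hm) (this ▸ hf)

theorem exists_X_notMem (x : PP n) : ∃ i, (X i : MvPolynomial (Fin (n + 1)) ℂ) ∉ ideal x := by
  by_contra! h
  refine ProjectiveSpectrum.not_irrelevant_le
    (show ProjectiveSpectrum (homogeneousSubmodule (Fin (n + 1)) ℂ) from x) ?_
  refine irrelevant_le_span_X.trans (Ideal.span_le.2 ?_)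
  rintro _ ⟨i, rfl⟩
  exact h i

/-- A relevant homogeneous prime ideal as a point. -/
def mk (P : Ideal (MvPolynomial (Fin (n + 1)) ℂ)) (hP : P.IsPrime)
    (hh : P.IsHomogeneous (homogeneousSubmodule (Fin (n + 1)) ℂ))
    (hX : ∃ i, (X i : MvPolynomial (Fin (n + 1)) ℂ) ∉ P) : PP n :=
  show ProjectiveSpectrum (homogeneousSubmodule (Fin (n + 1)) ℂ) from
  { asHomogeneousIdeal := ⟨P, hh⟩
    isPrime := hP
    not_irrelevant_le := fun h => by
      obtain ⟨i, hi⟩ := hX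
      exact hi (h (X_mem_irrelevant i)) }


/-- The local ring at `w` is the homogeneous localization. -/
def stalkEquiv (w : PP n) : (PP n).presheaf.stalk w ≃+*
    HomogeneousLocalization.AtPrime (homogeneousSubmodule (Fin (n + 1)) ℂ) (ideal w) :=
  id (Proj.stalkIso' (homogeneousSubmodule (Fin (n + 1)) ℂ) w)

theorem stalkEquiv_germ (w : PP n) (U : (PP n).Opens) (hw : w ∈ U) 
  (s : (ProjectiveSpectrum.Proj.structureSheaf (homogeneousSubmodule (Fin (n + 1)) ℂ)).1.obj (Opposite.op U)) :
    stalkEquiv w ((PP n).presheaf.germ U w hw s) = s.1 ⟨w, hw⟩ := 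
  Proj.stalkIso'_germ (homogeneousSubmodule (Fin (n + 1)) ℂ) U w hw s

/-- The image consists of fractions of degree zero. The target is the whole field of fractions of
S/P, so that numerator and denominator can be treated separately. -/
def stalkToResidue (w : PP n) : (PP n).presheaf.stalk w →+* (ideal w).ResidueField :=
  ((algebraMap (Localization.AtPrime (ideal w)) (ideal w).ResidueField).comp
    (algebraMap (HomogeneousLocalization.AtPrime (homogeneousSubmodule (Fin (n + 1)) ℂ) (ideal w)) (Localization.AtPrime (ideal w)))).comp
    (stalkEquiv w : _ →+* _)

/-- A germ at `z` is the germ of a fraction on the basic open set of its denominator; this set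
contains `w`, and there the same fraction represents the specialized germ. -/
theorem exists_stalkEquiv_specializes {w z : PP n} (h : w ⤳ z) (x : (PP n).presheaf.stalk z) :
   ∃ (d : ℕ) (a s : homogeneousSubmodule (Fin (n + 1)) ℂ d) (hz : (s : MvPolynomial (Fin (n + 1)) ℂ) ∈ (ideal z).primeCompl)
     (hw : (s : MvPolynomial (Fin (n + 1)) ℂ) ∈ (ideal w).primeCompl),
     stalkEquiv z x = .mk ⟨d, a, s, hz⟩ ∧
      stalkEquiv w ((PP n).presheaf.stalkSpecializes h x) = .mk ⟨d, a, s, hw⟩ := by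
  obtain ⟨y, rfl⟩ := (stalkEquiv z).symm.surjective x
  obtain ⟨f, rfl⟩ := HomogeneousLocalization.mk_surjective y
  have hw : (f.den : MvPolynomial (Fin (n + 1)) ℂ) ∈ (ideal w).primeCompl := 
    fun h' => f.den_mem (specializes_iff.1 h h')
  refine ⟨f.deg, f.num, f.den, f.den_mem, hw, ?_, ?_⟩
  · rw [RingEquiv.apply_symm_apply]
  · have e : (stalkEquiv z).symm (.mk f) = (PP n).presheaf.germ _ z (mem_basicOpen_den _ z f) (sectionInBasicOpen _ z f) := Proj.stalkIso'_symm_mk _ z f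
    rw [e]
    have := TopCat.Presheaf.germ_stalkSpecializes_apply (PP n).presheaf (x:=w) (y:=z) 
      (U := ProjectiveSpectrum.basicOpen _ f.den) (mem_basicOpen_den _ z f) h (sectionInBasicOpen _ z f)
    erw [this]
    exact stalkEquiv_germ w _ hw _ 

theorem stalkToResidue_of_eq_mk {w : PP n} {x : (PP n).presheaf.stalk w} {d : ℕ}
    {a s : homogeneousSubmodule (Fin (n + 1)) ℂ d}
    {hs : (s : MvPolynomial (Fin (n + 1)) ℂ) ∈ (ideal w).primeCompl}
    (hx : stalkEquiv w x = .mk ⟨d, a, s, hs⟩) :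
    stalkToResidue w x = algebraMap _ (ideal w).ResidueField (a : MvPolynomial (Fin (n + 1)) ℂ) /
      algebraMap _ (ideal w).ResidueField (s : MvPolynomial (Fin (n + 1)) ℂ) := by
  have hs0 : algebraMap _ (ideal w).ResidueField (s : MvPolynomial (Fin (n + 1)) ℂ) ≠ 0 := by
    rwa [Ne, Ideal.algebraMap_residueField_eq_zero]
  rw [eq_div_iff hs0]
  simp only [stalkToResidue, RingHom.comp_apply, RingHom.coe_coe, hx]
  rw [HomogeneousLocalization.algebraMap_apply, HomogeneousLocalization.val_mk,
    IsScalarTower.algebraMap_apply (MvPolynomial (Fin (n + 1)) ℂ) (Localization.AtPrime (ideal w))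
      (ideal w).ResidueField,
    ← map_mul, IsScalarTower.algebraMap_apply (MvPolynomial (Fin (n + 1)) ℂ) (Localization.AtPrime (ideal w))
      (ideal w).ResidueField (a : MvPolynomial (Fin (n + 1)) ℂ)]
  congr 1
  rw [Localization.mk_eq_mk']
  exact IsLocalization.mk'_spec (Localization.AtPrime (ideal w)) (a : MvPolynomial (Fin (n + 1)) ℂ)
    ⟨(s : MvPolynomial (Fin (n + 1)) ℂ), hs⟩

/-- Needed to factor the map through the residue field of the stalk: a fraction with nonzero image
has its numerator outside the prime. -/
instance (w : PP n) : IsLocalHom (stalkToResidue w) where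
  map_nonunit x hx := by
    obtain ⟨f, hf⟩ := HomogeneousLocalization.mk_surjective (stalkEquiv w x)
    have h := stalkToResidue_of_eq_mk (a := f.num) (s := f.den) (hs := f.den_mem) hf.symm
    rw [h, isUnit_iff_ne_zero] at hx
    have hn : (f.num : MvPolynomial (Fin (n + 1)) ℂ) ∉ ideal w := fun h' =>
      hx (by rw [Ideal.algebraMap_residueField_eq_zero.2 h', zero_div])
    suffices IsUnit (stalkEquiv w x) from (isUnit_map_iff _ _).1 this
    rw [← hf, ← HomogeneousLocalization.isUnit_iff_isUnit_val, HomogeneousLocalization.val_mk,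
      Localization.mk_eq_mk']
    exact (IsLocalization.AtPrime.isUnit_mk'_iff _ (ideal w) _ _).2 hn

/-- The residue field of `w` embedded in the residue field of its prime ideal. -/
def residueEmb (w : PP n) : (PP n).residueField w →+* (ideal w).ResidueField :=
  IsLocalRing.ResidueField.lift (stalkToResidue w)

theorem residueEmb_injective (w : PP n) : Function.Injective (residueEmb w) :=
  (residueEmb w).injective

/-- The class of a polynomial in the residue field of the prime ideal of `w`. -/
abbrev res (w : PP n) : MvPolynomial (Fin (n + 1)) ℂ →+* (ideal w).ResidueField :=
  algebraMap _ _

theorem res_eq_zero {w : PP n} {a : MvPolynomial (Fin (n + 1)) ℂ} : res w a = 0 ↔ a ∈ ideal w :=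
  Ideal.algebraMap_residueField_eq_zero

theorem exists_residueEmb_eq {w z : PP n} {h : w ⤳ z} {x : (PP n).residueField w}
    (hx : x ∈ Chow.localRing h) : ∃ (d : ℕ) (a s : MvPolynomial (Fin (n + 1)) ℂ),
      a.IsHomogeneous d ∧ s.IsHomogeneous d ∧ s ∉ ideal z ∧ residueEmb w x = res w a / res w s := by
  obtain ⟨y, rfl⟩ := hx
  obtain ⟨d, a, s, hz, hw, -, h2⟩ := exists_stalkEquiv_specializes h y
  exact ⟨d, a, s, a.2, s.2, hz, stalkToResidue_of_eq_mk h2⟩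

theorem exists_mem_localRing {w z : PP n} (h : w ⤳ z) {d : ℕ} {a s : MvPolynomial (Fin (n + 1)) ℂ}
    (ha : a.IsHomogeneous d) (hs : s.IsHomogeneous d) (hz : s ∉ ideal z) :
    ∃ x ∈ Chow.localRing h, residueEmb w x = res w a / res w s := by
  obtain ⟨d', a', s', hz', hw', h1, h2⟩ := exists_stalkEquiv_specializes h
    ((stalkEquiv z).symm (.mk ⟨d, ⟨a, ha⟩, ⟨s, hs⟩, hz⟩))
  refine ⟨_, ⟨(stalkEquiv z).symm (.mk ⟨d, ⟨a, ha⟩, ⟨s, hs⟩, hz⟩), rfl⟩, ?_⟩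
  refine (stalkToResidue_of_eq_mk h2).trans ?_
  -- The fraction that represents the germ need not be `a / s` literally; both are equal in the
  -- localization at `z`, and in a domain this gives equality of cross products.
  rw [RingEquiv.apply_symm_apply] at h1
  have hs' : s ∉ ideal w := fun h' => hz (specializes_iff.1 h h')
  rw [div_eq_div_iff (by rwa [Ne, Ideal.algebraMap_residueField_eq_zero])
    (by rwa [Ne, Ideal.algebraMap_residueField_eq_zero]), ← map_mul, ← map_mul]
  have h3 := congrArg HomogeneousLocalization.val h1
  simp only [HomogeneousLocalization.val_mk, Localization.mk_eq_mk'] at h3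
  rw [IsLocalization.mk'_eq_iff_eq, IsLocalization.eq_iff_exists (ideal z).primeCompl] at h3
  obtain ⟨⟨c, hc⟩, h3⟩ := h3
  have hc0 : c ≠ 0 := fun h0 => hc (h0 ▸ zero_mem _)
  have h4 := mul_left_cancel₀ hc0 h3
  simp only at h4
  congr 1
  linear_combination -h4

theorem exists_residueEmb_eq_div {w : PP n} (x : (PP n).residueField w) :
    ∃ (d : ℕ) (a s : MvPolynomial (Fin (n + 1)) ℂ),
      a.IsHomogeneous d ∧ s.IsHomogeneous d ∧ s ∉ ideal w ∧ residueEmb w x = res w a / res w s := by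
  obtain ⟨y, rfl⟩ := (PP n).residue_surjective w x
  refine exists_residueEmb_eq (h := specializes_refl w) ⟨y, ?_⟩
  simp [Chow.toFunctionField]

end PP
end

/-! ### Prime filtrations and Hilbert functions of homogeneous ideals. -/

noncomputable section

attribute [local instance] MvPolynomial.gradedAlgebra
open MvPolynomial

namespace HilbertFn

variable {σ K : Type*} [Field K]

/-- Homogeneous ideals of the polynomial ring with its standard grading. -/
abbrev IsHomog (I : Ideal (MvPolynomial σ K)) : Prop :=
  I.IsHomogeneous (homogeneousSubmodule σ K)

theorem decompose_eq (p : MvPolynomial σ K) (d : ℕ) :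
    (DirectSum.decompose (homogeneousSubmodule σ K) p d : MvPolynomial σ K) =
      homogeneousComponent d p :=
  decomposition.decompose'_apply p d

theorem isHomog_iff {I : Ideal (MvPolynomial σ K)} :
    IsHomog I ↔ ∀ p ∈ I, ∀ d, homogeneousComponent d p ∈ I :=
  ⟨fun h p hp d => decompose_eq p d ▸ h d hp, fun h d p hp => (decompose_eq p d).symm ▸ h p hp d⟩

theorem homogeneousComponent_mul {g : MvPolynomial σ K} {s : ℕ} (hg : g.IsHomogeneous s)
    (a : MvPolynomial σ K) (d : ℕ) :
    homogeneousComponent (s + d) (g * a) = g * homogeneousComponent d a := by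
  rw [← decompose_eq, ← decompose_eq]
  exact DirectSum.coe_decompose_mul_add_of_left_mem (homogeneousSubmodule σ K) hg

theorem homogeneousComponent_self {g : MvPolynomial σ K} {s : ℕ} (hg : g.IsHomogeneous s) :
    homogeneousComponent s g = g := by
  rw [homogeneousComponent_of_mem hg, if_pos rfl]

theorem IsHomog.span_singleton {g : MvPolynomial σ K} {s : ℕ} (hg : g.IsHomogeneous s) :
    IsHomog (Ideal.span {g}) :=
  Ideal.homogeneous_span _ _ fun x hx => by
    rw [Set.mem_singleton_iff.1 hx]; exact ⟨s, hg⟩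

/-- The ideal quotient `(I : g)`. -/
def colonBy (I : Ideal (MvPolynomial σ K)) (g : MvPolynomial σ K) : Ideal (MvPolynomial σ K) :=
  Submodule.comap (LinearMap.mulLeft (MvPolynomial σ K) g) I

theorem mem_colonBy {I : Ideal (MvPolynomial σ K)} {g a : MvPolynomial σ K} :
    a ∈ colonBy I g ↔ g * a ∈ I := Iff.rfl

theorem le_colonBy (I : Ideal (MvPolynomial σ K)) (g : MvPolynomial σ K) : I ≤ colonBy I g :=
  fun _ ha => I.mul_mem_left _ ha

theorem IsHomog.colonBy {I : Ideal (MvPolynomial σ K)} (hI : IsHomog I) {g : MvPolynomial σ K}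
    {s : ℕ} (hg : g.IsHomogeneous s) : IsHomog (colonBy I g) :=
  isHomog_iff.2 fun a ha d => mem_colonBy.2 <| by
    rw [← homogeneousComponent_mul hg]
    exact isHomog_iff.1 hI _ ha _

theorem colonBy_eq_self {I : Ideal (MvPolynomial σ K)} [hI : I.IsPrime] {g : MvPolynomial σ K}
    (hg : g ∉ I) : colonBy I g = I :=
  le_antisymm (fun _ ha => (hI.mem_or_mem ha).resolve_left hg) (le_colonBy I g)

/-- Existence of an associated prime, in homogeneous form. Take (I : g) maximal among these with `g`
homogeneous outside `I`. If `a` is not in it, then (I : ga) is again of this kind and contains it,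
hence equals it. -/
theorem exists_colonBy_isPrime [Finite σ] {I : Ideal (MvPolynomial σ K)} (hI : IsHomog I)
    (hne : I ≠ ⊤) :
    ∃ (s : ℕ) (g : MvPolynomial σ K), g.IsHomogeneous s ∧ g ∉ I ∧ (colonBy I g).IsPrime := by
  obtain ⟨J, ⟨s, g, hg, hgI, rfl⟩, hmax⟩ := set_has_maximal_iff_noetherian.2
    (inferInstance : IsNoetherian (MvPolynomial σ K) (MvPolynomial σ K))
    {J | ∃ (s : ℕ) (g : MvPolynomial σ K), g.IsHomogeneous s ∧ g ∉ I ∧ J = colonBy I g}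
    ⟨_, 0, 1, isHomogeneous_one _ _, (Ideal.ne_top_iff_one I).1 hne, rfl⟩
  refine ⟨s, g, hg, hgI, (hI.colonBy hg).isPrime_of_homogeneous_mem_or_mem ?_ ?_⟩
  · rw [Ideal.ne_top_iff_one, mem_colonBy, mul_one]
    exact hgI
  · rintro a b ⟨i, ha⟩ - hab
    refine or_iff_not_imp_left.2 fun hna => ?_
    have h1 : colonBy I g ≤ colonBy I (g * a) := fun x hx => by
      rw [mem_colonBy, mul_right_comm]
      exact I.mul_mem_right _ hx
    have h2 : ¬ colonBy I g < colonBy I (g * a) :=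
      hmax _ ⟨s + i, g * a, hg.mul ha, hna, rfl⟩
    have h3 := eq_of_le_of_not_lt h1 h2
    rw [h3, mem_colonBy, mul_assoc]
    exact hab

theorem lt_sup_span_singleton {I : Ideal (MvPolynomial σ K)} {g : MvPolynomial σ K} (hg : g ∉ I) :
    I < I ⊔ Ideal.span {g} :=
  lt_of_le_of_ne le_sup_left fun h => hg <| by
    rw [h]; exact Ideal.mem_sup_right (Ideal.mem_span_singleton_self g)

/-- A filtration of `S / I` with successive quotients `S / Q` shifted by `s`, for the pairs
`(Q, s)` of the list. -/
inductive PrimeFiltration : Ideal (MvPolynomial σ K) → List (Ideal (MvPolynomial σ K) × ℕ) → Prop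
  | top : PrimeFiltration ⊤ []
  | cons {I : Ideal (MvPolynomial σ K)} {g : MvPolynomial σ K} {s : ℕ}
      {l : List (Ideal (MvPolynomial σ K) × ℕ)} (hI : IsHomog I) (hg : g.IsHomogeneous s)
      (hQ : (colonBy I g).IsPrime) (hl : PrimeFiltration (I ⊔ Ideal.span {g}) l) :
      PrimeFiltration I ((colonBy I g, s) :: l)

theorem exists_primeFiltration [Finite σ] {I : Ideal (MvPolynomial σ K)} (hI : IsHomog I) :
    ∃ l, PrimeFiltration I l := by
  induction I using WellFoundedGT.induction with
  | ind I ih =>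
    by_cases hne : I = ⊤
    · exact ⟨[], hne ▸ .top⟩
    · obtain ⟨s, g, hg, hgI, hQ⟩ := exists_colonBy_isPrime hI hne
      obtain ⟨l, hl⟩ := ih _ (lt_sup_span_singleton hgI) (hI.sup (IsHomog.span_singleton hg))
      exact ⟨_, .cons hI hg hQ hl⟩

theorem PrimeFiltration.mem {I : Ideal (MvPolynomial σ K)}
    {l : List (Ideal (MvPolynomial σ K) × ℕ)} (h : PrimeFiltration I l) :
    ∀ q ∈ l, q.1.IsPrime ∧ IsHomog q.1 ∧ I ≤ q.1 := by
  induction h with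
  | top => simp
  | cons hI hg hQ hl ih =>
    intro q hq
    rcases List.mem_cons.1 hq with rfl | hq
    · exact ⟨hQ, hI.colonBy hg, le_colonBy _ _⟩
    · exact ⟨(ih q hq).1, (ih q hq).2.1, le_sup_left.trans (ih q hq).2.2⟩

/-- The degree `t` part of an ideal. -/
def degreePart (I : Ideal (MvPolynomial σ K)) (t : ℕ) : Submodule K (homogeneousSubmodule σ K t) :=
  (I.restrictScalars K).comap (homogeneousSubmodule σ K t).subtype

theorem mem_degreePart {I : Ideal (MvPolynomial σ K)} {t : ℕ} {x : homogeneousSubmodule σ K t} :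
    x ∈ degreePart I t ↔ (x : MvPolynomial σ K) ∈ I := Iff.rfl

theorem degreePart_mono {I J : Ideal (MvPolynomial σ K)} (h : I ≤ J) (t : ℕ) :
    degreePart I t ≤ degreePart J t := fun _ hx => h hx

instance [Finite σ] (t : ℕ) : FiniteDimensional K (homogeneousSubmodule σ K t) :=
  Module.Finite.iff_fg.2 (homogeneousSubmodule_fg σ K t)

/-- The Hilbert function of `S / I`. -/
def hilb (I : Ideal (MvPolynomial σ K)) (t : ℕ) : ℕ :=
  Module.finrank K (homogeneousSubmodule σ K t ⧸ degreePart I t)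

theorem hilb_top (t : ℕ) : hilb (⊤ : Ideal (MvPolynomial σ K)) t = 0 := by
  have : degreePart (⊤ : Ideal (MvPolynomial σ K)) t = ⊤ := eq_top_iff.2 fun _ _ => trivial
  rw [hilb, this]
  exact Module.finrank_zero_of_subsingleton

theorem hilb_anti [Finite σ] {I J : Ideal (MvPolynomial σ K)} (h : I ≤ J) (t : ℕ) :
    hilb J t ≤ hilb I t :=
  LinearMap.finrank_le_finrank_of_surjective (f := Submodule.factor (degreePart_mono h t))
    (Submodule.factor_surjective _)

theorem hilb_pos [Finite σ] {I : Ideal (MvPolynomial σ K)} {t : ℕ} {x : MvPolynomial σ K}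
    (hx : x.IsHomogeneous t) (hxI : x ∉ I) : 0 < hilb I t := by
  have : Nontrivial (homogeneousSubmodule σ K t ⧸ degreePart I t) :=
    Submodule.Quotient.nontrivial_iff.2 fun h =>
      hxI (show (⟨x, hx⟩ : homogeneousSubmodule σ K t) ∈ degreePart I t from h ▸ trivial)
  exact Module.finrank_pos

/-- Dimension count in the exact sequence 0 → S/(I : g)(-s) → S/I → S/(I + (g)) → 0 in degree `s +
t`. -/
theorem hilb_add [Finite σ] {I : Ideal (MvPolynomial σ K)} (hI : IsHomog I) {g : MvPolynomial σ K}
    {s : ℕ} (hg : g.IsHomogeneous s) (t : ℕ) :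
    hilb I (s + t) = hilb (I ⊔ Ideal.span {g}) (s + t) + hilb (colonBy I g) t := by
  let m : homogeneousSubmodule σ K t →ₗ[K] homogeneousSubmodule σ K (s + t) :=
    ((LinearMap.mulLeft K g).comp (homogeneousSubmodule σ K t).subtype).codRestrict _
      fun x => hg.mul x.2
  let ψ := (degreePart I (s + t)).mkQ.comp m
  let φ := Submodule.factor (degreePart_mono (le_sup_left (b := Ideal.span {g}) (a := I)) (s + t))
  have hker : LinearMap.ker ψ = degreePart (colonBy I g) t := by
    ext x
    simp only [ψ, LinearMap.mem_ker, LinearMap.comp_apply, Submodule.mkQ_apply,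
      Submodule.Quotient.mk_eq_zero]
    exact Iff.rfl
  have hφ : LinearMap.range φ = ⊤ := LinearMap.range_eq_top.2 (Submodule.factor_surjective _)
  have hex : LinearMap.ker φ = LinearMap.range ψ := by
    ext y
    obtain ⟨x, rfl⟩ := Submodule.mkQ_surjective _ y
    constructor
    · intro h
      have h1 : (x : MvPolynomial σ K) ∈ I ⊔ Ideal.span {g} := by
        have : φ ((degreePart I (s + t)).mkQ x) = 0 := h
        simpa [φ, Submodule.Quotient.mk_eq_zero, mem_degreePart] using this
      obtain ⟨a, ha, b, hb, hab⟩ := Submodule.mem_sup.1 h1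
      obtain ⟨c, rfl⟩ := Ideal.mem_span_singleton'.1 hb
      -- The cofactor `c` need not be homogeneous; only its component of degree `t` contributes in
      -- degree `s + t`.
      refine ⟨⟨homogeneousComponent t c, homogeneousComponent_isHomogeneous t c⟩, ?_⟩
      refine (Submodule.Quotient.eq _).2 (mem_degreePart.2 ?_)
      have h2 : (x : MvPolynomial σ K) = homogeneousComponent (s + t) a +
          g * homogeneousComponent t c := by
        rw [← homogeneousComponent_mul hg, ← map_add, mul_comm g, hab,
          homogeneousComponent_self x.2]
      have h3 := I.neg_mem (isHomog_iff.1 hI a ha (s + t))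
      convert h3 using 1
      change g * homogeneousComponent t c - (x : MvPolynomial σ K) = _
      rw [h2]; ring
    · rintro ⟨c, hc⟩
      rw [← hc]
      change φ ((degreePart I (s + t)).mkQ (m c)) = 0
      refine (Submodule.Quotient.mk_eq_zero (degreePart _ _)).2 (mem_degreePart.2 ?_)
      exact Ideal.mem_sup_right (Ideal.mul_mem_right _ _ (Ideal.mem_span_singleton_self g))
  have h1 := LinearMap.finrank_range_add_finrank_ker φ
  rw [hφ, finrank_top, hex, ← (LinearMap.quotKerEquivRange ψ).finrank_eq, hker] at h1
  exact h1.symm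

theorem hilb_add_of_isPrime [Finite σ] {I : Ideal (MvPolynomial σ K)} [I.IsPrime] (hI : IsHomog I)
    {g : MvPolynomial σ K} {s : ℕ} (hg : g.IsHomogeneous s) (hgI : g ∉ I) (t : ℕ) :
    hilb I (s + t) = hilb (I ⊔ Ideal.span {g}) (s + t) + hilb I t := by
  rw [hilb_add hI hg, colonBy_eq_self hgI]

end HilbertFn
end

/-! ### Hilbert polynomials. -/

noncomputable section

attribute [local instance] MvPolynomial.gradedAlgebra

namespace HilbertFn
open Polynomial in
/-- The sequence `f` is eventually given by the polynomial `p`. -/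
def EventuallyPoly (f : ℕ → ℕ) (p : ℚ[X]) : Prop :=
  ∀ᶠ t : ℕ in Filter.atTop, (f t : ℚ) = p.eval (t : ℚ)

-- The difference operator is onto: it sends X^(d+1) to (d+1) X^d plus lower terms, so each X^d is
-- reached by induction.
open Polynomial in
theorem exists_taylor_sub_eq (q : ℚ[X]) : ∃ p : ℚ[X], taylor 1 p - p = q := by
  let D : ℚ[X] →ₗ[ℚ] ℚ[X] := taylor 1 - LinearMap.id
  suffices h : ∀ d : ℕ, (X ^ d : ℚ[X]) ∈ LinearMap.range D by
    have : q ∈ LinearMap.range D := by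
      rw [q.as_sum_range_C_mul_X_pow]
      refine Submodule.sum_mem _ fun i _ => ?_
      rw [← smul_eq_C_mul]
      exact Submodule.smul_mem _ _ (h i)
    exact this
  intro d
  induction d using Nat.strong_induction_on with
  | _ d ih =>
    have h1 : D (X ^ (d + 1)) = ∑ i ∈ Finset.range d, ((d + 1).choose i : ℚ) • (X ^ i : ℚ[X]) +
        ((d : ℚ) + 1) • X ^ d := by
      simp only [D, LinearMap.sub_apply, LinearMap.id_apply, taylor_X_pow, C_1, add_pow, one_pow,
        mul_one]
      rw [Finset.sum_range_succ, Finset.sum_range_succ]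
      simp [smul_eq_C_mul, mul_comm]
    have h2 : (X ^ d : ℚ[X]) = ((d : ℚ) + 1)⁻¹ • (D (X ^ (d + 1)) -
        ∑ i ∈ Finset.range d, ((d + 1).choose i : ℚ) • (X ^ i : ℚ[X])) := by
      rw [h1, add_sub_cancel_left, smul_smul, inv_mul_cancel₀ (by positivity), one_smul]
    rw [h2]
    refine Submodule.smul_mem _ _ (Submodule.sub_mem _ ⟨_, rfl⟩ (Submodule.sum_mem _ fun i hi => ?_))
    exact Submodule.smul_mem _ _ (ih i (Finset.mem_range.1 hi))

namespace EventuallyPoly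
open Polynomial

theorem unique {f : ℕ → ℕ} {p q : ℚ[X]} (hp : EventuallyPoly f p) (hq : EventuallyPoly f q) :
    p = q := by
  obtain ⟨N, hN⟩ := Filter.eventually_atTop.1 (hp.and hq)
  refine eq_of_infinite_eval_eq p q (Set.Infinite.mono (s := (fun t : ℕ => (t : ℚ)) '' Set.Ici N) ?_
    ((Set.Ici_infinite N).image Nat.cast_injective.injOn))
  rintro _ ⟨t, ht, rfl⟩
  exact (hN t ht).1.symm.trans (hN t ht).2

theorem exists_of_diff {f g : ℕ → ℕ} {q : ℚ[X]} (hg : EventuallyPoly g q)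
    (h : ∀ t, f (1 + t) = g (1 + t) + f t) : ∃ p, EventuallyPoly f p := by
  -- The recurrence reads f(t+1) - f(t) = g(t+1), so the polynomial to be summed is q(t+1). The
  -- constant added to `p` below matches the value of `f` at `N`.
  obtain ⟨p, hp⟩ := exists_taylor_sub_eq (taylor 1 q)
  obtain ⟨N, hN⟩ := Filter.eventually_atTop.1 hg
  refine ⟨p + C (f N - p.eval (N : ℚ)), Filter.eventually_atTop.2 ⟨N, fun t ht => ?_⟩⟩
  induction t, ht using Nat.le_induction with
  | base => simp
  | succ t ht ih =>
    have h1 := congrArg (eval (t : ℚ)) hp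
    rw [eval_sub, taylor_eval, taylor_eval] at h1
    have h2 := hN (t + 1) (by omega)
    rw [add_comm t 1, h t, add_comm 1 t]
    push_cast at h2 ⊢
    rw [h2, ih]
    simp only [eval_add, eval_C]
    linear_combination -h1

/-- Otherwise q/p tends to zero, whereas g/f is eventually at least one. -/
theorem degree_le {f g : ℕ → ℕ} {p q : ℚ[X]} (hp : EventuallyPoly f p) (hq : EventuallyPoly g q)
    (h : ∀ t, f t ≤ g t) : p.degree ≤ q.degree := by
  by_contra! hlt
  have h1 := (div_tendsto_atTop_zero_of_degree_lt q p hlt).comp (tendsto_natCast_atTop_atTop (R := ℚ))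
  have hp0 : p ≠ 0 := by rintro rfl; simp at hlt
  have hroot : ∀ᶠ t : ℕ in Filter.atTop, p.eval (t : ℚ) ≠ 0 := by
    have : (p.rootSet ℚ).Finite := rootSet_finite p ℚ
    have h2 := (this.preimage (Nat.cast_injective (R := ℚ)).injOn).eventually_cofinite_notMem
    rw [Nat.cofinite_eq_atTop] at h2
    filter_upwards [h2] with t ht h0
    exact ht (by simp [mem_rootSet, hp0, h0])
  have h2 : ∀ᶠ t : ℕ in Filter.atTop, (1 : ℚ) ≤ q.eval (t : ℚ) / p.eval (t : ℚ) := by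
    filter_upwards [hp, hq, hroot] with t h1 h2 h3
    have h4 : (0 : ℚ) < p.eval (t : ℚ) := lt_of_le_of_ne (h1 ▸ Nat.cast_nonneg _) (Ne.symm h3)
    rw [le_div_iff₀ h4, one_mul, ← h1, ← h2]
    exact_mod_cast h t
  exact absurd (ge_of_tendsto h1 h2) (by norm_num)

end EventuallyPoly

open Polynomial in
theorem coeff_taylor_of_natDegree_le {p : ℚ[X]} {k : ℕ} (h : p.natDegree ≤ k) (r : ℚ) :
    (taylor r p).coeff k = p.coeff k := by
  rcases h.lt_or_eq with h | rfl
  · rw [coeff_eq_zero_of_natDegree_lt h, coeff_eq_zero_of_natDegree_lt]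
    rwa [natDegree_taylor]
  · exact coeff_taylor_natDegree _ _

open Polynomial in
theorem degree_sub_taylor_lt {p : ℚ[X]} (hp : p ≠ 0) (r : ℚ) : (p - taylor r p).degree < p.degree :=
  degree_sub_lt_left (degree_taylor p r).symm hp (leadingCoeff_taylor r p).symm

open MvPolynomial

variable {σ K : Type*} [Field K]

theorem hilb_eq_zero_of_X_mem {I : Ideal (MvPolynomial σ K)} (h : ∀ i, X i ∈ I) (t : ℕ) :
    hilb I (t + 1) = 0 := by
  have : degreePart I (t + 1) = ⊤ := by
    refine eq_top_iff.2 fun x _ => mem_degreePart.2 ?_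
    have hle : Ideal.span (X '' Set.univ) ≤ I := Ideal.span_le.2 (by rintro _ ⟨i, -, rfl⟩; exact h i)
    refine hle (mem_ideal_span_X_image.2 fun m hm => ?_)
    by_contra! h0
    have hm0 : m = 0 := by ext i; simpa using h0 i
    have := x.2 (mem_support_iff.1 hm)
    simp [hm0] at this
  rw [hilb, this]
  exact Module.finrank_zero_of_subsingleton

/-- Noetherian induction with the exact sequence of `hilb_add` for a `g` with (I : g) prime. It
fails to reduce only if (I : g) = I. Then `I` is prime, and either it contains all variables and the
function is eventually zero, or a variable outside `I` turns the sequence into a difference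
equation. -/
theorem exists_eventuallyPoly [Finite σ] {I : Ideal (MvPolynomial σ K)} (hI : IsHomog I) :
    ∃ p, EventuallyPoly (hilb I) p := by
  induction I using WellFoundedGT.induction with
  | ind I ih =>
    by_cases hne : I = ⊤
    · exact ⟨0, Filter.Eventually.of_forall fun t => by simp [hne, hilb_top]⟩
    obtain ⟨s, g, hg, hgI, hQ⟩ := exists_colonBy_isPrime hI hne
    obtain ⟨p, hp⟩ := ih _ (lt_sup_span_singleton hgI) (hI.sup (IsHomog.span_singleton hg))
    rcases (le_colonBy I g).lt_or_eq with hlt | heq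
    · obtain ⟨q, hq⟩ := ih _ hlt (hI.colonBy hg)
      refine ⟨p + Polynomial.taylor (-(s : ℚ)) q, ?_⟩
      obtain ⟨N, hN⟩ := Filter.eventually_atTop.1 hq
      filter_upwards [hp, Filter.eventually_ge_atTop (s + N)] with t h1 h2
      obtain ⟨t, rfl⟩ := Nat.exists_eq_add_of_le (show s ≤ t by omega)
      rw [hilb_add hI hg, Nat.cast_add, h1, hN t (by omega), Polynomial.eval_add,
        Polynomial.taylor_eval]
      congr 2
      push_cast; ring
    · rw [← heq] at hQ
      by_cases hX : ∀ i, X i ∈ I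
      · refine ⟨0, Filter.eventually_atTop.2 ⟨1, fun t ht => ?_⟩⟩
        obtain ⟨t, rfl⟩ := Nat.exists_eq_add_of_le' ht
        simp [hilb_eq_zero_of_X_mem hX]
      · push Not at hX
        obtain ⟨i, hi⟩ := hX
        obtain ⟨q, hq⟩ := ih _ (lt_sup_span_singleton hi)
          (hI.sup (IsHomog.span_singleton (isHomogeneous_X K i)))
        exact hq.exists_of_diff (hilb_add_of_isPrime hI (isHomogeneous_X K i) hi)

open Classical in
/-- The Hilbert polynomial of `S / I`. -/
def hilbPoly (I : Ideal (MvPolynomial σ K)) : Polynomial ℚ :=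
  if h : ∃ p, EventuallyPoly (hilb I) p then h.choose else 0

theorem eventuallyPoly_hilbPoly [Finite σ] {I : Ideal (MvPolynomial σ K)} (hI : IsHomog I) :
    EventuallyPoly (hilb I) (hilbPoly I) := by
  have h := exists_eventuallyPoly hI
  rw [hilbPoly, dif_pos h]
  exact h.choose_spec

theorem hilbPoly_add [Finite σ] {I : Ideal (MvPolynomial σ K)} (hI : IsHomog I)
    {g : MvPolynomial σ K} {s : ℕ} (hg : g.IsHomogeneous s) :
    hilbPoly I = hilbPoly (I ⊔ Ideal.span {g}) +
      Polynomial.taylor (-(s : ℚ)) (hilbPoly (colonBy I g)) := by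
  refine (eventuallyPoly_hilbPoly hI).unique ?_
  obtain ⟨N, hN⟩ := Filter.eventually_atTop.1 (eventuallyPoly_hilbPoly (hI.colonBy hg))
  filter_upwards [eventuallyPoly_hilbPoly (hI.sup (IsHomog.span_singleton hg)),
    Filter.eventually_ge_atTop (s + N)] with t h1 h2
  obtain ⟨t, rfl⟩ := Nat.exists_eq_add_of_le (show s ≤ t by omega)
  rw [hilb_add hI hg, Nat.cast_add, h1, hN t (by omega), Polynomial.eval_add,
    Polynomial.taylor_eval]
  congr 2
  push_cast; ring

theorem hilbPoly_top : hilbPoly (⊤ : Ideal (MvPolynomial σ K)) = 0 := by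
  have h : EventuallyPoly (hilb (⊤ : Ideal (MvPolynomial σ K))) 0 :=
    Filter.Eventually.of_forall fun t => by simp [hilb_top]
  have h' : ∃ p, EventuallyPoly (hilb (⊤ : Ideal (MvPolynomial σ K))) p := ⟨0, h⟩
  rw [hilbPoly, dif_pos h']
  exact h'.choose_spec.unique h

theorem degree_hilbPoly_anti [Finite σ] {I J : Ideal (MvPolynomial σ K)} (hI : IsHomog I)
    (hJ : IsHomog J) (h : I ≤ J) : (hilbPoly J).degree ≤ (hilbPoly I).degree :=
  (eventuallyPoly_hilbPoly hJ).degree_le (eventuallyPoly_hilbPoly hI) (hilb_anti h)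

/-- All powers of the variable stay outside the prime, so the Hilbert function never vanishes. -/
theorem hilbPoly_ne_zero [Finite σ] {I : Ideal (MvPolynomial σ K)} [hp : I.IsPrime]
    (hI : IsHomog I) {i : σ} (hi : X i ∉ I) : hilbPoly I ≠ 0 := by
  intro h0
  obtain ⟨N, hN⟩ := Filter.eventually_atTop.1 (eventuallyPoly_hilbPoly hI)
  have h1 := hN N le_rfl
  rw [h0, Polynomial.eval_zero, Nat.cast_eq_zero] at h1
  have h2 := hilb_pos (I := I) (isHomogeneous_X_pow (R := K) i N)
    fun h => hi (hp.mem_of_pow_mem N h)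
  omega

theorem hilbPoly_eq_zero {I : Ideal (MvPolynomial σ K)} (h : ∀ i, X i ∈ I) : hilbPoly I = 0 := by
  have h1 : EventuallyPoly (hilb I) 0 := by
    refine Filter.eventually_atTop.2 ⟨1, fun t ht => ?_⟩
    obtain ⟨t, rfl⟩ := Nat.exists_eq_add_of_le' ht
    simp [hilb_eq_zero_of_X_mem h]
  have h' : ∃ p, EventuallyPoly (hilb I) p := ⟨0, h1⟩
  rw [hilbPoly, dif_pos h']
  exact h'.choose_spec.unique h1

/-- A shift of the argument does not affect the coefficient of t^k when the degree is at most `k`.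
Hence that coefficient is additive and forgets the shifts in the list. -/
theorem PrimeFiltration.hilbPoly [Finite σ] {I : Ideal (MvPolynomial σ K)}
    {l : List (Ideal (MvPolynomial σ K) × ℕ)} (h : PrimeFiltration I l) {k : ℕ}
    (hk : ∀ q ∈ l, (HilbertFn.hilbPoly q.1).natDegree ≤ k) :
    (HilbertFn.hilbPoly I).natDegree ≤ k ∧ (HilbertFn.hilbPoly I).coeff k =
      (l.map fun q => (HilbertFn.hilbPoly q.1).coeff k).sum := by
  induction h with
  | top => simp [hilbPoly_top]
  | cons hI hg hQ hl ih =>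
    obtain ⟨h1, h2⟩ := ih fun q hq => hk q (List.mem_cons_of_mem _ hq)
    have h3 := hk _ List.mem_cons_self
    rw [hilbPoly_add hI hg, List.map_cons, List.sum_cons, Polynomial.coeff_add, h2,
      coeff_taylor_of_natDegree_le h3]
    refine ⟨Polynomial.natDegree_add_le_of_degree_le h1 ?_, add_comm _ _⟩
    rwa [Polynomial.natDegree_taylor]

/-- Every homogeneous ideal has a prime filtration piece of at least the dimension of the ideal. -/
theorem PrimeFiltration.exists_degree_le [Finite σ] {I : Ideal (MvPolynomial σ K)}
    {l : List (Ideal (MvPolynomial σ K) × ℕ)} (h : PrimeFiltration I l)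
    (hne : HilbertFn.hilbPoly I ≠ 0) :
    ∃ q ∈ l, (HilbertFn.hilbPoly I).degree ≤ (HilbertFn.hilbPoly q.1).degree := by
  induction h with
  | top => exact absurd hilbPoly_top hne
  | @cons I g s l hI hg hQ hl ih =>
    have h1 := hilbPoly_add hI hg
    by_cases hd : (HilbertFn.hilbPoly I).degree ≤ (HilbertFn.hilbPoly (colonBy I g)).degree
    · exact ⟨_, List.mem_cons_self, hd⟩
    · have h2 : (HilbertFn.hilbPoly I).degree ≤
          (HilbertFn.hilbPoly (I ⊔ Ideal.span {g})).degree := by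
        by_contra! h3
        have h4 := Polynomial.degree_add_le (HilbertFn.hilbPoly (I ⊔ Ideal.span {g}))
          (Polynomial.taylor (-(s : ℚ)) (HilbertFn.hilbPoly (colonBy I g)))
        rw [← h1, Polynomial.degree_taylor] at h4
        exact absurd h4 (not_le.2 (max_lt h3 (not_le.1 hd)))
      have h3 : HilbertFn.hilbPoly (I ⊔ Ideal.span {g}) ≠ 0 := by
        intro h0
        rw [h0, Polynomial.degree_zero, le_bot_iff, Polynomial.degree_eq_bot] at h2
        exact hne h2
      obtain ⟨q, hq, h4⟩ := ih h3
      exact ⟨q, List.mem_cons_of_mem _ hq, h2.trans h4⟩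

end HilbertFn
end

/-! ### The dimension of a point is the degree of its Hilbert polynomial. -/

noncomputable section

attribute [local instance] MvPolynomial.gradedAlgebra
open MvPolynomial HilbertFn

namespace HilbertFn
-- The difference p(t) - p(t-1) has degree exactly one less: its coefficient of t^d is d+1 times the
-- leading coefficient of p.
open Polynomial in
theorem coeff_sub_taylor_ne_zero {p : ℚ[X]} {d : ℕ} (hp : p.natDegree = d + 1) :
    (p - taylor (-1) p).coeff d ≠ 0 := by
  have h1 : (hasseDeriv d p).natDegree < 2 := by
    have := natDegree_hasseDeriv_le p d
    omega
  have h2 : p.coeff (d + 1) ≠ 0 := by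
    rw [← hp]
    exact leadingCoeff_ne_zero.2 (fun h => by simp [h] at hp)
  rw [Polynomial.coeff_sub, taylor_coeff, eval_eq_sum_range' h1]
  simp only [Finset.sum_range_succ, Finset.sum_range_zero, hasseDeriv_coeff]
  have h3 : (((d + 1).choose d : ℕ) : ℚ) = d + 1 := by simp
  rw [add_comm 1 d, h3]
  simp only [zero_add, Nat.choose_self, Nat.cast_one, one_mul, pow_zero, mul_one, pow_one, mul_neg]
  intro h
  have : ((d : ℚ) + 1) * p.coeff (d + 1) = 0 := by linarith
  rcases mul_eq_zero.1 this with h | h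
  · exact (by positivity : (d : ℚ) + 1 ≠ 0) h
  · exact h2 h
end HilbertFn

namespace PP
variable {n : ℕ}

theorem lt_iff {w z : PP n} : z < w ↔ ideal w < ideal z := by
  rw [lt_iff_le_not_ge, lt_iff_le_not_ge, le_iff, le_iff]

theorem hilbPoly_ideal_ne_zero (x : PP n) : hilbPoly (ideal x) ≠ 0 := by
  obtain ⟨i, hi⟩ := exists_X_notMem x
  exact hilbPoly_ne_zero (ideal_isHomogeneous x) hi

/-- The dimension of the subvariety with generic point `x`. -/
def dim (x : PP n) : ℕ := (hilbPoly (ideal x)).natDegree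

theorem exists_isHomogeneous_notMem {I J : Ideal (MvPolynomial (Fin (n + 1)) ℂ)} (hI : IsHomog I)
    (h : ¬ I ≤ J) : ∃ (d : ℕ) (y : MvPolynomial (Fin (n + 1)) ℂ), y.IsHomogeneous d ∧ y ∈ I ∧
      y ∉ J := by
  obtain ⟨y, hyI, hyJ⟩ := Set.not_subset.1 h
  by_contra! h'
  refine hyJ ?_
  rw [← sum_homogeneousComponent y]
  exact J.sum_mem fun d _ => h' d _ (homogeneousComponent_isHomogeneous d y)
    (isHomog_iff.1 hI y hyI d)

/-- The form `y` is a nonzerodivisor on S/P_w, so the new polynomial is p(t) - p(t-d). The bound is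
on `degree`, not `natDegree`, to cover closed points, where the new polynomial is zero. -/
theorem degree_hilbPoly_sup_lt {w : PP n} {d : ℕ} {y : MvPolynomial (Fin (n + 1)) ℂ}
    (hy : y.IsHomogeneous d) (hyw : y ∉ ideal w) :
    (hilbPoly (ideal w ⊔ Ideal.span {y})).degree < (hilbPoly (ideal w)).degree := by
  have h1 := hilbPoly_add (ideal_isHomogeneous w) hy
  rw [colonBy_eq_self hyw] at h1
  rw [eq_sub_iff_add_eq.2 h1.symm]
  exact degree_sub_taylor_lt (hilbPoly_ideal_ne_zero w) _

theorem dim_lt_of_lt {w z : PP n} (h : z < w) : dim z < dim w := by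
  rw [lt_iff] at h
  obtain ⟨d, y, hy, hyz, hyw⟩ := exists_isHomogeneous_notMem (ideal_isHomogeneous z) h.not_ge
  refine Polynomial.natDegree_lt_natDegree (hilbPoly_ideal_ne_zero z)
    (lt_of_le_of_lt ?_ (degree_hilbPoly_sup_lt hy hyw))
  exact degree_hilbPoly_anti ((ideal_isHomogeneous w).sup (IsHomog.span_singleton hy))
    (ideal_isHomogeneous z) (sup_le h.le ((Ideal.span_singleton_le_iff_mem _).2 hyz))

theorem exists_point_of_hilbPoly_ne_zero {I : Ideal (MvPolynomial (Fin (n + 1)) ℂ)}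
    (hp : I.IsPrime) (hI : IsHomog I) (h : hilbPoly I ≠ 0) : ∃ x : PP n, ideal x = I := by
  have : ∃ i, (X i : MvPolynomial (Fin (n + 1)) ℂ) ∉ I := by
    by_contra! h'
    exact h (hilbPoly_eq_zero h')
  exact ⟨mk I hp hI this, rfl⟩

/-- Cut `w` by a coordinate hyperplane not containing it. The section has Hilbert polynomial of
degree at least `d`, and some prime in a filtration attains that degree. Its polynomial is nonzero,
so the prime is a point. -/
theorem exists_lt_le_dim {w : PP n} {d : ℕ} (h : dim w = d + 1) : ∃ z < w, d ≤ dim z := by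
  obtain ⟨i, hi⟩ := exists_X_notMem w
  have hXi := isHomogeneous_X ℂ i
  have hJ := (ideal_isHomogeneous w).sup (IsHomog.span_singleton hXi)
  obtain ⟨l, hl⟩ := exists_primeFiltration hJ
  have h1 := hilbPoly_add (ideal_isHomogeneous w) hXi
  rw [colonBy_eq_self hi] at h1
  have h2 := coeff_sub_taylor_ne_zero h
  rw [Nat.cast_one] at h1
  rw [← eq_sub_iff_add_eq.2 h1.symm] at h2
  have h3 : hilbPoly (ideal w ⊔ Ideal.span {X i}) ≠ 0 := fun h0 => h2 (by rw [h0]; simp)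
  obtain ⟨q, hq, h4⟩ := hl.exists_degree_le h3
  obtain ⟨hqp, hqh, hle⟩ := hl.mem q hq
  have h5 : hilbPoly q.1 ≠ 0 := by
    rintro h0
    rw [h0, Polynomial.degree_zero, le_bot_iff, Polynomial.degree_eq_bot] at h4
    exact h3 h4
  obtain ⟨z, hz⟩ := exists_point_of_hilbPoly_ne_zero hqp hqh h5
  refine ⟨z, lt_iff.2 ?_, ?_⟩
  · rw [hz]
    exact lt_of_lt_of_le (lt_sup_span_singleton hi) hle
  · rw [dim, hz]
    exact (Polynomial.le_natDegree_of_ne_zero h2).trans (Polynomial.natDegree_le_natDegree h4)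

/-- Links the order-theoretic dimension used to define cycles with Hilbert polynomials: `dim`
strictly increases along the order, and below a point of positive dimension there is one of
dimension at most one less. -/
theorem height_eq_dim (w : PP n) : Order.height w = (dim w : ℕ∞) := by
  induction h : dim w using Nat.strong_induction_on generalizing w with
  | _ d ih =>
    refine le_antisymm ?_ ?_
    · rw [Order.height_le_coe_iff]
      intro z hz
      have := dim_lt_of_lt hz
      rw [ih (dim z) (h ▸ this) z rfl]
      exact_mod_cast h ▸ this
    · rcases d with _ | d
      · simp
      · obtain ⟨z, hz, hd⟩ := exists_lt_le_dim h
        have h1 := dim_lt_of_lt hz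
        have h2 := ih (dim z) (h ▸ h1) z rfl
        have h3 := Order.height_strictMono hz (by rw [h2]; exact ENat.natCast_lt_top _)
        rw [h2] at h3
        refine le_trans ?_ (Order.add_one_le_of_lt h3)
        exact_mod_cast Nat.add_le_add_right hd 1

theorem eq_of_le_of_dim_eq {w z : PP n} (h : z ≤ w) (hd : dim w ≤ dim z) : z = w := by
  by_contra hne
  have : z < w := lt_iff.2 (lt_of_le_of_ne (le_iff.1 h) fun h' => hne (ideal_injective h').symm)
  exact absurd (dim_lt_of_lt this) (not_lt.2 hd)

end PP
end

/-! ### Orders of vanishing computed from prime filtrations. -/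

noncomputable section

attribute [local instance] MvPolynomial.gradedAlgebra
open MvPolynomial HilbertFn

/-- The class of `γ` generates a submodule of `R ⧸ J` with annihilator exactly `M`, that is, a
simple module, and the quotient by it is R/(J + (γ)). -/
theorem Module.length_quotient_eq_add_one {R : Type*} [CommRing R] {J M : Ideal R}
    (hM : M.IsMaximal) {γ : R} (hγ : γ ∉ J) (h : ∀ m ∈ M, m * γ ∈ J) :
    Module.length R (R ⧸ J) = Module.length R (R ⧸ (J ⊔ Ideal.span {γ})) + 1 := by
  let ψ : R →ₗ[R] R ⧸ J := LinearMap.toSpanSingleton R (R ⧸ J) (Submodule.Quotient.mk γ)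
  have hψ : ∀ r, ψ r = Submodule.Quotient.mk (r * γ) := fun r => rfl
  have hker : LinearMap.ker ψ = M := by
    refine (hM.eq_of_le (J := LinearMap.ker ψ) ?_ fun m hm => ?_).symm
    · rw [Ideal.ne_top_iff_one, LinearMap.mem_ker, hψ, one_mul, Submodule.Quotient.mk_eq_zero]
      exact hγ
    · rw [LinearMap.mem_ker, hψ, Submodule.Quotient.mk_eq_zero]
      exact h m hm
  let φ : (R ⧸ J) →ₗ[R] (R ⧸ (J ⊔ Ideal.span {γ})) := Submodule.factor le_sup_left
  have hsimple : IsSimpleModule R (R ⧸ M) := isSimpleModule_iff_isCoatom.2 hM.out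
  let ψ' : (R ⧸ M) →ₗ[R] R ⧸ J := M.liftQ ψ hker.ge
  have hinj : Function.Injective ψ' := by
    rw [← LinearMap.ker_eq_bot]
    exact Submodule.ker_liftQ_eq_bot _ _ _ hker.le
  have hex : Function.Exact ψ' φ := by
    intro y
    obtain ⟨x, rfl⟩ := Submodule.Quotient.mk_surjective _ y
    constructor
    · intro hx
      have hx' : x ∈ J ⊔ Ideal.span {γ} := (Submodule.Quotient.mk_eq_zero _).1 hx
      obtain ⟨a, ha, b, hb, rfl⟩ := Submodule.mem_sup.1 hx'
      obtain ⟨c, rfl⟩ := Ideal.mem_span_singleton'.1 hb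
      refine ⟨Submodule.Quotient.mk c, (Submodule.Quotient.eq _).2 ?_⟩
      change c * γ - (a + c * γ) ∈ J
      rw [show c * γ - (a + c * γ) = -a by ring]
      exact J.neg_mem ha
    · rintro ⟨c, hc⟩
      obtain ⟨c, rfl⟩ := Submodule.Quotient.mk_surjective _ c
      rw [← hc]
      exact (Submodule.Quotient.mk_eq_zero (J ⊔ Ideal.span {γ})).2
        (Ideal.mem_sup_right (Ideal.mul_mem_left _ _ (Ideal.mem_span_singleton_self γ)))
  rw [Module.length_eq_add_of_exact ψ' φ hinj (Submodule.factor_surjective _) hex,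
    Module.length_eq_one, add_comm]

namespace PP
variable {n : ℕ} {w z : PP n}

/-- The element of the residue field of `w` is the fraction `a / s`, with `a ∈ I` and `s`
homogeneous of the same degree and `s` not vanishing at `z`. -/
def IsFrac (z : PP n) (I : Ideal (MvPolynomial (Fin (n + 1)) ℂ)) (x : (PP n).residueField w) :
    Prop :=
  ∃ (d : ℕ) (a s : MvPolynomial (Fin (n + 1)) ℂ), a.IsHomogeneous d ∧ s.IsHomogeneous d ∧ a ∈ I ∧
    s ∉ ideal z ∧ residueEmb w x = res w a / res w s

theorem res_ne_zero (h : w ⤳ z) {s : MvPolynomial (Fin (n + 1)) ℂ} (hs : s ∉ ideal z) :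
    res w s ≠ 0 := fun h0 => hs (specializes_iff.1 h (res_eq_zero.1 h0))

theorem mul_notMem {z : PP n} {s t : MvPolynomial (Fin (n + 1)) ℂ} (hs : s ∉ ideal z)
    (ht : t ∉ ideal z) : s * t ∉ ideal z :=
  fun h => ((inferInstance : (ideal z).IsPrime).mem_or_mem h).elim hs ht

theorem isFrac_top (h : w ⤳ z) {x : (PP n).residueField w} (hx : x ∈ Chow.localRing h) :
    IsFrac z ⊤ x := by
  obtain ⟨d, a, s, ha, hs, hsz, hx⟩ := exists_residueEmb_eq hx
  exact ⟨d, a, s, ha, hs, trivial, hsz, hx⟩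

/-- The ideal of the local ring of `w` at `z` generated by a homogeneous ideal. -/
def locIdeal (h : w ⤳ z) (I : Ideal (MvPolynomial (Fin (n + 1)) ℂ)) :
    Ideal (Chow.localRing h) where
  carrier := {x | IsFrac z I (x : (PP n).residueField w)}
  zero_mem' := ⟨0, 0, 1, isHomogeneous_zero _ _ _, isHomogeneous_one _ _, zero_mem _,
    (Ideal.ne_top_iff_one _).1 (inferInstance : (ideal z).IsPrime).ne_top, by simp⟩
  add_mem' := by
    rintro x y ⟨d, a, s, ha, hs, haI, hsz, hx⟩ ⟨e, b, t, hb, ht, hbI, htz, hy⟩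
    refine ⟨d + e, a * t + s * b, s * t, (ha.mul ht).add (hs.mul hb), hs.mul ht,
      I.add_mem (I.mul_mem_right _ haI) (I.mul_mem_left _ hbI), mul_notMem hsz htz, ?_⟩
    rw [Subring.coe_add, map_add, hx, hy, div_add_div _ _ (res_ne_zero h hsz) (res_ne_zero h htz)]
    simp only [map_add, map_mul]
  smul_mem' := by
    rintro ⟨c, hc⟩ y ⟨e, b, t, hb, ht, hbI, htz, hy⟩
    obtain ⟨d, a, s, ha, hs, hsz, hx⟩ := exists_residueEmb_eq hc
    refine ⟨d + e, a * b, s * t, ha.mul hb, hs.mul ht, I.mul_mem_left _ hbI, mul_notMem hsz htz, ?_⟩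
    rw [smul_eq_mul, Subring.coe_mul, map_mul, hx, hy, div_mul_div_comm, map_mul, map_mul]

theorem locIdeal_mono (h : w ⤳ z) {I J : Ideal (MvPolynomial (Fin (n + 1)) ℂ)} (hIJ : I ≤ J) :
    locIdeal h I ≤ locIdeal h J := by
  rintro x ⟨d, a, s, ha, hs, haI, hx⟩
  exact ⟨d, a, s, ha, hs, hIJ haI, hx⟩

/-- Equal fractions have cross products that agree only modulo `ideal w`; this is why `I` has to
contain it. -/
theorem mem_of_mem_locIdeal {h : w ⤳ z} {I : Ideal (MvPolynomial (Fin (n + 1)) ℂ)}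
    (hI : ideal w ≤ I) {x : Chow.localRing h} (hx : x ∈ locIdeal h I)
    {a s : MvPolynomial (Fin (n + 1)) ℂ} (hs : s ∉ ideal z)
    (has : residueEmb w x = res w a / res w s) : ∃ t ∉ ideal z, a * t ∈ I := by
  obtain ⟨e, b, t, hb, ht, hbI, htz, hy⟩ := hx
  rw [has, div_eq_div_iff (res_ne_zero h hs) (res_ne_zero h htz), ← map_mul, ← map_mul,
    ← sub_eq_zero, ← map_sub, res_eq_zero] at hy
  exact ⟨t, htz, by simpa using I.add_mem (hI hy) (I.mul_mem_right s hbI)⟩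

theorem locIdeal_ideal_isMaximal (h : w ⤳ z) : (locIdeal h (ideal z)).IsMaximal := by
  refine Ideal.isMaximal_iff.2 ⟨fun h1 => ?_, fun J x hJ hx hxJ => ?_⟩
  · obtain ⟨t, ht, h2⟩ := mem_of_mem_locIdeal (a := 1) (s := 1) (specializes_iff.1 h) h1
      ((Ideal.ne_top_iff_one _).1 (inferInstance : (ideal z).IsPrime).ne_top) (by simp)
    exact ht (by simpa using h2)
  · obtain ⟨d, a, s, ha, hs, hsz, hx'⟩ := exists_residueEmb_eq x.2
    have haz : a ∉ ideal z := fun haz => hx ⟨d, a, s, ha, hs, haz, hsz, hx'⟩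
    obtain ⟨y, hy, hy'⟩ := exists_mem_localRing h hs ha haz
    have : (⟨y, hy⟩ * x : Chow.localRing h) = 1 := by
      refine Subtype.ext (residueEmb_injective w ?_)
      rw [Subring.coe_mul, map_mul, hx', hy', Subring.coe_one, map_one,
        div_mul_div_cancel₀ (res_ne_zero h haz), div_self (res_ne_zero h hsz)]
    rw [← this]
    exact J.mul_mem_left _ hxJ

theorem locIdeal_sup (h : w ⤳ z) {I : Ideal (MvPolynomial (Fin (n + 1)) ℂ)} (hI : IsHomog I)
    {g u : MvPolynomial (Fin (n + 1)) ℂ} {e : ℕ} (hg : g.IsHomogeneous e) (hu : u.IsHomogeneous e)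
    (huz : u ∉ ideal z) {γ : Chow.localRing h} (hγ : residueEmb w γ = res w g / res w u) :
    locIdeal h (I ⊔ Ideal.span {g}) = locIdeal h I ⊔ Ideal.span {γ} := by
  refine le_antisymm ?_ (sup_le (locIdeal_mono h le_sup_left)
    ((Ideal.span_singleton_le_iff_mem _).2 ⟨e, g, u, hg, hu,
      Ideal.mem_sup_right (Ideal.mem_span_singleton_self g), huz, hγ⟩))
  rintro x ⟨d, b, t, hb, ht, hbI, htz, hx⟩
  obtain ⟨a, ha, b', hb', hab⟩ := Submodule.mem_sup.1 hbI
  obtain ⟨c, rfl⟩ := Ideal.mem_span_singleton'.1 hb'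
  -- Neither summand of `b` need be homogeneous. Multiplying by `u` and taking the component of
  -- degree `e + d` gives homogeneous pieces, which become fractions over `u * t` and `t`.
  have h1 : u * b = homogeneousComponent (e + d) (u * a) + g * homogeneousComponent d (u * c) := by
    rw [← homogeneousComponent_mul hg, ← map_add, show u * a + g * (u * c) = u * b by
      rw [← hab]; ring, homogeneousComponent_self (hu.mul hb)]
  obtain ⟨y, hy, hy'⟩ := exists_mem_localRing h
    (homogeneousComponent_isHomogeneous (e + d) (u * a)) (hu.mul ht) (mul_notMem huz htz)
  obtain ⟨v, hv, hv'⟩ := exists_mem_localRing h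
    (homogeneousComponent_isHomogeneous d (u * c)) ht htz
  have h2 : x = ⟨y, hy⟩ + ⟨v, hv⟩ * γ := by
    refine Subtype.ext (residueEmb_injective w ?_)
    rw [Subring.coe_add, Subring.coe_mul, map_add, map_mul, hx, hy', hv', hγ]
    have h3 := congrArg (res w) h1
    rw [map_add, (res w).map_mul, (res w).map_mul] at h3
    have h4 := res_ne_zero h huz
    have h5 := res_ne_zero h htz
    rw [(res w).map_mul u t]
    field_simp
    linear_combination h3
  rw [h2]
  refine Ideal.add_mem _ (Ideal.mem_sup_left ⟨e + d, _, _, homogeneousComponent_isHomogeneous _ _,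
    hu.mul ht, isHomog_iff.1 hI _ (I.mul_mem_left _ ha) _, mul_notMem huz htz, hy'⟩)
    (Ideal.mem_sup_right (Ideal.mul_mem_left _ _ (Ideal.mem_span_singleton_self _)))

theorem exists_isHomogeneous_notMem_ideal (z : PP n) (d : ℕ) :
    ∃ u : MvPolynomial (Fin (n + 1)) ℂ, u.IsHomogeneous d ∧ u ∉ ideal z := by
  obtain ⟨i, hi⟩ := exists_X_notMem z
  exact ⟨X i ^ d, isHomogeneous_X_pow i d, fun h =>
    hi ((inferInstance : (ideal z).IsPrime).mem_of_pow_mem d h)⟩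

open Classical in
/-- The number of times the point `z` occurs in a list of shifted primes. -/
def mult (z : PP n) (l : List (Ideal (MvPolynomial (Fin (n + 1)) ℂ) × ℕ)) : ℕ :=
  l.countP fun q => q.1 = ideal z

/-- Localize the filtration at `z`. A step with quotient S/Q contributes a simple module if Q is the
prime of `z`. Otherwise Q is not contained in that prime, by `hz`, and the step becomes trivial. -/
theorem length_locIdeal (h : w ⤳ z) {I : Ideal (MvPolynomial (Fin (n + 1)) ℂ)}
    {l : List (Ideal (MvPolynomial (Fin (n + 1)) ℂ) × ℕ)} (hl : PrimeFiltration I l)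
    (hI : ideal w ≤ I) (hz : ∀ q ∈ l, q.1 ≤ ideal z → q.1 = ideal z) :
    Module.length (Chow.localRing h) (Chow.localRing h ⧸ locIdeal h I) = mult z l := by
  induction hl with
  | top =>
    have : locIdeal h ⊤ = ⊤ := eq_top_iff.2 fun x _ => isFrac_top h x.2
    rw [this]
    simp [mult]
  | @cons I g s l hIh hg hQ hl ih =>
    have ih' := ih (hI.trans le_sup_left) fun q hq => hz q (List.mem_cons_of_mem _ hq)
    have hz' := hz _ List.mem_cons_self
    obtain ⟨u, hu, huz⟩ := exists_isHomogeneous_notMem_ideal z s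
    obtain ⟨γ, hγR, hγ⟩ := exists_mem_localRing h hg hu huz
    rw [locIdeal_sup (γ := ⟨γ, hγR⟩) h hIh hg hu huz hγ] at ih'
    by_cases hQz : colonBy I g = ideal z
    · rw [Module.length_quotient_eq_add_one (γ := ⟨γ, hγR⟩) (locIdeal_ideal_isMaximal h), ih']
      · simp [mult, hQz]
      · intro hmem
        obtain ⟨t, ht, hgt⟩ := mem_of_mem_locIdeal hI hmem huz hγ
        exact ht (hQz ▸ (mem_colonBy.2 hgt))
      · rintro m ⟨d, a, v, ha, hv, haz, hvz, hm⟩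
        refine ⟨s + d, g * a, u * v, hg.mul ha, hu.mul hv, ?_, mul_notMem huz hvz, ?_⟩
        · rw [← hQz] at haz
          exact haz
        · rw [Subring.coe_mul, map_mul, hm, hγ, mul_comm, div_mul_div_comm, map_mul, map_mul]
    · have hmem : (⟨γ, hγR⟩ : Chow.localRing h) ∈ locIdeal h I := by
        -- An element `a` of (I : g) not vanishing at `z` rewrites g/u as ga/(ua), with numerator in
        -- `I`.
        obtain ⟨d, a, ha, haQ, haz⟩ := exists_isHomogeneous_notMem (hIh.colonBy hg)
          fun hle => hQz (hz' hle)
        refine ⟨s + d, g * a, u * a, hg.mul ha, hu.mul ha, haQ, mul_notMem huz haz, ?_⟩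
        rw [map_mul, map_mul, mul_div_mul_right _ _ (res_ne_zero h haz)]
        exact hγ
      rw [sup_eq_left.2 ((Ideal.span_singleton_le_iff_mem _).2 hmem)] at ih'
      rw [ih']
      simp [mult, hQz]

theorem locIdeal_self (h : w ⤳ z) : locIdeal h (ideal w) = ⊥ := by
  refine eq_bot_iff.2 ?_
  rintro x ⟨d, a, s, ha, hs, haw, hsz, hx⟩
  rw [res_eq_zero.2 haw, zero_div, map_eq_zero] at hx
  exact Subtype.ext hx

theorem ord_eq_mult (h : w ⤳ z) {a u : MvPolynomial (Fin (n + 1)) ℂ} {d : ℕ}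
    (ha : a.IsHomogeneous d) (hu : u.IsHomogeneous d) (huz : u ∉ ideal z)
    {l : List (Ideal (MvPolynomial (Fin (n + 1)) ℂ) × ℕ)}
    (hl : PrimeFiltration (ideal w ⊔ Ideal.span {a}) l)
    (hz : ∀ q ∈ l, q.1 ≤ ideal z → q.1 = ideal z) {x : Chow.localRing h}
    (hx : residueEmb w x = res w a / res w u) : Ring.ord (Chow.localRing h) x = mult z l := by
  rw [Ring.ord, ← length_locIdeal h hl le_sup_left hz,
    locIdeal_sup h (ideal_isHomogeneous w) ha hu huz hx, locIdeal_self, bot_sup_eq]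

/-- The order at `z` of the rational function `a / b` on the subvariety of `w`. -/
theorem hasOrder_iff (h : w ⤳ z) {a b : MvPolynomial (Fin (n + 1)) ℂ} {d : ℕ}
    (ha : a.IsHomogeneous d) (hb : b.IsHomogeneous d) (haw : a ∉ ideal w) (hbw : b ∉ ideal w)
    {la lb : List (Ideal (MvPolynomial (Fin (n + 1)) ℂ) × ℕ)}
    (hla : PrimeFiltration (ideal w ⊔ Ideal.span {a}) la)
    (hlb : PrimeFiltration (ideal w ⊔ Ideal.span {b}) lb)
    (hza : ∀ q ∈ la, q.1 ≤ ideal z → q.1 = ideal z)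
    (hzb : ∀ q ∈ lb, q.1 ≤ ideal z → q.1 = ideal z) {f : (PP n).residueField w}
    (hf : residueEmb w f = res w a / res w b) (m : ℤ) :
    Chow.HasOrder h f m ↔ m = (mult z la : ℤ) - mult z lb := by
  obtain ⟨u, hu, huz⟩ := exists_isHomogeneous_notMem_ideal z d
  obtain ⟨x, hxR, hx⟩ := exists_mem_localRing h ha hu huz
  obtain ⟨y, hyR, hy⟩ := exists_mem_localRing h hb hu huz
  have hx' := ord_eq_mult (x := ⟨x, hxR⟩) h ha hu huz hla hza hx
  have hy' := ord_eq_mult (x := ⟨y, hyR⟩) h hb hu huz hlb hzb hy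
  have ha0 : res w a ≠ 0 := fun h0 => haw (res_eq_zero.1 h0)
  have hb0 : res w b ≠ 0 := fun h0 => hbw (res_eq_zero.1 h0)
  have hu0 := res_ne_zero h huz
  have hy0 : (⟨y, hyR⟩ : Chow.localRing h) ≠ 0 := fun h0 => by
    have : y = 0 := congrArg Subtype.val h0
    rw [this, map_zero, eq_comm, div_eq_zero_iff] at hy
    exact hy.elim hb0 hu0
  have hfy : f * y = x := residueEmb_injective w <| by
    rw [map_mul, hf, hx, hy, div_mul_div_cancel₀ hb0]
  constructor
  · rintro ⟨α, β, p, q, hβ, hαβ, hp, hq, rfl⟩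
    -- The definition allows any presentation α/β of `f`; cross multiplication with x/y and
    -- additivity of `Ring.ord` show that the difference of orders is the same for all.
    have h1 : (⟨x, hxR⟩ : Chow.localRing h) * β = α * ⟨y, hyR⟩ := by
      refine Subtype.ext ?_
      rw [Subring.coe_mul, Subring.coe_mul, ← hαβ]
      change x * (β : (PP n).residueField w) = f * β * y
      rw [← hfy]
      ring
    have h2 := congrArg (Ring.ord (Chow.localRing h)) h1
    rw [Ring.ord_mul _ (mem_nonZeroDivisors_of_ne_zero hβ),
      Ring.ord_mul _ (mem_nonZeroDivisors_of_ne_zero hy0), hx', hy', hp, hq] at h2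
    have h3 : mult z la + q = p + mult z lb := by exact_mod_cast h2
    omega
  · rintro rfl
    exact ⟨⟨x, hxR⟩, ⟨y, hyR⟩, _, _, hy0, hfy, hx', hy', rfl⟩

end PP
end

/-! ### Divisors of rational functions, and the degree map on Chow groups. -/

noncomputable section

attribute [local instance] MvPolynomial.gradedAlgebra
open MvPolynomial HilbertFn

namespace PP
variable {n : ℕ} {k : ℕ} {Z : Closeds (PP n)}

theorem dim_eq (z : Chow.Subvariety k Z) : dim z.1 = k := by
  have := z.2.2
  rw [height_eq_dim] at this
  exact_mod_cast this

/-- The subvariety of `Z` given by a point. -/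
def subvariety {x : PP n} (hx : x ∈ Z) (hd : dim x = k) : Chow.Subvariety k Z :=
  ⟨x, hx, by rw [height_eq_dim, hd]⟩

theorem mem_of_le {w z : PP n} (hw : w ∈ Z) (h : z ≤ w) : z ∈ Z :=
  (specializes_iff.2 (le_iff.1 h)).mem_closed Z.isClosed hw

theorem filtration_mem {w : PP n} {a : MvPolynomial (Fin (n + 1)) ℂ} (ha : a ∉ ideal w)
    {l : List (Ideal (MvPolynomial (Fin (n + 1)) ℂ) × ℕ)}
    (hl : PrimeFiltration (ideal w ⊔ Ideal.span {a}) l) {q : _ × ℕ} (hq : q ∈ l)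
    (hq0 : hilbPoly q.1 ≠ 0) : ∃ y < w, ideal y = q.1 ∧ a ∈ ideal y := by
  obtain ⟨hp, hh, hle⟩ := hl.mem q hq
  obtain ⟨y, hy⟩ := exists_point_of_hilbPoly_ne_zero hp hh hq0
  refine ⟨y, lt_iff.2 (hy ▸ lt_of_lt_of_le (lt_sup_span_singleton ha) hle), hy, hy ▸ hle ?_⟩
  exact Ideal.mem_sup_right (Ideal.mem_span_singleton_self a)

/-- Every relevant prime in the list strictly contains `ideal w`, so its variety has dimension at
most that of `z`; if it also contains `z`, the two coincide. This is the minimality hypothesis of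
`length_locIdeal`. -/
theorem filtration_eq {w z : PP n} (hwz : dim w = dim z + 1)
    {a : MvPolynomial (Fin (n + 1)) ℂ} (ha : a ∉ ideal w)
    {l : List (Ideal (MvPolynomial (Fin (n + 1)) ℂ) × ℕ)}
    (hl : PrimeFiltration (ideal w ⊔ Ideal.span {a}) l) :
    ∀ q ∈ l, q.1 ≤ ideal z → q.1 = ideal z := by
  intro q hq hqz
  obtain ⟨hp, hh, hle⟩ := hl.mem q hq
  have hX : ∃ i, (X i : MvPolynomial (Fin (n + 1)) ℂ) ∉ q.1 := by
    obtain ⟨i, hi⟩ := exists_X_notMem z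
    exact ⟨i, fun h => hi (hqz h)⟩
  obtain ⟨i, hi⟩ := hX
  obtain ⟨y, hyw, hy, -⟩ := filtration_mem ha hl hq (hilbPoly_ne_zero hh hi)
  rw [← hy] at hqz ⊢
  have h1 := dim_lt_of_lt hyw
  rw [eq_of_le_of_dim_eq (le_iff.2 hqz) (by omega)]

open Classical in
/-- The cycle of a shifted prime of dimension `k`. -/
def primeCycle (k : ℕ) (Z : Closeds (PP n)) (I : Ideal (MvPolynomial (Fin (n + 1)) ℂ)) :
    Chow.Cycle k Z :=
  if h : ∃ z : Chow.Subvariety k Z, ideal z.1 = I then Finsupp.single h.choose 1 else 0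

/-- The `k`-dimensional part of the cycle of a list of shifted primes. -/
def listCycle (k : ℕ) (Z : Closeds (PP n))
    (l : List (Ideal (MvPolynomial (Fin (n + 1)) ℂ) × ℕ)) : Chow.Cycle k Z :=
  (l.map fun q => primeCycle k Z q.1).sum

theorem primeCycle_ideal (z : Chow.Subvariety k Z) :
    primeCycle k Z (ideal z.1) = Finsupp.single z 1 := by
  have h : ∃ y : Chow.Subvariety k Z, ideal y.1 = ideal z.1 := ⟨z, rfl⟩
  rw [primeCycle, dif_pos h, Subtype.ext (ideal_injective h.choose_spec)]

theorem primeCycle_eq_zero {I : Ideal (MvPolynomial (Fin (n + 1)) ℂ)}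
    (h : ¬ ∃ z : Chow.Subvariety k Z, ideal z.1 = I) : primeCycle k Z I = 0 := dif_neg h

theorem listCycle_apply (l : List (Ideal (MvPolynomial (Fin (n + 1)) ℂ) × ℕ))
    (z : Chow.Subvariety k Z) : listCycle k Z l z = mult z.1 l := by
  induction l with
  | nil => simp [listCycle, mult]
  | cons q l ih =>
    have h1 : listCycle k Z (q :: l) = primeCycle k Z q.1 + listCycle k Z l := by simp [listCycle]
    rw [h1, Finsupp.add_apply, ih]
    by_cases hq : q.1 = ideal z.1
    · rw [hq, primeCycle_ideal, Finsupp.single_eq_same]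
      simp [mult, hq, add_comm]
    · have h2 : primeCycle k Z q.1 z = 0 := by
        by_cases h : ∃ y : Chow.Subvariety k Z, ideal y.1 = q.1
        · obtain ⟨y, hy⟩ := h
          rw [← hy, primeCycle_ideal, Finsupp.single_apply_eq_zero]
          rintro rfl
          exact absurd hy.symm hq
        · rw [primeCycle_eq_zero h, Finsupp.zero_apply]
      rw [h2]
      simp [mult, hq]

theorem mult_eq_zero {z : PP n} {l : List (Ideal (MvPolynomial (Fin (n + 1)) ℂ) × ℕ)}
    (h : ∀ q ∈ l, q.1 ≠ ideal z) : mult z l = 0 := by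
  rw [mult, List.countP_eq_zero]
  simpa using h

/-- A cycle is the divisor of `a / b` if and only if it is the difference of the cycles of `a`
and `b`. -/
theorem isDivisor_iff (w : Chow.Subvariety (k + 1) Z) {a b : MvPolynomial (Fin (n + 1)) ℂ} {d : ℕ}
    (ha : a.IsHomogeneous d) (hb : b.IsHomogeneous d) (haw : a ∉ ideal w.1) (hbw : b ∉ ideal w.1)
    {la lb : List (Ideal (MvPolynomial (Fin (n + 1)) ℂ) × ℕ)}
    (hla : PrimeFiltration (ideal w.1 ⊔ Ideal.span {a}) la)
    (hlb : PrimeFiltration (ideal w.1 ⊔ Ideal.span {b}) lb) {f : (PP n).residueField w.1}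
    (hf : residueEmb w.1 f = res w.1 a / res w.1 b) (c : Chow.Cycle k Z) :
    Chow.IsDivisor w.1 f c ↔ c = listCycle k Z la - listCycle k Z lb := by
  have key : ∀ z : Chow.Subvariety k Z, (listCycle k Z la - listCycle k Z lb) z =
      (((mult z.1 la : ℤ) - mult z.1 lb : ℤ) : ℚ) := fun z => by
    rw [Finsupp.sub_apply, listCycle_apply, listCycle_apply]; push_cast; rfl
  have hd : ∀ z : Chow.Subvariety k Z, dim w.1 = dim z.1 + 1 := fun z => by
    rw [dim_eq, dim_eq]
  have hord := fun (z : Chow.Subvariety k Z) (h : w.1 ⤳ z.1) => hasOrder_iff h ha hb haw hbw hla hlb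
    (filtration_eq (hd z) haw hla) (filtration_eq (hd z) hbw hlb) hf
  have hno : ∀ z : Chow.Subvariety k Z, ¬ w.1 ⤳ z.1 → mult z.1 la = 0 ∧ mult z.1 lb = 0 :=
    fun z hz => ⟨mult_eq_zero fun q hq h => hz (specializes_iff.2 (h ▸ le_sup_left.trans
      (hla.mem q hq).2.2)), mult_eq_zero fun q hq h => hz (specializes_iff.2 (h ▸ le_sup_left.trans
      (hlb.mem q hq).2.2))⟩
  constructor
  · intro hc
    refine Finsupp.ext fun z => ?_
    rw [key]
    by_cases hz : w.1 ⤳ z.1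
    · obtain ⟨m, hm, hcz⟩ := (hc z).1 hz
      rw [hcz, (hord z hz m).1 hm]
    · rw [(hc z).2 hz, (hno z hz).1, (hno z hz).2]
      simp
  · rintro rfl z
    refine ⟨fun hz => ⟨_, (hord z hz _).2 rfl, key z⟩, fun hz => ?_⟩
    rw [key, (hno z hz).1, (hno z hz).2]
    simp

/-- The degree of a cycle, up to the factor `k!`. -/
def cycleDegree (k : ℕ) (Z : Closeds (PP n)) : Chow.Cycle k Z →ₗ[ℚ] ℚ :=
  Finsupp.linearCombination ℚ fun z => (hilbPoly (ideal z.1)).coeff k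

theorem cycleDegree_single (z : Chow.Subvariety k Z) (c : ℚ) :
    cycleDegree k Z (Finsupp.single z c) = c * (hilbPoly (ideal z.1)).coeff k := by
  simp [cycleDegree]

/-- Additivity of the top coefficient along the filtration. Primes of dimension below `k`, and the
irrelevant ones, contribute zero on both sides. -/
theorem cycleDegree_listCycle (w : Chow.Subvariety (k + 1) Z) {a : MvPolynomial (Fin (n + 1)) ℂ}
    (haw : a ∉ ideal w.1) {l : List (Ideal (MvPolynomial (Fin (n + 1)) ℂ) × ℕ)}
    (hl : PrimeFiltration (ideal w.1 ⊔ Ideal.span {a}) l) :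
    cycleDegree k Z (listCycle k Z l) =
      (hilbPoly (ideal w.1 ⊔ Ideal.span {a})).coeff k := by
  have hdim : ∀ q ∈ l, hilbPoly q.1 ≠ 0 → ∃ y ∈ Z, ideal y = q.1 ∧ dim y ≤ k := by
    intro q hq h0
    obtain ⟨y, hyw, hy, -⟩ := filtration_mem haw hl hq h0
    have h1 := dim_lt_of_lt hyw
    rw [dim_eq] at h1
    exact ⟨y, mem_of_le w.2.1 hyw.le, hy, by omega⟩
  have hk : ∀ q ∈ l, (hilbPoly q.1).natDegree ≤ k := by
    intro q hq
    by_cases h0 : hilbPoly q.1 = 0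
    · simp [h0]
    · obtain ⟨y, -, hy, h1⟩ := hdim q hq h0
      rwa [dim, hy] at h1
  rw [(hl.hilbPoly hk).2, listCycle, map_list_sum, List.map_map]
  congr 1
  refine List.map_congr_left fun q hq => ?_
  by_cases h : ∃ y : Chow.Subvariety k Z, ideal y.1 = q.1
  · obtain ⟨y, hy⟩ := h
    rw [Function.comp_apply, ← hy, primeCycle_ideal, cycleDegree_single, one_mul]
  · rw [Function.comp_apply, primeCycle_eq_zero h, map_zero]
    by_cases h0 : hilbPoly q.1 = 0
    · simp [h0]
    · obtain ⟨y, hyZ, hy, h1⟩ := hdim q hq h0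
      refine (Polynomial.coeff_eq_zero_of_natDegree_lt ?_).symm
      rw [← hy]
      exact lt_of_le_of_ne h1 fun h2 => h ⟨subvariety hyZ h2, hy⟩

/-- Write f = a/b with forms of the same degree d. Both divisors have as degree the coefficient of
t^k in p(t) - p(t-d), where p is the polynomial of `w`. -/
theorem cycleDegree_isDivisor (w : Chow.Subvariety (k + 1) Z) {f : (PP n).residueField w.1}
    (hf : f ≠ 0) {c : Chow.Cycle k Z} (hc : Chow.IsDivisor w.1 f c) : cycleDegree k Z c = 0 := by
  obtain ⟨d, a, b, ha, hb, hbw, hfab⟩ := exists_residueEmb_eq_div f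
  have haw : a ∉ ideal w.1 := fun h => hf <| by
    rw [res_eq_zero.2 h, zero_div, map_eq_zero] at hfab
    exact hfab
  have hw := ideal_isHomogeneous w.1
  obtain ⟨la, hla⟩ := exists_primeFiltration (hw.sup (IsHomog.span_singleton ha))
  obtain ⟨lb, hlb⟩ := exists_primeFiltration (hw.sup (IsHomog.span_singleton hb))
  rw [(isDivisor_iff w ha hb haw hbw hla hlb hfab c).1 hc, map_sub,
    cycleDegree_listCycle w haw hla, cycleDegree_listCycle w hbw hlb]
  have h1 := hilbPoly_add hw ha
  have h2 := hilbPoly_add hw hb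
  rw [colonBy_eq_self haw] at h1
  rw [colonBy_eq_self hbw] at h2
  rw [eq_sub_iff_add_eq.2 h1.symm, eq_sub_iff_add_eq.2 h2.symm, sub_self]

theorem ratEquivZero_le_ker (k : ℕ) (Z : Closeds (PP n)) :
    Chow.ratEquivZero k Z ≤ LinearMap.ker (cycleDegree k Z) :=
  Submodule.span_le.2 <| by
    rintro c ⟨w, f, hf, hc⟩
    exact cycleDegree_isDivisor w hf hc

/-- The degree of a cycle class, up to the factor `k!`. -/
def degree (k : ℕ) (Z : Closeds (PP n)) : Chow.CH k Z →ₗ[ℚ] ℚ :=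
  (Chow.ratEquivZero k Z).liftQ (cycleDegree k Z) (ratEquivZero_le_ker k Z)

/-- The class of a subvariety. -/
def pt (z : Chow.Subvariety k Z) : Chow.CH k Z :=
  (Chow.ratEquivZero k Z).mkQ (Finsupp.single z 1)

theorem degree_pt (z : Chow.Subvariety k Z) :
    degree k Z (pt z) = (hilbPoly (ideal z.1)).coeff k := by
  rw [pt, degree, Submodule.mkQ_apply, Submodule.liftQ_apply, cycleDegree_single, one_mul]

/-- In dimension exactly `k` the coefficient of t^k is the leading one. -/
theorem degree_pt_ne_zero (z : Chow.Subvariety k Z) : degree k Z (pt z) ≠ 0 := by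
  have : degree k Z (pt z) = (hilbPoly (ideal z.1)).leadingCoeff := by
    rw [degree_pt, Polynomial.leadingCoeff]
    congr 1
    exact (dim_eq z).symm
  rw [this, Ne, Polynomial.leadingCoeff_eq_zero]
  exact hilbPoly_ideal_ne_zero _

theorem pushforward_pt {Z' : Closeds (PP n)} (h : Z ≤ Z') (z : Chow.Subvariety k Z) :
    Chow.pushforward k h (pt z) = pt (Chow.Subvariety.incl h z) := by
  rw [pt, Submodule.mkQ_apply, Chow.pushforward, Submodule.mapQ_apply, Finsupp.lmapDomain_apply,
    Finsupp.mapDomain_single]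
  rfl

theorem span_range_pt : Submodule.span ℚ (Set.range (pt : Chow.Subvariety k Z → _)) = ⊤ := by
  refine eq_top_iff.2 fun x _ => ?_
  obtain ⟨c, rfl⟩ := Submodule.mkQ_surjective _ x
  induction c using Finsupp.induction_linear with
  | zero => simp
  | add f g hf hg => rw [map_add]; exact add_mem (hf trivial) (hg trivial)
  | single z r =>
    rw [← mul_one r, ← smul_eq_mul, ← Finsupp.smul_single, map_smul]
    exact Submodule.smul_mem _ _ (Submodule.subset_span ⟨z, rfl⟩)

theorem degree_pushforward {Z' : Closeds (PP n)} (h : Z ≤ Z') (x : Chow.CH k Z) :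
    degree k Z' (Chow.pushforward k h x) = degree k Z x := by
  obtain ⟨c, rfl⟩ := Submodule.mkQ_surjective _ x
  induction c using Finsupp.induction_linear with
  | zero => simp
  | add f g hf hg => simp only [map_add, hf, hg]
  | single z r =>
    rw [← mul_one r, ← smul_eq_mul, ← Finsupp.smul_single, map_smul]
    simp only [map_smul]
    congr 1
    change degree k Z' (Chow.pushforward k h (pt z)) = degree k Z (pt z)
    rw [pushforward_pt, degree_pt, degree_pt]
    rfl

/-- The criterion behind every isomorphism with ℚ: the class of `L` spans the group and has nonzero
degree. -/
theorem degree_bijective (L : Chow.Subvariety k Z)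
    (h : ∀ z : Chow.Subvariety k Z, pt z ∈ Submodule.span ℚ {pt L}) :
    Function.Bijective (degree k Z) := by
  have htop : ∀ x : Chow.CH k Z, x ∈ Submodule.span ℚ {pt L} := fun x => by
    have : Submodule.span ℚ (Set.range (pt : Chow.Subvariety k Z → _)) ≤ Submodule.span ℚ {pt L} :=
      Submodule.span_le.2 (by rintro _ ⟨z, rfl⟩; exact h z)
    rw [span_range_pt] at this
    exact this trivial
  constructor
  · rw [injective_iff_map_eq_zero]
    intro x hx
    obtain ⟨r, rfl⟩ := Submodule.mem_span_singleton.1 (htop x)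
    rw [map_smul, smul_eq_mul, mul_eq_zero] at hx
    rw [hx.resolve_right (degree_pt_ne_zero L), zero_smul]
  · intro r
    exact ⟨(r / degree k Z (pt L)) • pt L, by
      rw [map_smul, smul_eq_mul, div_mul_cancel₀ _ (degree_pt_ne_zero L)]⟩

theorem pushforward_bijective {Z' : Closeds (PP n)} (h : Z ≤ Z')
    (hZ : Function.Bijective (degree k Z)) (hZ' : Function.Bijective (degree k Z')) :
    Function.Bijective (Chow.pushforward k h) := by
  have : ⇑(degree k Z) = degree k Z' ∘ Chow.pushforward k h :=
    funext fun x => (degree_pushforward h x).symm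
  rw [this] at hZ
  exact (Function.Bijective.of_comp_iff' hZ' _).1 hZ

/-- The relation in the Chow group given by the rational function `a / b` on `w`. -/
theorem sum_pt_eq (w : Chow.Subvariety (k + 1) Z) {a b : MvPolynomial (Fin (n + 1)) ℂ} {d : ℕ}
    (ha : a.IsHomogeneous d) (hb : b.IsHomogeneous d) (haw : a ∉ ideal w.1) (hbw : b ∉ ideal w.1)
    {la lb : List (Ideal (MvPolynomial (Fin (n + 1)) ℂ) × ℕ)}
    (hla : PrimeFiltration (ideal w.1 ⊔ Ideal.span {a}) la)
    (hlb : PrimeFiltration (ideal w.1 ⊔ Ideal.span {b}) lb) :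
    (Chow.ratEquivZero k Z).mkQ (listCycle k Z la) =
      (Chow.ratEquivZero k Z).mkQ (listCycle k Z lb) := by
  obtain ⟨x, -, hx⟩ := exists_mem_localRing (specializes_refl w.1) ha hb hbw
  rw [← sub_eq_zero, ← map_sub, Submodule.mkQ_apply, Submodule.Quotient.mk_eq_zero]
  refine Submodule.subset_span ⟨w, x, ?_, (isDivisor_iff w ha hb haw hbw hla hlb hx _).2 rfl⟩
  rintro rfl
  rw [map_zero, eq_comm, div_eq_zero_iff] at hx
  exact hx.elim (fun h => haw (res_eq_zero.1 h)) fun h => hbw (res_eq_zero.1 h)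

end PP
end

/-! ### Elimination: the part of an ideal that involves only some of the variables. -/

noncomputable section

attribute [local instance] MvPolynomial.gradedAlgebra
open MvPolynomial HilbertFn

namespace HilbertFn
variable {σ K : Type*} [Field K]

open Classical in
/-- The coefficient in `p` of the monomial `m` in the variables outside `s`, a polynomial in the
variables of `s`. -/
def outerCoeff (s : Set σ) (p : MvPolynomial σ K) (m : σ →₀ ℕ) : MvPolynomial σ K :=
  ∑ u ∈ p.support with u.filter (· ∉ s) = m, monomial (u.filter (· ∈ s)) (coeff u p)

open Classical in
theorem sum_outerCoeff (s : Set σ) (p : MvPolynomial σ K) :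
    p = ∑ m ∈ p.support.image (fun u => u.filter (· ∉ s)), outerCoeff s p m * monomial m 1 := by
  conv_lhs => rw [p.as_sum]
  rw [← Finset.sum_fiberwise_of_maps_to (g := fun u => u.filter (· ∉ s))
    (t := p.support.image (fun u => u.filter (· ∉ s))) (fun u hu => Finset.mem_image_of_mem _ hu)]
  refine Finset.sum_congr rfl fun m _ => ?_
  rw [outerCoeff, Finset.sum_mul]
  refine Finset.sum_congr rfl fun u hu => ?_
  rw [← (Finset.mem_filter.1 hu).2, monomial_mul, mul_one, Finsupp.filter_add_filter_not]

theorem mem_supported_iff {t : Set σ} {p : MvPolynomial σ K} :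
    p ∈ supported K t ↔ ∀ u ∈ p.support, ∀ j, u j ≠ 0 → j ∈ t := by
  rw [mem_supported]
  constructor
  · intro h u hu j hj
    exact h ((mem_vars_iff_mem_support j).2 ⟨u, hu, Finsupp.mem_support_iff.2 hj⟩)
  · intro h j hj
    obtain ⟨u, hu, hj⟩ := (mem_vars_iff_mem_support j).1 hj
    exact h u hu j (Finsupp.mem_support_iff.1 hj)

theorem monomial_mem_supported {t : Set σ} {u : σ →₀ ℕ} (hu : ∀ j, u j ≠ 0 → j ∈ t) (a : K) :
    monomial u a ∈ supported K t := by
  classical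
  refine mem_supported_iff.2 fun v hv => ?_
  rw [Finset.mem_singleton.1 (support_monomial_subset hv)]
  exact hu

theorem outerCoeff_mem_supported (s : Set σ) {t : Set σ} {p : MvPolynomial σ K}
    (hp : p ∈ supported K t) (m : σ →₀ ℕ) : outerCoeff s p m ∈ supported K (s ∩ t) := by
  classical
  refine sum_mem fun u hu => monomial_mem_supported (fun j hj => ?_) _
  rw [Finsupp.filter_apply] at hj
  split_ifs at hj with hjs
  · exact ⟨hjs, mem_supported_iff.1 hp u (Finset.mem_filter.1 hu).1 j hj⟩
  · exact absurd rfl hj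

theorem outerCoeff_mem_supported' (s : Set σ) (p : MvPolynomial σ K) (m : σ →₀ ℕ) :
    outerCoeff s p m ∈ supported K s := by
  have := outerCoeff_mem_supported s (t := Set.univ) (p := p) (by simp) m
  rwa [Set.inter_univ] at this

/-- The ideal generated by the elements of `P` involving only the variables in `s`. -/
def core (s : Set σ) (P : Ideal (MvPolynomial σ K)) : Ideal (MvPolynomial σ K) :=
  Ideal.span {p | p ∈ P ∧ p ∈ supported K s}

theorem core_le (s : Set σ) (P : Ideal (MvPolynomial σ K)) : core s P ≤ P :=
  Ideal.span_le.2 fun _ hp => hp.1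

theorem mem_core {s : Set σ} {P : Ideal (MvPolynomial σ K)} {p : MvPolynomial σ K} (hp : p ∈ P)
    (hps : p ∈ supported K s) : p ∈ core s P := Ideal.subset_span ⟨hp, hps⟩

theorem core_mono {s : Set σ} {P Q : Ideal (MvPolynomial σ K)} (h : P ≤ Q) : core s P ≤ core s Q :=
  Ideal.span_mono fun _ hp => ⟨h hp.1, hp.2⟩

theorem core_core (s : Set σ) (P : Ideal (MvPolynomial σ K)) : core s (core s P) = core s P :=
  le_antisymm (core_le _ _) (Ideal.span_le.2 fun _ hp => mem_core (mem_core hp.1 hp.2) hp.2)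

theorem core_univ (P : Ideal (MvPolynomial σ K)) : core Set.univ P = P :=
  le_antisymm (core_le _ _) fun _ hp => mem_core hp (by simp)

open Classical in
theorem mem_core_of_outerCoeff_mem {s : Set σ} {P : Ideal (MvPolynomial σ K)}
    {p : MvPolynomial σ K} (h : ∀ m, outerCoeff s p m ∈ P) : p ∈ core s P := by
  rw [sum_outerCoeff s p]
  exact Ideal.sum_mem _ fun m _ => Ideal.mul_mem_right _ _
    (mem_core (h m) (outerCoeff_mem_supported' s p m))

open Classical in
/-- Reduction modulo `P` of the variables in `s`, keeping the other variables. -/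
def innerReduction (s : Set σ) (P : Ideal (MvPolynomial σ K)) :
    MvPolynomial σ K →ₐ[K] MvPolynomial σ (MvPolynomial σ K ⧸ P) :=
  aeval fun j => if j ∈ s then C (Ideal.Quotient.mk P (X j)) else X j

theorem innerReduction_of_mem_supported {s : Set σ} (P : Ideal (MvPolynomial σ K))
    {p : MvPolynomial σ K} (hp : p ∈ supported K s) :
    innerReduction s P p = C (Ideal.Quotient.mk P p) := by
  classical
  rw [p.as_sum, map_sum, map_sum, map_sum]
  refine Finset.sum_congr rfl fun u hu => ?_
  have h := mem_supported_iff.1 hp u hu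
  rw [innerReduction, aeval_monomial, monomial_eq, map_mul, map_mul]
  congr 1
  rw [Finsupp.prod, Finsupp.prod, map_prod, map_prod]
  refine Finset.prod_congr rfl fun j hj => ?_
  rw [if_pos (h j (Finsupp.mem_support_iff.1 hj)), map_pow, map_pow]

theorem innerReduction_monomial {s : Set σ} (P : Ideal (MvPolynomial σ K))
    {m : σ →₀ ℕ} (hm : ∀ j ∈ s, m j = 0) : innerReduction s P (monomial m 1) = monomial m 1 := by
  classical
  rw [innerReduction, aeval_monomial, map_one, one_mul, monomial_eq, C_1, one_mul]
  refine Finset.prod_congr rfl fun j hj => ?_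
  have hjs : j ∉ s := fun hjs => (Finsupp.mem_support_iff.1 hj) (hm j hjs)
  simp only [hjs, if_false]

theorem outerCoeff_mem_of_innerReduction_eq_zero {s : Set σ} {P : Ideal (MvPolynomial σ K)}
    {p : MvPolynomial σ K} (hp : innerReduction s P p = 0) (m : σ →₀ ℕ) :
    outerCoeff s p m ∈ P := by
  classical
  by_cases hm : m ∈ p.support.image (fun u => u.filter (· ∉ s))
  · rw [← Ideal.Quotient.eq_zero_iff_mem]
    have h1 := congrArg (coeff m) hp
    rw [coeff_zero] at h1
    nth_rewrite 1 [sum_outerCoeff s p] at h1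
    rw [map_sum, coeff_sum, Finset.sum_eq_single m] at h1
    · have h2 : ∀ j ∈ s, m j = 0 := by
        obtain ⟨u, -, rfl⟩ := Finset.mem_image.1 hm
        intro j hj
        simp [hj]
      rw [map_mul, innerReduction_of_mem_supported P (outerCoeff_mem_supported' s p m),
        innerReduction_monomial P h2, coeff_C_mul, coeff_monomial, if_pos rfl, mul_one] at h1
      exact h1
    · intro m' hm' hne
      have h2 : ∀ j ∈ s, m' j = 0 := by
        obtain ⟨u, -, rfl⟩ := Finset.mem_image.1 hm'
        intro j hj
        simp [hj]
      rw [map_mul, innerReduction_of_mem_supported P (outerCoeff_mem_supported' s p m'),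
        innerReduction_monomial P h2, coeff_C_mul, coeff_monomial, if_neg hne, mul_zero]
    · exact fun h => absurd hm h
  · have : outerCoeff s p m = 0 := by
      rw [outerCoeff, Finset.filter_false_of_mem, Finset.sum_empty]
      exact fun u hu h => hm (Finset.mem_image.2 ⟨u, hu, h⟩)
    rw [this]
    exact zero_mem _

/-- Realizes the core as the kernel of a map to a polynomial ring over S/P, which is a domain when P
is prime; primality of the core follows. -/
theorem ker_innerReduction (s : Set σ) (P : Ideal (MvPolynomial σ K)) :
    RingHom.ker (innerReduction s P) = core s P := by
  refine le_antisymm (fun p hp => mem_core_of_outerCoeff_mem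
    (outerCoeff_mem_of_innerReduction_eq_zero hp)) (Ideal.span_le.2 fun p hp => ?_)
  rw [SetLike.mem_coe, RingHom.mem_ker, innerReduction_of_mem_supported P hp.2,
    Ideal.Quotient.eq_zero_iff_mem.2 hp.1, C_0]

instance core_isPrime (s : Set σ) (P : Ideal (MvPolynomial σ K)) [P.IsPrime] :
    (core s P).IsPrime := by
  rw [← ker_innerReduction]
  exact RingHom.ker_isPrime _

theorem outerCoeff_mem {s : Set σ} {P : Ideal (MvPolynomial σ K)} {p : MvPolynomial σ K}
    (hp : p ∈ core s P) (m : σ →₀ ℕ) : outerCoeff s p m ∈ P := by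
  rw [← ker_innerReduction] at hp
  exact outerCoeff_mem_of_innerReduction_eq_zero hp m

theorem homogeneousComponent_mem_supported {t : Set σ} {p : MvPolynomial σ K}
    (hp : p ∈ supported K t) (d : ℕ) : homogeneousComponent d p ∈ supported K t := by
  classical
  rw [mem_supported_iff] at hp ⊢
  intro u hu
  refine hp u ?_
  rw [mem_support_iff, coeff_homogeneousComponent] at hu
  rw [mem_support_iff]
  exact fun h => hu (by simp [h])

theorem core_isHomog (s : Set σ) {P : Ideal (MvPolynomial σ K)} (hP : IsHomog P) :
    IsHomog (core s P) := by
  have : core s P = Ideal.span {p | (p ∈ P ∧ p ∈ supported K s) ∧ ∃ d, p.IsHomogeneous d} := by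
    refine le_antisymm (Ideal.span_le.2 fun p hp => ?_) (Ideal.span_mono fun p hp => hp.1)
    rw [← sum_homogeneousComponent p]
    exact Ideal.sum_mem _ fun d _ => Ideal.subset_span ⟨⟨isHomog_iff.1 hP p hp.1 d,
      homogeneousComponent_mem_supported hp.2 d⟩, d, homogeneousComponent_isHomogeneous d p⟩
  rw [this]
  exact Ideal.homogeneous_span _ _ fun p hp => hp.2

end HilbertFn
end

/-! ### Cones over projections: a bound on dimension, and pseudo-division. -/

noncomputable section

attribute [local instance] MvPolynomial.gradedAlgebra
open MvPolynomial HilbertFn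

namespace HilbertFn
variable {σ K : Type*} [Field K]

/-- Expand `p` in the variables outside `insert i s`. The coefficients lie in `P` by `hP`, and since
`p` does not involve `i` they are polynomials in the variables of `s`. -/
theorem mem_core_of_mem_supported_compl {s : Set σ} {i : σ} {P : Ideal (MvPolynomial σ K)}
    (hP : core (insert i s) P = P) {p : MvPolynomial σ K} (hp : p ∈ P)
    (hpi : p ∈ supported K {i}ᶜ) : p ∈ core s P := by
  classical
  rw [sum_outerCoeff (insert i s) p]
  refine Ideal.sum_mem _ fun m _ => Ideal.mul_mem_right _ _ (mem_core ?_ ?_)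
  · exact outerCoeff_mem (hP.symm ▸ hp) m
  · refine supported_mono ?_ (outerCoeff_mem_supported (insert i s) hpi m)
    rintro j ⟨hj, hji⟩
    exact hj.resolve_left hji

open Classical in
/-- Setting the variable `i` to zero. -/
def killVar (i : σ) : MvPolynomial σ K →ₐ[K] MvPolynomial σ K :=
  aeval fun j => if j = i then 0 else X j

theorem killVar_mem_supported (i : σ) (p : MvPolynomial σ K) :
    killVar i p ∈ supported K {i}ᶜ := by
  classical
  induction p using MvPolynomial.induction_on with
  | C a => rw [killVar, aeval_C]; exact Subalgebra.algebraMap_mem _ _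
  | add p q hp hq => rw [map_add]; exact add_mem hp hq
  | mul_X p j hp =>
    rw [map_mul]
    refine mul_mem hp ?_
    rw [killVar, aeval_X]
    split_ifs with h
    · exact zero_mem _
    · exact X_mem_supported.2 h

theorem sub_killVar_mem (i : σ) (p : MvPolynomial σ K) : p - killVar i p ∈ Ideal.span {X i} := by
  classical
  rw [← Ideal.Quotient.eq_zero_iff_mem, map_sub, sub_eq_zero]
  have : (Ideal.Quotient.mkₐ K (Ideal.span {X i})) =
      (Ideal.Quotient.mkₐ K (Ideal.span {(X i : MvPolynomial σ K)})).comp (killVar i) := by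
    refine algHom_ext fun j => ?_
    rw [AlgHom.comp_apply, killVar, aeval_X]
    split_ifs with h
    · rw [h, map_zero]
      exact Ideal.Quotient.eq_zero_iff_mem.2 (Ideal.mem_span_singleton_self _)
    · rfl
  exact DFunLike.congr_fun this p

theorem killVar_isHomogeneous (i : σ) {p : MvPolynomial σ K} {d : ℕ} (hp : p.IsHomogeneous d) :
    (killVar i p).IsHomogeneous d := by
  classical
  have := hp.aeval (fun j => if j = i then (0 : MvPolynomial σ K) else X j) (n := 1) fun j => by
    split_ifs
    · exact isHomogeneous_zero _ _ _
    · exact isHomogeneous_X _ _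
  rwa [one_mul] at this

theorem finrank_quotient_le_of_inf_le {V : Type*} [AddCommGroup V] [Module K V]
    [FiniteDimensional K V] {A D₁ D₂ : Submodule K V} (h : A ⊓ D₂ ≤ D₁) (htop : A ⊔ D₁ = ⊤) :
    Module.finrank K (V ⧸ D₁) ≤ Module.finrank K (V ⧸ D₂) := by
  have h1 := Submodule.finrank_sup_add_finrank_inf_eq A D₁
  have h2 := Submodule.finrank_sup_add_finrank_inf_eq A D₂
  have h3 := Submodule.finrank_mono (le_inf inf_le_left h : A ⊓ D₂ ≤ A ⊓ D₁)
  have h4 := Submodule.finrank_le (A ⊔ D₂)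
  have h5 := Submodule.finrank_quotient_add_finrank D₁
  have h6 := Submodule.finrank_quotient_add_finrank D₂
  rw [htop, finrank_top] at h1
  omega

/-- Adding the variable `i` to the core cuts the cone back to at most the dimension of V(P). Forms
free of that variable represent every class modulo (X_i), and those of them lying in `P` already lie
in the core. -/
theorem hilb_core_sup_le [Finite σ] {s : Set σ} {i : σ} {P : Ideal (MvPolynomial σ K)}
    (hP : core (insert i s) P = P) (t : ℕ) :
    hilb (core s P ⊔ Ideal.span {X i}) t ≤ hilb P t := by
  let A : Submodule K (homogeneousSubmodule σ K t) :=
    (Subalgebra.toSubmodule (supported K {i}ᶜ)).comap (homogeneousSubmodule σ K t).subtype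
  refine finrank_quotient_le_of_inf_le (A := A) ?_ (eq_top_iff.2 fun x _ => ?_)
  · rintro x ⟨hxA, hxP⟩
    exact Ideal.mem_sup_left (mem_core_of_mem_supported_compl hP hxP hxA)
  · let y : homogeneousSubmodule σ K t := ⟨killVar i x, killVar_isHomogeneous i x.2⟩
    have hy : y ∈ A := killVar_mem_supported i _
    have hxy : x - y ∈ degreePart (core s P ⊔ Ideal.span {X i}) t :=
      Ideal.mem_sup_right (sub_killVar_mem i (x : MvPolynomial σ K))
    have := Submodule.add_mem_sup hy hxy
    rwa [add_sub_cancel] at this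

/-- Polynomials of degree less than `N` in the variable `i`. -/
def DegLT (i : σ) (N : ℕ) (p : MvPolynomial σ K) : Prop := ∀ u ∈ p.support, u i < N

theorem DegLT.sub {i : σ} {N : ℕ} {p q : MvPolynomial σ K} (hp : DegLT i N p) (hq : DegLT i N q) :
    DegLT i N (p - q) := by
  classical
  intro u hu
  rcases Finset.mem_union.1 (support_sub σ p q hu) with h | h
  · exact hp u h
  · exact hq u h

theorem DegLT.mul {i : σ} {N M : ℕ} {p q : MvPolynomial σ K} (hp : ∀ u ∈ p.support, u i ≤ M)
    (hq : DegLT i N q) : DegLT i (M + N) (p * q) := by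
  classical
  intro u hu
  obtain ⟨v, hv, w, hw, rfl⟩ := Finset.mem_add.1 (support_mul p q hu)
  have h1 := hp v hv
  have h2 := hq w hw
  rw [Finsupp.add_apply]
  omega

theorem apply_le_zero_of_mem_supported {s : Set σ} {i : σ} (hi : i ∉ s) {p : MvPolynomial σ K}
    (hp : p ∈ supported K s) : ∀ u ∈ p.support, u i ≤ 0 := fun u hu => by
  by_contra h
  exact hi (mem_supported_iff.1 hp u hu i (by omega))

theorem exists_leading {s : Set σ} {i : σ} {N : ℕ} {p : MvPolynomial σ K}
    (hp : p ∈ supported K (insert i s)) (hN : DegLT i (N + 1) p) :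
    ∃ c r : MvPolynomial σ K, c ∈ supported K s ∧ r ∈ supported K (insert i s) ∧
      p = c * X i ^ N + r ∧ DegLT i N r := by
  classical
  refine ⟨∑ u ∈ p.support with u i = N, monomial (u.erase i) (coeff u p),
    ∑ u ∈ p.support with u i ≠ N, monomial u (coeff u p), ?_, ?_, ?_, ?_⟩
  · refine sum_mem fun u hu => monomial_mem_supported (fun j hj => ?_) _
    have hji : j ≠ i := by rintro rfl; simp at hj
    rw [Finsupp.erase_ne hji] at hj
    exact (mem_supported_iff.1 hp u (Finset.mem_filter.1 hu).1 j hj).resolve_left hji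
  · refine sum_mem fun u hu => monomial_mem_supported (fun j hj => ?_) _
    exact mem_supported_iff.1 hp u (Finset.mem_filter.1 hu).1 j hj
  · conv_lhs => rw [p.as_sum, ← Finset.sum_filter_add_sum_filter_not _ (fun u => u i = N)]
    congr 1
    rw [Finset.sum_mul]
    refine Finset.sum_congr rfl fun u hu => ?_
    rw [X_pow_eq_monomial, monomial_mul, mul_one, ← (Finset.mem_filter.1 hu).2, add_comm,
      Finsupp.single_add_erase]
  · intro u hu
    obtain ⟨v, hv, hu'⟩ := Finset.mem_biUnion.1 (support_sum hu)
    rw [Finset.mem_singleton.1 (support_monomial_subset hu')]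
    obtain ⟨h1, h2⟩ := Finset.mem_filter.1 hv
    have := hN v h1
    omega

/-- Choose `f` in `P` outside the core, of least degree in the variable `i`, and pseudo-divide
elements of `P` by `f`. Thus in the zero locus of `f` on the cone, a component not contained in V(P)
must satisfy some equation in the variables of `s` that does not hold on V(P). -/
theorem exists_minimal_form {s : Set σ} {i : σ} (hi : i ∉ s) {P : Ideal (MvPolynomial σ K)}
    (hPh : IsHomog P) (hP : core (insert i s) P = P) (hne : core s P ≠ P) :
    ∃ (d : ℕ) (f : MvPolynomial σ K), f.IsHomogeneous d ∧ f ∈ P ∧ f ∉ core s P ∧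
      ∀ Q : Ideal (MvPolynomial σ K), Q.IsPrime → core s P ≤ Q → f ∈ Q →
        (∀ c ∈ Q, c ∈ supported K s → c ∈ P) → P ≤ Q := by
  classical
  have hex : ∃ e, ∃ f ∈ P, f ∈ supported K (insert i s) ∧ f ∉ core s P ∧ DegLT i (e + 1) f := by
    have : ∃ f ∈ P, f ∈ supported K (insert i s) ∧ f ∉ core s P := by
      by_contra! h
      exact hne (le_antisymm (core_le _ _) (hP.symm.le.trans
        (Ideal.span_le.2 fun p hp => h p hp.1 hp.2)))
    obtain ⟨f, h1, h2, h3⟩ := this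
    exact ⟨f.support.sup fun u => u i, f, h1, h2, h3, fun u hu =>
      Nat.lt_succ_of_le (Finset.le_sup (f := fun u : σ →₀ ℕ => u i) hu)⟩
  obtain ⟨f₀, hf₀P, hf₀s, hf₀c, hf₀d⟩ := Nat.find_spec hex
  have hmin : ∀ g ∈ P, g ∈ supported K (insert i s) → DegLT i (Nat.find hex) g →
      g ∈ core s P := by
    intro g hgP hgs hgd
    by_contra hgc
    rcases h0 : Nat.find hex with _ | e
    · rw [h0] at hgd
      refine hgc ?_
      have : g = 0 := by
        rw [← support_eq_empty, Finset.eq_empty_iff_forall_notMem]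
        exact fun u hu => absurd (hgd u hu) (Nat.not_lt_zero _)
      rw [this]
      exact zero_mem _
    · have := Nat.find_min hex (m := e) (by omega)
      rw [h0] at hgd
      exact this ⟨g, hgP, hgs, hgc, hgd⟩
  generalize Nat.find hex = e at hmin hf₀d
  obtain ⟨d, hd⟩ : ∃ d, homogeneousComponent d f₀ ∉ core s P := by
    by_contra! h
    refine hf₀c ?_
    rw [← sum_homogeneousComponent f₀]
    exact Ideal.sum_mem _ fun d _ => h d
  have hfP := isHomog_iff.1 hPh f₀ hf₀P d
  have hfs := homogeneousComponent_mem_supported hf₀s d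
  have hfd : DegLT i (e + 1) (homogeneousComponent d f₀) := by
    intro u hu
    refine hf₀d u ?_
    rw [mem_support_iff, coeff_homogeneousComponent] at hu
    rw [mem_support_iff]
    exact fun h => hu (by simp [h])
  refine ⟨d, _, homogeneousComponent_isHomogeneous d f₀, hfP, hd, ?_⟩
  generalize homogeneousComponent d f₀ = f at hd hfP hfs hfd
  obtain ⟨c, r, hc, hr, hfcr, hrd⟩ := exists_leading hfs hfd
  have hXs : X i ∈ supported K (insert i s) := X_mem_supported.2 (Set.mem_insert _ _)
  have hcs : c ∈ supported K (insert i s) := supported_mono (Set.subset_insert _ _) hc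
  -- If the leading coefficient `c` were in `P`, then `r`, of smaller degree in the variable `i`,
  -- would be in the core by minimality, and so would `f`.
  have hcP : c ∉ P := by
    intro hcP
    have h1 : c * X i ^ e ∈ core s P := Ideal.mul_mem_right _ _ (mem_core hcP hc)
    have h2 : r ∈ core s P := by
      refine hmin r ?_ hr hrd
      rw [show r = f - c * X i ^ e by rw [hfcr]; ring]
      exact sub_mem hfP (core_le _ _ h1)
    exact hd (hfcr ▸ add_mem h1 h2)
  intro Q hQ hle hfQ hQP
  have hcQ : c ∉ Q := fun h => hcP (hQP c h hc)
  -- Pseudo-division: `c * g - c' * X i ^ N * f` has smaller degree in the variable `i`, so it lies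
  -- in `Q` by induction. Then so does `c * g`, and `c` is not in the prime `Q`.
  have key : ∀ N, ∀ g ∈ P, g ∈ supported K (insert i s) → DegLT i (e + N) g → g ∈ Q := by
    intro N
    induction N with
    | zero => exact fun g hgP hgs hgd => hle (hmin g hgP hgs hgd)
    | succ N ih =>
      intro g hgP hgs hgd
      obtain ⟨c', r', hc', hr', hg, hr'd⟩ := exists_leading hgs (N := e + N) hgd
      have hc's : c' ∈ supported K (insert i s) := supported_mono (Set.subset_insert _ _) hc'
      have h1 : c * g - c' * X i ^ N * f = c * r' - c' * X i ^ N * r := by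
        rw [hg, hfcr]; ring
      have h2 : c * g - c' * X i ^ N * f ∈ Q := by
        refine ih _ (sub_mem (P.mul_mem_left _ hgP) (P.mul_mem_left _ hfP))
          (sub_mem (mul_mem hcs hgs) (mul_mem (mul_mem hc's (pow_mem hXs N)) hfs)) ?_
        rw [h1]
        refine DegLT.sub ?_ ?_
        · have := DegLT.mul (apply_le_zero_of_mem_supported hi hc) hr'd
          rwa [zero_add] at this
        · have h3 := DegLT.mul (i := i) (M := N) (p := c' * X i ^ N) ?_ hrd
          · rwa [add_comm] at h3
          · intro u hu
            obtain ⟨v, hv, w, hw, rfl⟩ := Finset.mem_add.1 (support_mul _ _ hu)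
            have h4 := apply_le_zero_of_mem_supported hi hc' v hv
            rw [X_pow_eq_monomial] at hw
            rw [Finset.mem_singleton.1 (support_monomial_subset hw)]
            simp; omega
      have h3 : c * g ∈ Q := by
        have := Q.add_mem h2 (Q.mul_mem_left (c' * X i ^ N) hfQ)
        rwa [sub_add_cancel] at this
      exact (hQ.mem_or_mem h3).resolve_left hcQ
  rw [← hP]
  refine Ideal.span_le.2 fun g hg => key (g.support.sup (fun u => u i) + 1) g hg.1 hg.2 ?_
  intro u hu
  have : u i ≤ g.support.sup fun u => u i := Finset.le_sup (f := fun u : σ →₀ ℕ => u i) hu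
  omega

end HilbertFn
end

/-! ### Graded automorphisms, and generic points of coordinate subspaces. -/

noncomputable section

attribute [local instance] MvPolynomial.gradedAlgebra
open MvPolynomial HilbertFn

namespace HilbertFn
variable {σ K : Type*} [Field K]

/-- Automorphisms of the polynomial ring that preserve degrees. -/
def IsGradedEquiv (φ : MvPolynomial σ K ≃ₐ[K] MvPolynomial σ K) : Prop :=
  ∀ (d : ℕ) (p : MvPolynomial σ K), (φ p).IsHomogeneous d ↔ p.IsHomogeneous d

theorem IsGradedEquiv.symm {φ : MvPolynomial σ K ≃ₐ[K] MvPolynomial σ K} (h : IsGradedEquiv φ) :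
    IsGradedEquiv φ.symm := fun d p => by
  rw [← h d, AlgEquiv.apply_symm_apply]

theorem IsGradedEquiv.homogeneousComponent {φ : MvPolynomial σ K ≃ₐ[K] MvPolynomial σ K}
    (h : IsGradedEquiv φ) (d : ℕ) (p : MvPolynomial σ K) :
    homogeneousComponent d (φ p) = φ (homogeneousComponent d p) := by
  conv_lhs => rw [← sum_homogeneousComponent p, map_sum, map_sum]
  have h1 : ∀ i ∈ Finset.range (p.totalDegree + 1),
      MvPolynomial.homogeneousComponent d (φ (MvPolynomial.homogeneousComponent i p)) =
      if i = d then φ (MvPolynomial.homogeneousComponent d p) else 0 := fun i _ => by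
    rw [homogeneousComponent_of_mem ((h i _).2 (homogeneousComponent_isHomogeneous i p))]
    by_cases hid : i = d
    · simp [hid]
    · rw [if_neg hid, if_neg fun h' => hid h'.symm]
  rw [Finset.sum_congr rfl h1, Finset.sum_ite_eq']
  split_ifs with hd
  · rfl
  · rw [homogeneousComponent_eq_zero _ _ (by simpa using hd), map_zero]

theorem IsGradedEquiv.isHomog_comap {φ : MvPolynomial σ K ≃ₐ[K] MvPolynomial σ K}
    (h : IsGradedEquiv φ) {P : Ideal (MvPolynomial σ K)} (hP : IsHomog P) :
    IsHomog (P.comap φ) :=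
  isHomog_iff.2 fun p hp d => Ideal.mem_comap.2 <| by
    rw [← h.homogeneousComponent]
    exact isHomog_iff.1 hP _ hp d

theorem IsGradedEquiv.hilb_comap_le [Finite σ] {φ : MvPolynomial σ K ≃ₐ[K] MvPolynomial σ K}
    (h : IsGradedEquiv φ) (P : Ideal (MvPolynomial σ K)) (t : ℕ) :
    hilb (P.comap φ) t ≤ hilb P t := by
  let m : homogeneousSubmodule σ K t →ₗ[K] homogeneousSubmodule σ K t :=
    (φ.toLinearMap.comp (homogeneousSubmodule σ K t).subtype).codRestrict _
      fun x => (h t _).2 x.2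
  have hle : degreePart (P.comap φ) t ≤ (degreePart P t).comap m := fun x hx => hx
  refine LinearMap.finrank_le_finrank_of_injective (f := Submodule.mapQ _ _ m hle) ?_
  rw [← LinearMap.ker_eq_bot]
  exact Submodule.ker_liftQ_eq_bot _ _ _ fun x hx => by
    rw [LinearMap.mem_ker, LinearMap.comp_apply, Submodule.mkQ_apply,
      Submodule.Quotient.mk_eq_zero] at hx
    exact hx

theorem comap_symm_comap (φ : MvPolynomial σ K ≃ₐ[K] MvPolynomial σ K)
    (P : Ideal (MvPolynomial σ K)) : (P.comap φ).comap φ.symm = P := by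
  ext x
  rw [Ideal.mem_comap, Ideal.mem_comap, AlgEquiv.apply_symm_apply]

theorem IsGradedEquiv.hilb_comap [Finite σ] {φ : MvPolynomial σ K ≃ₐ[K] MvPolynomial σ K}
    (h : IsGradedEquiv φ) (P : Ideal (MvPolynomial σ K)) : hilb (P.comap φ) = hilb P := by
  refine funext fun t => le_antisymm (h.hilb_comap_le P t) ?_
  have := h.symm.hilb_comap_le (P.comap φ) t
  rwa [comap_symm_comap] at this

theorem IsGradedEquiv.hilbPoly_comap [Finite σ] {φ : MvPolynomial σ K ≃ₐ[K] MvPolynomial σ K}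
    (h : IsGradedEquiv φ) (P : Ideal (MvPolynomial σ K)) : hilbPoly (P.comap φ) = hilbPoly P := by
  rw [hilbPoly, hilbPoly, h.hilb_comap]

/-- Ensures that every component of the zero locus of `I` shows up in the list, hence that its
multiplicity is positive. -/
theorem PrimeFiltration.exists_le {I P : Ideal (MvPolynomial σ K)}
    {l : List (Ideal (MvPolynomial σ K) × ℕ)} (h : PrimeFiltration I l) (hP : P.IsPrime)
    (hle : I ≤ P) : ∃ q ∈ l, q.1 ≤ P := by
  induction h with
  | top => exact absurd (top_le_iff.1 hle) hP.ne_top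
  | @cons I g s l hI hg hQ hl ih =>
    by_cases hgP : g ∈ P
    · obtain ⟨q, hq, hqP⟩ := ih (sup_le hle ((Ideal.span_singleton_le_iff_mem _).2 hgP))
      exact ⟨q, List.mem_cons_of_mem _ hq, hqP⟩
    · exact ⟨_, List.mem_cons_self, fun a ha => (hP.mem_or_mem (hle ha)).resolve_left hgP⟩

/-- Reduces primality of coordinate ideals to that of the ideal of all variables. -/
theorem span_X_image_eq_core (s : Set σ) :
    Ideal.span (X '' s) = core s (Ideal.span (Set.range (X : σ → MvPolynomial σ K))) := by
  refine le_antisymm (Ideal.span_le.2 ?_) (Ideal.span_le.2 fun p hp => ?_)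
  · rintro _ ⟨j, hj, rfl⟩
    exact mem_core (Ideal.subset_span ⟨j, rfl⟩) (X_mem_supported.2 hj)
  · refine mem_ideal_span_X_image.2 fun u hu => ?_
    have h1 := hp.1
    rw [← Set.image_univ, mem_ideal_span_X_image] at h1
    obtain ⟨j, -, hj⟩ := h1 u hu
    exact ⟨j, mem_supported_iff.1 hp.2 u hu j hj, hj⟩

instance span_range_X_isPrime :
    (Ideal.span (Set.range (X : σ → MvPolynomial σ K))).IsPrime := by
  have : Ideal.span (Set.range (X : σ → MvPolynomial σ K)) =
      RingHom.ker (constantCoeff : MvPolynomial σ K →+* K) := by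
    ext p
    rw [← Set.image_univ, mem_ideal_span_X_image, RingHom.mem_ker, constantCoeff_eq]
    constructor
    · intro h
      by_contra h0
      obtain ⟨j, -, hj⟩ := h 0 (mem_support_iff.2 h0)
      exact hj rfl
    · intro h u hu
      by_contra! h0
      have : u = 0 := by ext j; simpa using h0 j
      exact (mem_support_iff.1 hu) (this ▸ h)
  rw [this]
  exact RingHom.ker_isPrime _

instance span_X_image_isPrime (s : Set σ) :
    (Ideal.span ((X : σ → MvPolynomial σ K) '' s)).IsPrime := by
  rw [span_X_image_eq_core]; infer_instance

theorem span_X_image_isHomog (s : Set σ) :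
    IsHomog (Ideal.span ((X : σ → MvPolynomial σ K) '' s)) :=
  Ideal.homogeneous_span _ _ <| by
    rintro _ ⟨j, -, rfl⟩
    exact ⟨1, isHomogeneous_X K j⟩

theorem X_mem_span_X_image {s : Set σ} {j : σ} :
    (X j : MvPolynomial σ K) ∈ Ideal.span (X '' s) ↔ j ∈ s := by
  classical
  rw [mem_ideal_span_X_image]
  constructor
  · intro h
    obtain ⟨i, hi, hij⟩ := h (Finsupp.single j 1) (by simp [mem_support_iff])
    rwa [show j = i by by_contra hne; exact hij (by simp [hne])]
  · intro hj u hu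
    rw [support_X, Finset.mem_singleton] at hu
    exact ⟨j, hj, by simp [hu]⟩

/-- A polynomial in the variables of `s` differs from its constant term by an element of `P`, and a
proper ideal contains no nonzero constant. -/
theorem eq_span_X_image {s : Set σ} {P : Ideal (MvPolynomial σ K)} (hne : P ≠ ⊤)
    (hP : core s P = P) (hX : ∀ j ∈ s, X j ∈ P) : P = Ideal.span (X '' s) := by
  have hle : Ideal.span (X '' s) ≤ P := Ideal.span_le.2 (by rintro _ ⟨j, hj, rfl⟩; exact hX j hj)
  refine le_antisymm ?_ hle
  rw [← hP]
  refine Ideal.span_le.2 fun p hp => ?_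
  have h1 : p - C (coeff 0 p) ∈ Ideal.span (X '' s) := by
    classical
    refine mem_ideal_span_X_image.2 fun u hu => ?_
    rw [mem_support_iff, coeff_sub, coeff_C] at hu
    have hu0 : u ≠ 0 := by rintro rfl; simp at hu
    rw [if_neg fun h => hu0 h.symm, sub_zero] at hu
    obtain ⟨j, hj⟩ := Finsupp.ne_iff.1 hu0
    exact ⟨j, mem_supported_iff.1 hp.2 u (mem_support_iff.2 hu) j hj, hj⟩
  have h2 : C (coeff 0 p) ∈ P := by
    have := sub_mem hp.1 (hle h1)
    rwa [sub_sub_cancel] at this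
  have h3 : coeff 0 p = 0 := by
    by_contra h0
    exact hne (Ideal.eq_top_of_isUnit_mem _ h2 ((isUnit_iff_ne_zero.2 h0).map C))
  rw [h3, C_0, sub_zero] at h1
  exact h1

theorem X_notMem_core {s : Set σ} {i : σ} (hi : i ∉ s) {P : Ideal (MvPolynomial σ K)}
    (hne : P ≠ ⊤) : X i ∉ core s P := by
  classical
  rw [← ker_innerReduction, RingHom.mem_ker, innerReduction, aeval_X, if_neg hi]
  have : Nontrivial (MvPolynomial σ K ⧸ P) := Ideal.Quotient.nontrivial_iff.2 hne
  exact X_ne_zero i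

end HilbertFn

namespace PP
variable {n : ℕ}

theorem hilbPoly_sup {w : PP n} {y : MvPolynomial (Fin (n + 1)) ℂ}
    (hy : y.IsHomogeneous 1) (hyw : y ∉ ideal w) : hilbPoly (ideal w ⊔ Ideal.span {y}) =
      hilbPoly (ideal w) - Polynomial.taylor (-1) (hilbPoly (ideal w)) := by
  have h1 := hilbPoly_add (ideal_isHomogeneous w) hy
  rw [colonBy_eq_self hyw, Nat.cast_one] at h1
  exact eq_sub_iff_add_eq.2 h1.symm

theorem dim_le_of_hilbPoly_sup {w : PP n} {y : MvPolynomial (Fin (n + 1)) ℂ}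
    (hy : y.IsHomogeneous 1) (hyw : y ∉ ideal w) :
    dim w ≤ (hilbPoly (ideal w ⊔ Ideal.span {y})).natDegree + 1 := by
  rcases h : dim w with _ | d
  · omega
  · have := Polynomial.le_natDegree_of_ne_zero (coeff_sub_taylor_ne_zero h)
    rw [← hilbPoly_sup hy hyw] at this
    omega

/-- The set of the first `c` indices. -/
def below (n c : ℕ) : Set (Fin (n + 1)) := {j | (j : ℕ) < c}

theorem mem_below {c : ℕ} {j : Fin (n + 1)} : j ∈ below n c ↔ (j : ℕ) < c := Iff.rfl

theorem insert_below {c : ℕ} (hc : c < n + 1) : insert ⟨c, hc⟩ (below n c) = below n (c + 1) := by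
  ext j
  simp only [Set.mem_insert_iff, mem_below, Fin.ext_iff]
  omega

/-- Dimensions come by induction from the smallest subspace: each coordinate hyperplane section
lowers the dimension by exactly one. In the initial case the section is empty, with polynomial zero,
which forces dimension zero. -/
theorem exists_coordinate_point {c : ℕ} (hc : c ≤ n) :
    ∃ x : PP n, ideal x = Ideal.span (X '' below n c) ∧ dim x = n - c := by
  have hex : ∀ c ≤ n, ∃ x : PP n, ideal x = Ideal.span (X '' below n c) := fun c hc =>
    ⟨mk _ (span_X_image_isPrime _) (span_X_image_isHomog _)
      ⟨⟨c, by omega⟩, fun h => lt_irrefl c (mem_below.1 (X_mem_span_X_image.1 h))⟩, rfl⟩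
  suffices ∀ m, m ≤ n → ∀ x : PP n, ideal x = Ideal.span (X '' below n (n - m)) → dim x = m by
    obtain ⟨x, hx⟩ := hex c hc
    exact ⟨x, hx, this (n - c) (by omega) x (by rw [hx]; congr; omega)⟩
  have hsup : ∀ m (hm : m ≤ n) (x : PP n), ideal x = Ideal.span (X '' below n (n - m)) →
      X ⟨n - m, by omega⟩ ∉ ideal x ∧ ideal x ⊔ Ideal.span {X ⟨n - m, by omega⟩} =
        Ideal.span (X '' below n (n - m + 1)) := by
    intro m hm x hx
    rw [hx, X_mem_span_X_image]
    refine ⟨fun h => lt_irrefl (n - m) (mem_below.1 h), ?_⟩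
    rw [← insert_below (by omega : n - m < n + 1), Set.image_insert_eq, Ideal.span_insert,
      sup_comm]
  intro m
  induction m with
  | zero =>
    intro hm x hx
    obtain ⟨h1, h2⟩ := hsup 0 hm x hx
    have h3 : hilbPoly (ideal x ⊔ Ideal.span {X ⟨n - 0, by omega⟩}) = 0 := by
      rw [h2]
      exact hilbPoly_eq_zero fun j => X_mem_span_X_image.2 (mem_below.2 j.2)
    rcases h4 : dim x with _ | d
    · rfl
    · refine absurd ?_ (coeff_sub_taylor_ne_zero h4)
      rw [← hilbPoly_sup (isHomogeneous_X _ _) h1, h3, Polynomial.coeff_zero]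
  | succ m ih =>
    intro hm x hx
    obtain ⟨h1, h2⟩ := hsup (m + 1) hm x hx
    obtain ⟨y, hy⟩ := hex (n - m) (by omega)
    have h3 := ih (by omega) y hy
    rw [show n - (m + 1) + 1 = n - m by omega, ← hy] at h2
    have h4 := dim_le_of_hilbPoly_sup (isHomogeneous_X _ _) h1
    rw [h2] at h4
    have h5 : y < x := lt_iff.2 (h2 ▸ lt_sup_span_singleton h1)
    have h6 := dim_lt_of_lt h5
    change dim x ≤ dim y + 1 at h4
    omega

end PP
end

/-! ### Chow groups of the members of a coordinate flag. -/

noncomputable section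

attribute [local instance] MvPolynomial.gradedAlgebra
open MvPolynomial HilbertFn

namespace PP
variable {n k : ℕ} {Z : Closeds (PP n)}

theorem pt_mem_span (h : Function.Injective (degree k Z)) (z L : Chow.Subvariety k Z) :
    pt z ∈ Submodule.span ℚ {pt L} := by
  refine Submodule.mem_span_singleton.2 ⟨degree k Z (pt z) / degree k Z (pt L), h ?_⟩
  rw [map_smul, smul_eq_mul, div_mul_cancel₀ _ (degree_pt_ne_zero L)]

theorem mkQ_primeCycle_mem {N : Submodule ℚ (Chow.CH k Z)}
    {I : Ideal (MvPolynomial (Fin (n + 1)) ℂ)}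
    (h : ∀ z : Chow.Subvariety k Z, ideal z.1 = I → pt z ∈ N) :
    (Chow.ratEquivZero k Z).mkQ (primeCycle k Z I) ∈ N := by
  by_cases hI : ∃ z : Chow.Subvariety k Z, ideal z.1 = I
  · obtain ⟨z, rfl⟩ := hI
    rw [primeCycle_ideal]
    exact h z rfl
  · rw [primeCycle_eq_zero hI, map_zero]
    exact zero_mem _

/-- The class of a cycle of which all but one component have class in `N`. -/
theorem mkQ_listCycle_sub_mem {N : Submodule ℚ (Chow.CH k Z)} (V : Chow.Subvariety k Z)
    {l : List (Ideal (MvPolynomial (Fin (n + 1)) ℂ) × ℕ)}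
    (h : ∀ q ∈ l, ∀ z : Chow.Subvariety k Z, ideal z.1 = q.1 → z ≠ V → pt z ∈ N) :
    (Chow.ratEquivZero k Z).mkQ (listCycle k Z l) - (mult V.1 l : ℚ) • pt V ∈ N := by
  induction l with
  | nil => simp [listCycle, mult]
  | cons q l ih =>
    have ih' := ih fun q hq => h q (List.mem_cons_of_mem _ hq)
    have h1 : listCycle k Z (q :: l) = primeCycle k Z q.1 + listCycle k Z l := by simp [listCycle]
    rw [h1, map_add]
    by_cases hq : q.1 = ideal V.1
    · have h2 : mult V.1 (q :: l) = mult V.1 l + 1 := by simp [mult, hq]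
      rw [h2, hq, primeCycle_ideal]
      convert ih' using 1
      push_cast
      rw [add_smul, one_smul]
      change pt V + _ - _ = _
      abel
    · have h2 : mult V.1 (q :: l) = mult V.1 l := by simp [mult, hq]
      rw [h2, add_sub_assoc]
      refine add_mem (mkQ_primeCycle_mem fun z hz => h q List.mem_cons_self z hz ?_) ih'
      rintro rfl
      exact hq hz.symm

theorem mkQ_listCycle_mem {N : Submodule ℚ (Chow.CH k Z)}
    {l : List (Ideal (MvPolynomial (Fin (n + 1)) ℂ) × ℕ)}
    (h : ∀ q ∈ l, ∀ z : Chow.Subvariety k Z, ideal z.1 = q.1 → pt z ∈ N) :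
    (Chow.ratEquivZero k Z).mkQ (listCycle k Z l) ∈ N := by
  rw [listCycle, map_list_sum, List.map_map]
  refine list_sum_mem fun x hx => ?_
  obtain ⟨q, hq, rfl⟩ := List.mem_map.1 hx
  exact mkQ_primeCycle_mem (h q hq)

theorem mult_ne_zero {w z : PP n} (hwz : dim w = dim z + 1) (hle : ideal w ≤ ideal z)
    {a : MvPolynomial (Fin (n + 1)) ℂ} (haw : a ∉ ideal w) (haz : a ∈ ideal z)
    {l : List (Ideal (MvPolynomial (Fin (n + 1)) ℂ) × ℕ)}
    (hl : PrimeFiltration (ideal w ⊔ Ideal.span {a}) l) : mult z l ≠ 0 := by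
  obtain ⟨q, hq, hqz⟩ := hl.exists_le (inferInstance : (ideal z).IsPrime)
    (sup_le hle ((Ideal.span_singleton_le_iff_mem _).2 haz))
  have := filtration_eq hwz haw hl q hq hqz
  rw [mult]
  intro h0
  rw [List.countP_eq_zero] at h0
  exact h0 q hq (by simpa using this)

/-- The linear subspace where the first `c` coordinates vanish. -/
def flag (φ : MvPolynomial (Fin (n + 1)) ℂ ≃ₐ[ℂ] MvPolynomial (Fin (n + 1)) ℂ) (c : ℕ) :
    Closeds (PP n) :=
  zeros ((fun j => φ (X j)) '' below n c)

variable {φ : MvPolynomial (Fin (n + 1)) ℂ ≃ₐ[ℂ] MvPolynomial (Fin (n + 1)) ℂ}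

theorem mem_flag {c : ℕ} {x : PP n} :
    x ∈ flag φ c ↔ ∀ j ∈ below n c, φ (X j) ∈ ideal x := by
  rw [flag, mem_zeros, Set.image_subset_iff]
  exact Iff.rfl

theorem flag_anti {c c' : ℕ} (h : c ≤ c') : flag φ c' ≤ flag φ c := fun _ hx =>
  mem_flag.2 fun j hj => mem_flag.1 hx j (lt_of_lt_of_le hj h)

theorem mem_flag_succ {c : ℕ} (hc : c < n + 1) {x : PP n} (hx : x ∈ flag φ c)
    (h : φ (X ⟨c, hc⟩) ∈ ideal x) : x ∈ flag φ (c + 1) := by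
  rw [mem_flag, ← insert_below hc]
  rintro j (rfl | hj)
  · exact h
  · exact mem_flag.1 hx j hj

theorem exists_point_comap (hφ : IsGradedEquiv φ) {P : Ideal (MvPolynomial (Fin (n + 1)) ℂ)}
    (hp : P.IsPrime) (hP : IsHomog P) (h0 : hilbPoly P ≠ 0) :
    ∃ x : PP n, (ideal x).comap φ = P ∧ dim x = (hilbPoly P).natDegree := by
  obtain ⟨x, hx⟩ := exists_point_of_hilbPoly_ne_zero (I := P.comap φ.symm) (hp.comap _)
    (hφ.symm.isHomog_comap hP) (by rwa [hφ.symm.hilbPoly_comap])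
  refine ⟨x, ?_, ?_⟩
  · rw [hx]
    exact comap_symm_comap φ.symm P
  · rw [dim, hx, hφ.symm.hilbPoly_comap]

theorem exists_flag_point (hφ : IsGradedEquiv φ) {c : ℕ} (hc : c ≤ n) :
    ∃ x : PP n, (ideal x).comap φ = Ideal.span (X '' below n c) ∧ dim x = n - c := by
  obtain ⟨y, hy, hd⟩ := exists_coordinate_point hc
  obtain ⟨x, hx, hd'⟩ := exists_point_comap hφ (inferInstance : (ideal y).IsPrime)
    (ideal_isHomogeneous y) (hilbPoly_ideal_ne_zero y)
  exact ⟨x, hx.trans hy, hd'.trans hd⟩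

theorem comap_le_comap_iff {I J : Ideal (MvPolynomial (Fin (n + 1)) ℂ)} :
    I.comap φ ≤ J.comap φ ↔ I ≤ J := by
  refine ⟨fun h x hx => ?_, fun h x hx => h hx⟩
  have := h (show φ.symm x ∈ I.comap φ by rwa [Ideal.mem_comap, AlgEquiv.apply_symm_apply])
  rwa [Ideal.mem_comap, AlgEquiv.apply_symm_apply] at this

theorem dim_eq_natDegree_comap (hφ : IsGradedEquiv φ) (x : PP n) :
    dim x = (hilbPoly ((ideal x).comap φ)).natDegree := by
  rw [hφ.hilbPoly_comap, dim]

instance comap_ideal_isPrime (x : PP n) : ((ideal x).comap φ).IsPrime :=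
  (inferInstance : (ideal x).IsPrime).comap _

/-- The core of the ideal of a point defines a cone over a projection of its subvariety. -/
theorem exists_cone (hφ : IsGradedEquiv φ) (V : PP n) {s : Set (Fin (n + 1))} {i : Fin (n + 1)}
    (hi : i ∉ s) (hP : core (insert i s) ((ideal V).comap φ) = (ideal V).comap φ)
    (hne : core s ((ideal V).comap φ) ≠ (ideal V).comap φ) :
    ∃ w : PP n, (ideal w).comap φ = core s ((ideal V).comap φ) ∧ dim w = dim V + 1 := by
  have hh := hφ.isHomog_comap (ideal_isHomogeneous V)
  have hch := core_isHomog s hh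
  have h0 : hilbPoly (core s ((ideal V).comap φ)) ≠ 0 := by
    intro h0
    have := degree_hilbPoly_anti hch hh (core_le s _)
    rw [h0, Polynomial.degree_zero, le_bot_iff, Polynomial.degree_eq_bot,
      hφ.hilbPoly_comap] at this
    exact hilbPoly_ideal_ne_zero V this
  obtain ⟨w, hw, hd⟩ := exists_point_comap hφ (inferInstance : (core s _).IsPrime) hch h0
  refine ⟨w, hw, le_antisymm ?_ ?_⟩
  · obtain ⟨w', hw'⟩ := exists_point_of_hilbPoly_ne_zero
      (inferInstance : (core s ((ideal V).comap φ)).IsPrime) hch h0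
    -- Upper bound: the section of the cone by the variable `i` lowers the dimension by at most one,
    -- and its dimension is at most that of `V`.
    have hXi : X i ∉ ideal w' := hw' ▸ X_notMem_core hi (comap_ideal_isPrime V).ne_top
    have h1 := dim_le_of_hilbPoly_sup (isHomogeneous_X ℂ i) hXi
    rw [hw'] at h1
    have h2 := Polynomial.natDegree_le_natDegree
      ((eventuallyPoly_hilbPoly (hch.sup (IsHomog.span_singleton (isHomogeneous_X ℂ i)))).degree_le
        (eventuallyPoly_hilbPoly hh) (hilb_core_sup_le hP))
    rw [← dim_eq_natDegree_comap hφ] at h2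
    rw [dim, hw'] at h1
    omega
  · refine dim_lt_of_lt (lt_iff.2 (lt_of_le_of_ne ?_ ?_))
    · rw [← comap_le_comap_iff (φ := φ), hw]
      exact core_le _ _
    · intro h
      rw [← hw, h] at hne
      exact hne rfl

/-- Induction on the number `i` of coordinates needed to define V. Unless V already lies in the next
member of the flag, let W be the cone over the projection of V to the first `i` coordinates. On W
compare the form `f` of `exists_minimal_form` with a power of coordinate `c`. The divisor of the
latter lies in the next member of the flag, and that of `f` is a nonzero multiple of V plus
components defined by the first `i` coordinates. -/
theorem pt_mem_span_of_core (hφ : IsGradedEquiv φ) {c : ℕ} (hck : c + k < n) {i : ℕ} (hi : c ≤ i)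
    (V : Chow.Subvariety k (flag φ c))
    (hV : core (below n i) ((ideal V.1).comap φ) = (ideal V.1).comap φ) :
    pt V ∈ Submodule.span ℚ {x | ∃ z : Chow.Subvariety k (flag φ c), z.1 ∈ flag φ (c + 1) ∧
      pt z = x} := by
  induction i, hi using Nat.le_induction generalizing V with
  | base =>
    exfalso
    -- With only the first `c` coordinates, V would be the whole subspace, of dimension `n - c > k`.
    have h1 := eq_span_X_image (comap_ideal_isPrime V.1).ne_top hV fun j hj => mem_flag.1 V.2.1 j hj
    obtain ⟨x, hx, hd⟩ := exists_coordinate_point (n := n) (c := c) (by omega)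
    have h2 := dim_eq_natDegree_comap hφ V.1
    rw [h1, ← hx, dim_eq] at h2
    rw [dim] at hd
    omega
  | succ i hi ih =>
    by_cases hin : i < n + 1
    swap
    · refine ih V ?_
      rwa [show below n i = below n (i + 1) by
        ext j; rw [mem_below, mem_below]; have := j.2; omega]
    by_cases hVi : core (below n i) ((ideal V.1).comap φ) = (ideal V.1).comap φ
    · exact ih V hVi
    have hc : c < n + 1 := by omega
    by_cases hVc : φ (X ⟨c, hc⟩) ∈ ideal V.1
    · exact Submodule.subset_span ⟨V, mem_flag_succ hc V.2.1 hVc, rfl⟩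
    rw [← insert_below hin] at hV
    have hib : (⟨i, hin⟩ : Fin (n + 1)) ∉ below n i := fun h => lt_irrefl i (mem_below.1 h)
    obtain ⟨w, hw, hwd⟩ := exists_cone hφ V.1 hib hV hVi
    obtain ⟨d, f, hf, hfV, hfc, hfQ⟩ := exists_minimal_form hib
      (hφ.isHomog_comap (ideal_isHomogeneous V.1)) hV hVi
    have hwV : ideal w ≤ ideal V.1 := by
      rw [← comap_le_comap_iff (φ := φ), hw]
      exact core_le _ _
    have hwZ : w ∈ flag φ c := mem_flag.2 fun j hj => by
      have : X j ∈ core (below n i) ((ideal V.1).comap φ) :=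
        mem_core (mem_flag.1 V.2.1 j hj) (X_mem_supported.2 (lt_of_lt_of_le hj hi))
      rw [← hw] at this
      exact this
    have hfw : φ f ∉ ideal w := fun h => hfc (hw ▸ (show f ∈ (ideal w).comap φ from h))
    have hgh : (φ (X ⟨c, hc⟩)).IsHomogeneous 1 := (hφ 1 _).2 (isHomogeneous_X _ _)
    -- The exponent `d` makes the quotient of `f` by this power a rational function.
    have hg : (φ (X ⟨c, hc⟩) ^ d).IsHomogeneous d := by
      have := hgh.pow d
      rwa [one_mul] at this
    have hgw : φ (X ⟨c, hc⟩) ^ d ∉ ideal w := fun h =>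
      hVc (hwV ((inferInstance : (ideal w).IsPrime).mem_of_pow_mem d h))
    have hwh := ideal_isHomogeneous w
    obtain ⟨la, hla⟩ := exists_primeFiltration
      (hwh.sup (IsHomog.span_singleton ((hφ d f).2 hf)))
    obtain ⟨lb, hlb⟩ := exists_primeFiltration (hwh.sup (IsHomog.span_singleton hg))
    rw [dim_eq] at hwd
    have hrel := sum_pt_eq (subvariety hwZ hwd) ((hφ d f).2 hf) hg hfw hgw hla hlb
    have hb := mkQ_listCycle_mem (k := k) (Z := flag φ c) (l := lb)
      (N := Submodule.span ℚ {x | ∃ z : Chow.Subvariety k (flag φ c), z.1 ∈ flag φ (c + 1) ∧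
        pt z = x}) fun q hq z hz => by
      refine Submodule.subset_span ⟨z, mem_flag_succ hc z.2.1 ?_, rfl⟩
      refine (inferInstance : (ideal z.1).IsPrime).mem_of_pow_mem d ?_
      rw [hz]
      exact (hlb.mem q hq).2.2 (Ideal.mem_sup_right (Ideal.mem_span_singleton_self _))
    have ha := mkQ_listCycle_sub_mem (k := k) (Z := flag φ c) (l := la) V
      (N := Submodule.span ℚ {x | ∃ z : Chow.Subvariety k (flag φ c), z.1 ∈ flag φ (c + 1) ∧
        pt z = x}) fun q hq z hz hzV => by
      have hle := (hla.mem q hq).2.2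
      rw [← hz] at hle
      have hwz : ideal w ≤ ideal z.1 := le_sup_left.trans hle
      have hfz : φ f ∈ ideal z.1 :=
        hle (Ideal.mem_sup_right (Ideal.mem_span_singleton_self _))
      have hwz' : core (below n i) ((ideal V.1).comap φ) ≤ (ideal z.1).comap φ := by
        rw [← hw]
        exact comap_le_comap_iff.2 hwz
      -- If every equation of `z` in the first `i` coordinates holds on V, then `z` is V. Otherwise
      -- the projection of `z` is strictly smaller, and `z` turns out to be a cone itself.
      by_cases hcase : ∀ b ∈ (ideal z.1).comap φ, b ∈ supported ℂ (below n i) →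
          b ∈ (ideal V.1).comap φ
      · have h1 := hfQ _ (comap_ideal_isPrime z.1) hwz' hfz hcase
        refine absurd (Subtype.ext ?_) hzV
        exact eq_of_le_of_dim_eq (le_iff.2 (comap_le_comap_iff.1 h1)) (by rw [dim_eq, dim_eq])
      · push Not at hcase
        obtain ⟨b, hbz, hbs, hbV⟩ := hcase
        refine ih z ?_
        have hh := hφ.isHomog_comap (ideal_isHomogeneous z.1)
        by_contra hne
        have hch := core_isHomog (below n i) hh
        have h0 : hilbPoly (core (below n i) ((ideal z.1).comap φ)) ≠ 0 := by
          intro h0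
          have := degree_hilbPoly_anti hch hh (core_le _ _)
          rw [h0, Polynomial.degree_zero, le_bot_iff, Polynomial.degree_eq_bot,
            hφ.hilbPoly_comap] at this
          exact hilbPoly_ideal_ne_zero _ this
        obtain ⟨y, hy, -⟩ := exists_point_comap hφ (inferInstance : (core _ _).IsPrime) hch h0
        -- If `z` were not a cone, the cone `y` over it would lie strictly between `z` and `w`,
        -- whose dimensions are `k` and `k + 1`.
        have hzy : z.1 < y := by
          refine lt_iff.2 (lt_of_le_of_ne ?_ fun h => ?_)
          · rw [← comap_le_comap_iff (φ := φ), hy]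
            exact core_le _ _
          · rw [h] at hy
            exact hne hy.symm
        have hyw : y < w := by
          refine lt_iff.2 (lt_of_le_of_ne ?_ fun h => ?_)
          · rw [← comap_le_comap_iff (φ := φ), hy, hw, ← core_core]
            exact core_mono hwz'
          · rw [← h, hw] at hy
            exact hbV (core_le _ _ (hy ▸ mem_core hbz hbs))
        have h1 := dim_lt_of_lt hzy
        have h2 := dim_lt_of_lt hyw
        rw [dim_eq] at h1
        omega
    rw [hrel] at ha
    have hm : (mult V.1 la : ℚ) ≠ 0 := by
      exact_mod_cast mult_ne_zero (by rw [dim_eq]; exact hwd) hwV hfw hfV hla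
    have h3 := sub_mem hb ha
    rw [sub_sub_cancel] at h3
    exact (Submodule.smul_mem_iff _ hm).1 h3

/-- Cycles are pushed down the flag until it reaches dimension `k`, where the only subvariety of
that dimension is the linear subspace itself. -/
theorem degree_flag_bijective (hφ : IsGradedEquiv φ) {c : ℕ} (hck : c + k ≤ n) :
    Function.Bijective (degree k (flag φ c)) := by
  induction h : n - k - c generalizing c with
  | zero =>
    obtain ⟨x, hx, hd⟩ := exists_flag_point hφ (c := c) (by omega)
    have hxc : x ∈ flag φ c := mem_flag.2 fun j hj => by
      have : X j ∈ (ideal x).comap φ := hx ▸ X_mem_span_X_image.2 hj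
      exact this
    have hxk : dim x = k := by omega
    refine degree_bijective (subvariety hxc hxk) fun V => ?_
    suffices V = subvariety hxc hxk from this ▸ Submodule.mem_span_singleton_self _
    refine Subtype.ext (eq_of_le_of_dim_eq (le_iff.2 ?_) (by rw [dim_eq, dim_eq]))
    change ideal x ≤ ideal V.1
    rw [← comap_le_comap_iff (φ := φ), hx]
    refine Ideal.span_le.2 ?_
    rintro _ ⟨j, hj, rfl⟩
    exact mem_flag.1 V.2.1 j hj
  | succ m ih =>
    have ih' := ih (c := c + 1) (by omega) (by omega)
    obtain ⟨x, hx, hd⟩ := exists_flag_point hφ (c := n - k) (by omega)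
    have hxc : x ∈ flag φ (c + 1) := mem_flag.2 fun j hj => by
      have : X j ∈ (ideal x).comap φ := hx ▸ X_mem_span_X_image.2
        (lt_of_lt_of_le hj (by omega : c + 1 ≤ n - k))
      exact this
    have hxk : dim x = k := by omega
    refine degree_bijective (Chow.Subvariety.incl (flag_anti (Nat.le_succ c))
      (subvariety hxc hxk)) fun V => ?_
    -- The value `n + 1 + c` is at least `c`, as the induction requires, and admits all variables,
    -- so the condition on the core is void.
    refine Submodule.span_le.2 ?_ (pt_mem_span_of_core hφ (by omega) (i := n + 1 + c) (by omega) V ?_)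
    · rintro _ ⟨z, hz, rfl⟩
      have h1 := pt_mem_span ih'.1 (⟨z.1, hz, z.2.2⟩ : Chow.Subvariety k (flag φ (c + 1)))
        (subvariety hxc hxk)
      have h2 := Submodule.mem_map_of_mem
        (f := Chow.pushforward k (flag_anti (φ := φ) (Nat.le_succ c))) h1
      rw [Submodule.map_span, Set.image_singleton, pushforward_pt, pushforward_pt] at h2
      exact h2
    · rw [show below n (n + 1 + c) = Set.univ from
        Set.eq_univ_of_forall fun j => mem_below.2 (by have := j.2; omega), core_univ]

end PP
end

/-! ### Arbitrary linear subspaces, by a linear change of coordinates. -/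

noncomputable section

attribute [local instance] MvPolynomial.gradedAlgebra
open MvPolynomial HilbertFn

theorem Submodule.exists_linearEquiv_map_eq {K V : Type*} [Field K] [AddCommGroup V] [Module K V]
    [FiniteDimensional K V] {U U' : Submodule K V} (h : Module.finrank K U = Module.finrank K U') :
    ∃ e : V ≃ₗ[K] V, U.map (e : V →ₗ[K] V) = U' := by
  obtain ⟨C, hC⟩ := U.exists_isCompl
  obtain ⟨C', hC'⟩ := U'.exists_isCompl
  have h1 := Submodule.finrank_add_eq_of_isCompl hC
  have h2 := Submodule.finrank_add_eq_of_isCompl hC'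
  let e₁ : U ≃ₗ[K] U' := LinearEquiv.ofFinrankEq U U' h
  let e₂ : C ≃ₗ[K] C' := LinearEquiv.ofFinrankEq C C' (by omega)
  let e : V ≃ₗ[K] V := (Submodule.prodEquivOfIsCompl U C hC).symm ≪≫ₗ
    (e₁.prodCongr e₂) ≪≫ₗ Submodule.prodEquivOfIsCompl U' C' hC'
  refine ⟨e, Submodule.eq_of_le_of_finrank_eq ?_ ?_⟩
  · rintro _ ⟨u, hu, rfl⟩
    have : e u = e₁ ⟨u, hu⟩ := by
      have h3 := Submodule.prodEquivOfIsCompl_symm_apply_left U C hC ⟨u, hu⟩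
      simp only [e, LinearEquiv.trans_apply]
      rw [h3]
      simp
    rw [LinearEquiv.coe_coe, this]
    exact (e₁ ⟨u, hu⟩).2
  · rw [← h]
    exact LinearEquiv.finrank_map_eq e U

namespace PP
variable {n k : ℕ}

/-- The space of linear forms. -/
abbrev Lin (n : ℕ) : Type := homogeneousSubmodule (Fin (n + 1)) ℂ 1

/-- The coordinate forms. -/
def coord (j : Fin (n + 1)) : Lin n := ⟨X j, isHomogeneous_X ℂ j⟩

/-- The basis of coordinate forms. -/
def coordBasis (n : ℕ) : Module.Basis (Fin (n + 1)) ℂ (Lin n) :=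
  Module.Basis.mk (v := coord)
    (LinearIndependent.of_comp (homogeneousSubmodule (Fin (n + 1)) ℂ 1).subtype
      (linearIndependent_X (Fin (n + 1)) ℂ)) <| by
    intro x _
    have h : (x : MvPolynomial (Fin (n + 1)) ℂ) ∈ Submodule.span ℂ (Set.range X) :=
      homogeneousSubmodule_one_eq_span_X.le x.2
    have h2 : Submodule.span ℂ (Set.range X) =
        (Submodule.span ℂ (Set.range coord)).map (homogeneousSubmodule (Fin (n + 1)) ℂ 1).subtype := by
      rw [Submodule.map_span, ← Set.range_comp]
      rfl
    rw [h2] at h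
    obtain ⟨y, hy, hyx⟩ := h
    rwa [← Subtype.ext hyx]

theorem coordBasis_apply (j : Fin (n + 1)) : coordBasis n j = coord j := by
  rw [coordBasis, Module.Basis.mk_apply]

theorem finrank_lin : Module.finrank ℂ (Lin n) = n + 1 := by
  rw [Module.finrank_eq_card_basis (coordBasis n), Fintype.card_fin]

/-- The substitution of linear forms given by an endomorphism of the space of linear forms. -/
def substHom (e : Lin n →ₗ[ℂ] Lin n) :
    MvPolynomial (Fin (n + 1)) ℂ →ₐ[ℂ] MvPolynomial (Fin (n + 1)) ℂ :=
  aeval fun j => (e (coord j) : MvPolynomial (Fin (n + 1)) ℂ)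

theorem substHom_coe (e : Lin n →ₗ[ℂ] Lin n) (p : Lin n) :
    substHom e (p : MvPolynomial (Fin (n + 1)) ℂ) = e p := by
  have : (substHom e).toLinearMap.comp (homogeneousSubmodule (Fin (n + 1)) ℂ 1).subtype =
      (homogeneousSubmodule (Fin (n + 1)) ℂ 1).subtype.comp e := by
    refine (coordBasis n).ext fun j => ?_
    rw [coordBasis_apply]
    exact aeval_X _ j
  exact LinearMap.congr_fun this p

theorem substHom_isHomogeneous (e : Lin n →ₗ[ℂ] Lin n) {p : MvPolynomial (Fin (n + 1)) ℂ} {d : ℕ}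
    (hp : p.IsHomogeneous d) : (substHom e p).IsHomogeneous d := by
  have := hp.aeval (fun j => (e (coord j) : MvPolynomial (Fin (n + 1)) ℂ)) (n := 1)
    fun j => (e (coord j)).2
  rwa [one_mul] at this

theorem substHom_comp {e e' : Lin n →ₗ[ℂ] Lin n} (h : e.comp e' = LinearMap.id) :
    (substHom e).comp (substHom e') = AlgHom.id ℂ _ := by
  refine algHom_ext fun j => ?_
  rw [AlgHom.comp_apply, substHom, substHom, aeval_X]
  change substHom e _ = _
  rw [substHom_coe, ← LinearMap.comp_apply, h]
  rfl

/-- The change of coordinates given by an automorphism of the space of linear forms. -/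
def substEquiv (e : Lin n ≃ₗ[ℂ] Lin n) :
    MvPolynomial (Fin (n + 1)) ℂ ≃ₐ[ℂ] MvPolynomial (Fin (n + 1)) ℂ :=
  AlgEquiv.ofAlgHom (substHom (e : Lin n →ₗ[ℂ] Lin n)) (substHom (e.symm : Lin n →ₗ[ℂ] Lin n))
    (substHom_comp (by ext1 x; simp)) (substHom_comp (by ext1 x; simp))

theorem substEquiv_isGradedEquiv (e : Lin n ≃ₗ[ℂ] Lin n) : IsGradedEquiv (substEquiv e) := by
  refine fun d p => ⟨fun h => ?_, fun h => substHom_isHomogeneous _ h⟩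
  have := substHom_isHomogeneous (e.symm : Lin n →ₗ[ℂ] Lin n) h
  change ((substEquiv e).symm (substEquiv e p)).IsHomogeneous d at this
  rwa [AlgEquiv.symm_apply_apply] at this

/-- The projective linear subspace where all forms in `U` vanish. -/
def lin (U : Submodule ℂ (Lin n)) : Closeds (PP n) := zeros (Subtype.val '' (U : Set (Lin n)))

theorem mem_lin {U : Submodule ℂ (Lin n)} {x : PP n} :
    x ∈ lin U ↔ ∀ p ∈ U, (p : MvPolynomial (Fin (n + 1)) ℂ) ∈ ideal x := by
  rw [lin, mem_zeros, Set.image_subset_iff]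
  exact Iff.rfl

theorem lin_anti {U U' : Submodule ℂ (Lin n)} (h : U ≤ U') : lin U' ≤ lin U :=
  fun _ hx => mem_lin.2 fun p hp => mem_lin.1 hx p (h hp)

/-- The linear forms vanishing at a point. -/
def forms (x : PP n) : Submodule ℂ (Lin n) := degreePart (ideal x) 1

theorem mem_lin_iff {U : Submodule ℂ (Lin n)} {x : PP n} : x ∈ lin U ↔ U ≤ forms x := mem_lin

theorem finrank_le_of_mem_lin {U : Submodule ℂ (Lin n)} {x : PP n} (hx : x ∈ lin U) :
    Module.finrank ℂ U ≤ n := by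
  by_contra! h
  have h1 := Submodule.finrank_le U
  rw [finrank_lin] at h1
  have h2 : U = ⊤ := Submodule.eq_top_of_finrank_eq (by rw [finrank_lin]; omega)
  obtain ⟨i, hi⟩ := exists_X_notMem x
  exact hi (mem_lin.1 hx (coord i) (h2 ▸ trivial))

theorem finrank_span_coord {c : ℕ} (hc : c ≤ n + 1) :
    Module.finrank ℂ (Submodule.span ℂ (coord '' below n c)) = c := by
  have hli : LinearIndependent ℂ (coord : Fin (n + 1) → Lin n) := by
    have := (coordBasis n).linearIndependent
    rwa [show ⇑(coordBasis n) = coord from funext coordBasis_apply] at this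
  have : Fintype (below n c) := Fintype.ofFinite _
  have h2 := finrank_span_eq_card (R := ℂ)
    (hli.comp (fun j : below n c => j.1) Subtype.val_injective)
  rw [Set.range_comp, Subtype.range_coe] at h2
  rw [h2, ← Nat.card_eq_fintype_card]
  refine (Nat.card_congr ?_).trans (Nat.card_fin c)
  exact
    { toFun := fun j => ⟨j.1, j.2⟩
      invFun := fun j => ⟨⟨j.1, by omega⟩, j.2⟩
      left_inv := fun j => rfl
      right_inv := fun j => rfl }

theorem exists_flag (U : Submodule ℂ (Lin n)) :
    ∃ e : Lin n ≃ₗ[ℂ] Lin n, U = (Submodule.span ℂ (coord '' below n (Module.finrank ℂ U))).map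
      (e : Lin n →ₗ[ℂ] Lin n) := by
  have h1 := Submodule.finrank_le U
  rw [finrank_lin] at h1
  obtain ⟨e, he⟩ := Submodule.exists_linearEquiv_map_eq (U' := U) (finrank_span_coord h1)
  exact ⟨e, he.symm⟩

theorem lin_eq_flag {U : Submodule ℂ (Lin n)} {e : Lin n ≃ₗ[ℂ] Lin n} {c : ℕ}
    (h : U = (Submodule.span ℂ (coord '' below n c)).map (e : Lin n →ₗ[ℂ] Lin n)) :
    lin U = flag (substEquiv e) c := by
  have hX : ∀ j, substEquiv e (X j) = e (coord j) := fun j => substHom_coe _ (coord j)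
  ext x
  change x ∈ lin U ↔ x ∈ flag (substEquiv e) c
  rw [mem_lin_iff, mem_flag, h, Submodule.map_span, Submodule.span_le, Set.image_image,
    Set.image_subset_iff]
  refine forall₂_congr fun j _ => ?_
  rw [hX]
  exact Iff.rfl

theorem degree_lin_bijective {U : Submodule ℂ (Lin n)} (h : Module.finrank ℂ U + k ≤ n) :
    Function.Bijective (degree k (lin U)) := by
  obtain ⟨e, he⟩ := exists_flag U
  rw [lin_eq_flag he]
  exact degree_flag_bijective (substEquiv_isGradedEquiv e) h

/-- The generic point of a projective linear subspace. -/
theorem exists_lin_point {U : Submodule ℂ (Lin n)} (h : Module.finrank ℂ U ≤ n) :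
    ∃ x : PP n, ideal x = Ideal.span (Subtype.val '' (U : Set (Lin n))) ∧
      dim x = n - Module.finrank ℂ U := by
  obtain ⟨e, he⟩ := exists_flag U
  obtain ⟨x, hx, hd⟩ := exists_flag_point (substEquiv_isGradedEquiv e) h
  have hX : ∀ j, substEquiv e (X j) = e (coord j) := fun j => substHom_coe _ (coord j)
  have hxU : x ∈ lin U := by
    rw [lin_eq_flag he, mem_flag]
    intro j hj
    have : X j ∈ (ideal x).comap (substEquiv e) := hx ▸ X_mem_span_X_image.2 hj
    exact this
  refine ⟨x, le_antisymm ?_ ?_, hd⟩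
  · rw [← comap_le_comap_iff (φ := substEquiv e), hx]
    refine Ideal.span_le.2 ?_
    rintro _ ⟨j, hj, rfl⟩
    refine Ideal.mem_comap.2 (Ideal.subset_span ⟨e (coord j), ?_, (hX j).symm⟩)
    rw [he]
    exact Submodule.mem_map_of_mem (Submodule.subset_span ⟨j, hj, rfl⟩)
  · refine Ideal.span_le.2 ?_
    rintro _ ⟨p, hp, rfl⟩
    exact mem_lin.1 hxU p hp

end PP
end

/-! ### Codimension, proportional classes, and free summands of Chow groups. -/

noncomputable section

attribute [local instance] MvPolynomial.gradedAlgebra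
open MvPolynomial HilbertFn

namespace PP
variable {n k : ℕ} {Z : Closeds (PP n)}

theorem mem_closure_iff_le {x y : PP n} : y ∈ closure ({x} : Set (PP n)) ↔ y ≤ x :=
  specializes_iff_mem_closure.symm

theorem eq_of_le_of_le {x y : PP n} (h : x ≤ y) (h' : y ≤ x) : x = y :=
  ideal_injective (le_antisymm (le_iff.1 h') (le_iff.1 h))

theorem eq_or_lt_of_le {x y : PP n} (h : x ≤ y) : x = y ∨ x < y :=
  or_iff_not_imp_left.2 fun hne => lt_of_le_not_ge h fun h' => hne (eq_of_le_of_le h h')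

theorem dim_mono {x y : PP n} (h : x ≤ y) : dim x ≤ dim y := by
  rcases eq_or_lt_of_le h with rfl | h
  · exact le_rfl
  · exact (dim_lt_of_lt h).le

theorem lin_bot : lin (⊥ : Submodule ℂ (Lin n)) = ⊤ :=
  top_unique fun _ _ => mem_lin_iff.2 bot_le

theorem degree_top_bijective (h : k ≤ n) : Function.Bijective (degree k (⊤ : Closeds (PP n))) := by
  rw [← lin_bot]
  exact degree_lin_bijective (by rw [finrank_bot]; omega)

/-- The generic point of a projective linear subspace. -/
theorem exists_forms_eq {U : Submodule ℂ (Lin n)} (h : Module.finrank ℂ U ≤ n) :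
    ∃ x : PP n, forms x = U ∧ (∀ y, y ≤ x ↔ y ∈ lin U) ∧ dim x + Module.finrank ℂ U = n := by
  have aux : ∀ {W : Submodule ℂ (Lin n)}, Module.finrank ℂ W ≤ n →
      ∃ x : PP n, (∀ y, y ≤ x ↔ y ∈ lin W) ∧ dim x + Module.finrank ℂ W = n := by
    intro W hW
    obtain ⟨x, hx, hd⟩ := exists_lin_point hW
    refine ⟨x, fun y => ?_, by omega⟩
    rw [le_iff, hx, Ideal.span_le, mem_lin, Set.image_subset_iff]
    exact Iff.rfl
  obtain ⟨x, hx, hd⟩ := aux h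
  refine ⟨x, ?_, hx, hd⟩
  have hxf : x ∈ lin (forms x) := mem_lin_iff.2 le_rfl
  have hUf : U ≤ forms x := mem_lin_iff.1 ((hx x).1 le_rfl)
  -- The forms vanishing at `x` could a priori exceed `U`. They define a linear subspace with the
  -- same generic point, so equality of dimensions forces equality of ranks.
  obtain ⟨x', hx', hd'⟩ := aux (finrank_le_of_mem_lin hxf)
  have h1 : x' = x := eq_of_le_of_le ((hx x').2 (lin_anti hUf ((hx' x').1 le_rfl))) ((hx' x).2 hxf)
  rw [h1] at hd'
  exact (Submodule.eq_of_le_of_finrank_eq hUf (by omega)).symm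

theorem dim_le (x : PP n) : dim x ≤ n := by
  obtain ⟨g, -, hg, hd⟩ := exists_forms_eq (n := n) (U := ⊥) (by rw [finrank_bot]; omega)
  have := dim_mono ((hg x).2 (lin_bot ▸ trivial))
  omega

theorem coheight_le {x : PP n} {c : ℕ} (h : n ≤ dim x + c) : Order.coheight x ≤ c := by
  induction c generalizing x with
  | zero =>
    rw [Order.coheight_le_coe_iff]
    intro y hy
    have := dim_lt_of_lt hy
    have := dim_le y
    omega
  | succ c ih =>
    rw [Order.coheight_le_coe_iff]
    intro y hy
    have := dim_lt_of_lt hy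
    exact lt_of_le_of_lt (ih (x := y) (by omega)) (by exact_mod_cast Nat.lt_succ_self c)

/-- Dropping one linear equation at a time gives a chain of linear subspaces above `x`. -/
theorem le_coheight {U : Submodule ℂ (Lin n)} {x : PP n} (hx : ∀ y, y ≤ x ↔ y ∈ lin U)
    (hd : dim x + Module.finrank ℂ U = n) : (Module.finrank ℂ U : ℕ∞) ≤ Order.coheight x := by
  induction hc : Module.finrank ℂ U generalizing U x with
  | zero => simp
  | succ c ih =>
    obtain ⟨W, hWU, hW⟩ : ∃ W : Submodule ℂ (Lin n), W ≤ U ∧ Module.finrank ℂ W = c := by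
      obtain ⟨e, he⟩ := exists_flag U
      refine ⟨(Submodule.span ℂ (coord '' below n c)).map (e : Lin n →ₗ[ℂ] Lin n), ?_, ?_⟩
      · rw [he, hc]
        exact Submodule.map_mono (Submodule.span_mono
          (Set.image_mono fun j hj => lt_trans hj (Nat.lt_succ_self c)))
      · exact (LinearEquiv.finrank_map_eq e _).trans (finrank_span_coord (by omega))
    obtain ⟨y, -, hy, hyd⟩ := exists_forms_eq (U := W) (by omega)
    have hxy : x < y := by
      refine (eq_or_lt_of_le ((hy x).2 (lin_anti hWU ((hx x).1 le_rfl)))).resolve_left ?_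
      rintro rfl
      omega
    have := Order.coheight_add_one_le hxy
    push_cast
    exact (add_le_add_left (ih hy hyd hW) 1).trans this

theorem coheight_eq {U : Submodule ℂ (Lin n)} {x : PP n} (hx : ∀ y, y ≤ x ↔ y ∈ lin U)
    (hd : dim x + Module.finrank ℂ U = n) : Order.coheight x = Module.finrank ℂ U :=
  le_antisymm (coheight_le hd.ge) (le_coheight hx hd)

/-- Without a subvariety of dimension `k` the Chow group would vanish, but `degree` maps it onto ℚ.
-/
theorem exists_mem_lin_dim_eq {U : Submodule ℂ (Lin n)} (h : Module.finrank ℂ U + k ≤ n) :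
    ∃ x ∈ lin U, dim x = k := by
  by_contra! hne
  have : IsEmpty (Chow.Subvariety k (lin U)) := ⟨fun z => hne z.1 z.2.1 (dim_eq z)⟩
  obtain ⟨x, hx⟩ := (degree_lin_bijective h).2 1
  obtain ⟨c, rfl⟩ := Submodule.mkQ_surjective _ x
  rw [Subsingleton.elim c 0, map_zero, map_zero] at hx
  exact zero_ne_one hx

/-- Subvarieties of the same dimension in a common linear subspace have proportional classes. -/
theorem pt_mem_span_of_lin {U : Submodule ℂ (Lin n)} (hU : Module.finrank ℂ U + k ≤ n)
    (hUZ : lin U ≤ Z) {z y : Chow.Subvariety k Z} (hz : z.1 ∈ lin U) (hy : y.1 ∈ lin U) :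
    pt z ∈ Submodule.span ℚ {pt y} := by
  have h1 := pt_mem_span (degree_lin_bijective hU).1
    (⟨z.1, hz, z.2.2⟩ : Chow.Subvariety k (lin U)) ⟨y.1, hy, y.2.2⟩
  have h2 := Submodule.mem_map_of_mem (f := Chow.pushforward k hUZ) h1
  rwa [Submodule.map_span, Set.image_singleton, pushforward_pt, pushforward_pt] at h2

theorem pt_mem_span_trans {x y z : Chow.Subvariety k Z} (h : pt z ∈ Submodule.span ℚ {pt y})
    (h' : pt y ∈ Submodule.span ℚ {pt x}) : pt z ∈ Submodule.span ℚ {pt x} :=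
  (Submodule.span_singleton_le_iff_mem _ _).2 h' h

/-- Subvarieties of the same dimension `k` in linear subspaces which meet in dimension at least
`k` have proportional classes. -/
theorem pt_mem_span_of_lin_lin {U W : Submodule ℂ (Lin n)}
    (h : Module.finrank ℂ (U ⊔ W : Submodule ℂ (Lin n)) + k ≤ n)
    (hUZ : lin U ≤ Z) (hWZ : lin W ≤ Z) {z y : Chow.Subvariety k Z} (hz : z.1 ∈ lin U)
    (hy : y.1 ∈ lin W) : pt z ∈ Submodule.span ℚ {pt y} := by
  obtain ⟨x, hx, hd⟩ := exists_mem_lin_dim_eq h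
  have hU : U ≤ U ⊔ W := le_sup_left
  have hW : W ≤ U ⊔ W := le_sup_right
  have hfU := Submodule.finrank_mono hU
  have hfW := Submodule.finrank_mono hW
  have hxU := lin_anti hU hx
  have hxW := lin_anti hW hx
  exact pt_mem_span_trans
    (pt_mem_span_of_lin (y := subvariety (hUZ hxU) hd) (by omega) hUZ hz hxU)
    (pt_mem_span_of_lin (by omega) hWZ hxW hy)

theorem cls_eq_pt {V : Set (PP n)} (z : Chow.Subvariety k Z) (h : IsGenericPoint z.1 V) :
    Chow.cls k Z V = pt z := by
  have hex : ∃ y : Chow.Subvariety k Z, IsGenericPoint y.1 V := ⟨z, h⟩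
  rw [Chow.cls, dif_pos hex, pt, Subtype.ext (hex.choose_spec.eq h)]

theorem range_pushforward {Z' : Closeds (PP n)} (h : Z ≤ Z') :
    LinearMap.range (Chow.pushforward k h) =
      Submodule.span ℚ (pt '' {z : Chow.Subvariety k Z' | z.1 ∈ Z}) := by
  rw [LinearMap.range_eq_map, ← span_range_pt, Submodule.map_span, ← Set.range_comp]
  congr 1
  ext x
  constructor
  · rintro ⟨z, rfl⟩
    exact ⟨Chow.Subvariety.incl h z, z.2.1, (pushforward_pt h z).symm⟩
  · rintro ⟨z, hz, rfl⟩
    exact ⟨⟨z.1, hz, z.2.2⟩, pushforward_pt h _⟩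

theorem ratEquivZero_apply_eq_zero {z : Chow.Subvariety k Z}
    (h : ∀ w : Chow.Subvariety (k + 1) Z, ¬ z.1 ≤ w.1) {c : Chow.Cycle k Z}
    (hc : c ∈ Chow.ratEquivZero k Z) : c z = 0 := by
  have : Chow.ratEquivZero k Z ≤ LinearMap.ker (Finsupp.lapply z : Chow.Cycle k Z →ₗ[ℚ] ℚ) := by
    refine Submodule.span_le.2 ?_
    rintro c ⟨w, f, -, hc⟩
    exact (hc z).2 fun hw => h w hw
  exact this hc

/-- Subvarieties not contained in a subvariety of one dimension more are free generators of a
direct summand of the Chow group. -/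
theorem linearIndependent_isCompl {ι : Type*} {f : ι → Chow.Subvariety k Z}
    (hf : Function.Injective f) (h : ∀ i, ∀ w : Chow.Subvariety (k + 1) Z, ¬ (f i).1 ≤ w.1) :
    LinearIndependent ℚ (fun i => pt (f i)) ∧
      IsCompl (Submodule.span ℚ (Set.range fun i => pt (f i)))
        (Submodule.span ℚ (pt '' (Set.range f)ᶜ)) := by
  -- No divisor involves the subvarieties `f i`, so reading off their coefficients is well defined
  -- on classes.
  let φ : Chow.CH k Z →ₗ[ℚ] ι →₀ ℚ := (Chow.ratEquivZero k Z).liftQ (Finsupp.lcomapDomain f hf) <| by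
    intro c hc
    rw [LinearMap.mem_ker]
    ext i
    exact ratEquivZero_apply_eq_zero (h i) hc
  have hφ : ∀ (z : Chow.Subvariety k Z) (i : ι),
      φ (pt z) i = (Finsupp.single z 1 : Chow.Cycle k Z) (f i) := fun z i => rfl
  have hφf : ∀ i, φ (pt (f i)) = Finsupp.single i 1 := fun i => by
    classical
    ext j
    rw [hφ, Finsupp.single_apply, Finsupp.single_apply]
    simp only [hf.eq_iff]
  refine ⟨LinearIndependent.of_comp φ ?_, ?_, ?_⟩
  · have : φ ∘ (fun i => pt (f i)) = fun i => Finsupp.single i 1 := funext hφf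
    rw [this]
    exact Finsupp.linearIndependent_single_one ℚ ι
  · rw [Submodule.disjoint_def]
    intro x hx hx'
    obtain ⟨c, rfl⟩ := (Finsupp.mem_span_range_iff_exists_finsupp).1 hx
    have h1 : φ (c.sum fun i a => a • pt (f i)) = c := by
      rw [Finsupp.sum, map_sum]
      simp only [map_smul, hφf, Finsupp.smul_single, smul_eq_mul, mul_one]
      exact Finsupp.sum_single c
    have h2 : Submodule.span ℚ (pt '' (Set.range f)ᶜ) ≤ LinearMap.ker φ := by
      refine Submodule.span_le.2 ?_
      rintro _ ⟨z, hz, rfl⟩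
      rw [SetLike.mem_coe, LinearMap.mem_ker]
      ext i
      rw [hφ, Finsupp.zero_apply, Finsupp.single_apply_eq_zero]
      exact fun h => absurd ⟨i, h⟩ hz
    have h3 := h2 hx'
    rw [LinearMap.mem_ker, h1] at h3
    rw [h3, Finsupp.sum_zero_index]
  · rw [codisjoint_iff_le_sup, ← span_range_pt, Submodule.span_le]
    rintro _ ⟨z, rfl⟩
    by_cases hz : z ∈ Set.range f
    · obtain ⟨i, rfl⟩ := hz
      exact Submodule.mem_sup_left (Submodule.subset_span ⟨i, rfl⟩)
    · exact Submodule.mem_sup_right (Submodule.subset_span ⟨z, hz, rfl⟩)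

/-- By sobriety, irreducible closed subsets of the closure correspond to points below `x`, and
chains of such points are bounded by the height of `x`. -/
theorem topologicalKrullDim_closure_le {S : Set (PP n)} {x : PP n} (h : closure S = closure {x}) :
    topologicalKrullDim (closure S) ≤ (dim x : WithBot ℕ∞) := by
  have hx : (dim x : WithBot ℕ∞) = Order.krullDim (Set.Iic x) := by
    rw [← Order.height_eq_krullDim_Iic, height_eq_dim]
    rfl
  rw [hx]
  have hgen : ∀ V : IrreducibleCloseds (closure S), ∃ y : PP n,
      closure {y} = ((↑) '' (V : Set (closure S)) : Set (PP n)) := fun V =>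
    QuasiSober.sober (V.isIrreducible.image _ continuous_subtype_val.continuousOn)
      ((isClosed_closure.isClosedEmbedding_subtypeVal.isClosed_iff_image_isClosed).1 V.isClosed)
  choose g hg using hgen
  have hmem : ∀ V, g V ≤ x := fun V => by
    rw [← mem_closure_iff_le, ← h]
    have : g V ∈ ((↑) '' (V : Set (closure S)) : Set (PP n)) := hg V ▸ subset_closure rfl
    obtain ⟨y, -, hy⟩ := this
    exact hy ▸ y.2
  have hle : ∀ V W, g V ≤ g W ↔ V ≤ W := fun V W => by
    rw [← mem_closure_iff_le, ← isClosed_closure.closure_subset_iff (s := {g V}) |>.trans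
      Set.singleton_subset_iff, hg, hg, Set.image_subset_image_iff Subtype.val_injective]
    rfl
  refine Order.krullDim_le_of_strictMono (fun V => (⟨g V, hmem V⟩ : Set.Iic x)) ?_
  intro V W hVW
  exact lt_of_le_not_ge ((hle V W).2 hVW.le) fun h' => hVW.not_ge ((hle W V).1 h')

end PP
end

/-! ### The singular locus, edges and strata of an arrangement. -/

noncomputable section

attribute [local instance] MvPolynomial.gradedAlgebra
open MvPolynomial HilbertFn

namespace Arrangement
open PP
variable {n r k : ℕ} (A : Arrangement n r) {l : MvPolynomial (Fin (n + 1)) ℂ}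

variable {A} in
theorem mem_comp {j : Fin r} {x : PP n} : x ∈ A.comp j ↔ A.form j ∈ ideal x := by
  rw [comp, mem_zeros, Set.singleton_subset_iff]
  exact Iff.rfl

variable {A} in
theorem mem_X {x : PP n} : x ∈ A.X ↔ ∃ j, x ∈ A.comp j := by
  have hP : (ideal x).IsPrime := inferInstance
  simp only [mem_comp]
  rw [X, mem_zeros, Set.singleton_subset_iff, SetLike.mem_coe, poly, hP.prod_mem_iff]
  constructor
  · rintro ⟨j, -, hj⟩
    exact ⟨j, hP.mem_of_pow_mem _ hj⟩
  · rintro ⟨j, hj⟩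
    exact ⟨j, Finset.mem_univ j, Ideal.pow_mem_of_mem _ hj _ (A.mult_pos j)⟩

theorem form_mul_form_dvd_poly {a b : Fin r} (h : a = b → 2 ≤ A.mult a) :
    A.form a * A.form b ∣ A.poly := by
  by_cases hab : a = b
  · subst hab
    rw [← sq]
    exact (pow_dvd_pow _ (h rfl)).trans (Finset.dvd_prod_of_mem _ (Finset.mem_univ a))
  · have h1 := Finset.prod_dvd_prod_of_subset {a, b} Finset.univ
      (fun j => A.form j ^ A.mult j) (Finset.subset_univ _)
    rw [Finset.prod_pair hab] at h1
    exact (mul_dvd_mul (dvd_pow_self _ (A.mult_pos a).ne')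
      (dvd_pow_self _ (A.mult_pos b).ne')).trans h1

/-- The partial derivatives of a linear form are constants, so those in a prime ideal are zero; by
Euler's formula they cannot all vanish. -/
theorem pderiv_form_notMem (j : Fin r) (x : PP n) : ∃ i, pderiv i (A.form j) ∉ ideal x := by
  by_contra! h
  refine A.ne_zero j ?_
  have h1 : ∀ i, pderiv i (A.form j) = 0 := by
    intro i
    have h2 : (pderiv i (A.form j)).IsHomogeneous 0 := (A.isHomogeneous j).pderiv
    rw [← totalDegree_zero_iff_isHomogeneous, totalDegree_eq_zero_iff_eq_C] at h2
    have h3 := h i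
    rw [h2] at h3 ⊢
    by_contra h4
    refine (inferInstance : (ideal x).IsPrime).ne_top (Ideal.eq_top_of_isUnit_mem _ h3 ?_)
    exact (isUnit_iff_ne_zero.2 fun h5 => h4 (by rw [h5, C_0])).map C
  have h5 := (A.isHomogeneous j).sum_X_mul_pderiv
  simp only [h1, mul_zero, Finset.sum_const_zero, one_smul] at h5
  exact h5.symm

variable {A} in
/-- The singular points lie on two components, or on a multiple component. -/
theorem mem_sing {x : PP n} : x ∈ A.sing ↔
    ∃ a b, (a = b → 2 ≤ A.mult a) ∧ x ∈ A.comp a ∧ x ∈ A.comp b := by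
  have hP : (ideal x).IsPrime := inferInstance
  rw [sing, mem_zeros, Set.insert_subset_iff, Set.range_subset_iff]
  constructor
  · rintro ⟨h1, h2⟩
    obtain ⟨j, hj⟩ := mem_X.1 (mem_zeros.2 (Set.singleton_subset_iff.2 h1) : x ∈ A.X)
    by_contra! hno
    have hm : A.mult j = 1 := by
      by_contra hm
      have := A.mult_pos j
      exact hno j j (fun _ => by omega) hj hj
    -- On a single component of multiplicity one, the derivative of the product is, modulo the ideal
    -- of `x`, a derivative of the linear form times factors not vanishing at `x`.
    have hpoly : A.poly = A.form j * ∏ i ∈ Finset.univ.erase j, A.form i ^ A.mult i := by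
      rw [poly, ← Finset.mul_prod_erase _ _ (Finset.mem_univ j), hm, pow_one]
    have hg : ∏ i ∈ Finset.univ.erase j, A.form i ^ A.mult i ∉ ideal x := by
      rw [hP.prod_mem_iff]
      rintro ⟨i, hi, hix⟩
      exact hno j i (fun h => absurd h.symm (Finset.ne_of_mem_erase hi)) hj
        (mem_comp.2 (hP.mem_of_pow_mem _ hix))
    obtain ⟨i, hi⟩ := A.pderiv_form_notMem j x
    have h3 := h2 i
    rw [hpoly, SetLike.mem_coe, Derivation.leibniz, smul_eq_mul, smul_eq_mul] at h3
    have h4 := (Ideal.add_mem_iff_right _ (Ideal.mul_mem_right _ _ (mem_comp.1 hj))).1 h3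
    exact (hP.mem_or_mem h4).elim hg hi
  · rintro ⟨a, b, hab, ha, hb⟩
    obtain ⟨g, hg⟩ := A.form_mul_form_dvd_poly hab
    rw [mem_comp] at ha hb
    have hab' : A.form a * A.form b ∈ ideal x := Ideal.mul_mem_right _ _ ha
    refine ⟨hg ▸ Ideal.mul_mem_right _ _ hab', fun i => ?_⟩
    rw [hg, SetLike.mem_coe, Derivation.leibniz, Derivation.leibniz]
    simp only [smul_eq_mul]
    exact add_mem (Ideal.mul_mem_right _ _ hab') (Ideal.mul_mem_left _ _
      (add_mem (Ideal.mul_mem_right _ _ ha) (Ideal.mul_mem_right _ _ hb)))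

/-- The linear form of a component. -/
def linearForm (j : Fin r) : Lin n := ⟨A.form j, A.isHomogeneous j⟩

/-- The span of the forms of some components. -/
def edge (I : Set (Fin r)) : Submodule ℂ (Lin n) := Submodule.span ℂ (A.linearForm '' I)

variable {A} in
theorem mem_lin_edge {I : Set (Fin r)} {x : PP n} :
    x ∈ lin (A.edge I) ↔ ∀ j ∈ I, x ∈ A.comp j := by
  rw [mem_lin_iff, edge, Submodule.span_le, Set.image_subset_iff]
  exact forall₂_congr fun j _ => mem_comp.symm

theorem edge_union (I J : Set (Fin r)) : A.edge (I ∪ J) = A.edge I ⊔ A.edge J := by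
  rw [edge, Set.image_union, Submodule.span_union, edge, edge]

theorem finrank_edge_le (I : Finset (Fin r)) : Module.finrank ℂ (A.edge I) ≤ I.card := by
  classical
  have := finrank_span_finset_le_card (R := ℂ) (I.image A.linearForm)
  rw [Finset.coe_image] at this
  exact this.trans Finset.card_image_le

theorem finrank_edge_pair_le (a b : Fin r) : Module.finrank ℂ (A.edge {a, b}) ≤ 2 := by
  have := A.finrank_edge_le {a, b}
  rw [Finset.coe_pair] at this
  exact this.trans Finset.card_le_two

theorem finrank_edge_pair {a b : Fin r} (hab : a ≠ b) : Module.finrank ℂ (A.edge {a, b}) = 2 := by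
  have ha : A.linearForm a ≠ 0 := fun h => A.ne_zero a (congrArg Subtype.val h)
  have hli : LinearIndependent ℂ ![A.linearForm a, A.linearForm b] := by
    refine (LinearIndependent.pair_iff' ha).2 fun c hc => A.distinct a b hab ?_
    have h1 : c • A.form a = A.form b := congrArg Subtype.val hc
    have hc0 : c ≠ 0 := by
      rintro rfl
      exact A.ne_zero b (by rw [← h1, zero_smul])
    have hu : IsUnit (C c : MvPolynomial (Fin (n + 1)) ℂ) := (isUnit_iff_ne_zero.2 hc0).map C
    refine ⟨hu.unit, ?_⟩
    rw [IsUnit.unit_spec, ← h1, smul_eq_C_mul, mul_comm]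
  have := finrank_span_eq_card hli
  rwa [Matrix.range_cons, Matrix.range_cons, Matrix.range_empty, Set.union_empty,
    Set.singleton_union, ← Set.image_pair, Fintype.card_fin] at this

theorem finrank_edge_singleton (a : Fin r) : Module.finrank ℂ (A.edge {a}) = 1 := by
  rw [edge, Set.image_singleton]
  exact finrank_span_singleton fun h => A.ne_zero a (congrArg Subtype.val h)

/-- The generic points of the edges of an arrangement. -/
def IsEdge (x : PP n) : Prop := ∀ y, (∀ j, x ∈ A.comp j → y ∈ A.comp j) → y ≤ x

variable {A}

/-- The nonempty intersections of components have generic points. -/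
theorem exists_isEdge {I : Set (Fin r)} (h : Module.finrank ℂ (A.edge I) ≤ n) :
    ∃ x, A.IsEdge x ∧ (∀ y, y ≤ x ↔ ∀ j ∈ I, y ∈ A.comp j) ∧
      dim x + Module.finrank ℂ (A.edge I) = n := by
  obtain ⟨x, -, hx, hd⟩ := exists_forms_eq h
  have hx' : ∀ y, y ≤ x ↔ ∀ j ∈ I, y ∈ A.comp j := fun y => (hx y).trans mem_lin_edge
  exact ⟨x, fun y hy => (hx' y).2 fun j hj => hy j ((hx' x).1 le_rfl j hj), hx', hd⟩

theorem finrank_edge_le_of_mem {I : Set (Fin r)} {x : PP n} (h : ∀ j ∈ I, x ∈ A.comp j) :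
    Module.finrank ℂ (A.edge I) ≤ n := finrank_le_of_mem_lin (mem_lin_edge.2 h)

theorem exists_isEdge_comp {a : Fin r} (hn : 1 ≤ n) :
    ∃ x, A.IsEdge x ∧ (∀ y, y ≤ x ↔ y ∈ A.comp a) ∧ dim x + 1 = n := by
  obtain ⟨x, hx, hx', hd⟩ := exists_isEdge (A := A) (I := {a})
    (by rw [A.finrank_edge_singleton]; exact hn)
  rw [A.finrank_edge_singleton] at hd
  exact ⟨x, hx, fun y => by rw [hx' y]; simp, hd⟩

theorem exists_isEdge_inter {a b : Fin r} (hab : a ≠ b) (hn : 2 ≤ n) :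
    ∃ x, A.IsEdge x ∧ (∀ y, y ≤ x ↔ y ∈ A.comp a ∧ y ∈ A.comp b) ∧ dim x + 2 = n := by
  obtain ⟨x, hx, hx', hd⟩ := exists_isEdge (A := A) (I := {a, b})
    (by rw [A.finrank_edge_pair hab]; exact hn)
  rw [A.finrank_edge_pair hab] at hd
  exact ⟨x, hx, fun y => by rw [hx' y]; simp, hd⟩

theorem one_le_of_mem_comp {a : Fin r} {x : PP n} (hx : x ∈ A.comp a) : 1 ≤ n := by
  have := finrank_edge_le_of_mem (A := A) (I := {a}) (x := x) (by simpa using hx)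
  rwa [A.finrank_edge_singleton] at this

theorem two_le_of_mem_comp {a b : Fin r} (hab : a ≠ b) {x : PP n} (ha : x ∈ A.comp a)
    (hb : x ∈ A.comp b) : 2 ≤ n := by
  have := finrank_edge_le_of_mem (A := A) (I := {a, b}) (x := x) (by simpa using ⟨ha, hb⟩)
  rwa [A.finrank_edge_pair hab] at this

theorem dim_le_of_mem_comp {a : Fin r} {x : PP n} (hx : x ∈ A.comp a) : dim x + 1 ≤ n := by
  obtain ⟨y, -, hy, hd⟩ := exists_isEdge_comp (A := A) (a := a) (one_le_of_mem_comp hx)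
  have := dim_mono ((hy x).2 hx)
  omega

theorem dim_le_of_mem_comp_comp {a b : Fin r} (hab : a ≠ b) {x : PP n} (ha : x ∈ A.comp a)
    (hb : x ∈ A.comp b) : dim x + 2 ≤ n := by
  obtain ⟨y, -, hy, hd⟩ := exists_isEdge_inter (A := A) hab (two_le_of_mem_comp hab ha hb)
  have := dim_mono ((hy x).2 ⟨ha, hb⟩)
  omega

/-- A component of multiplicity one is not contained in Σ: its generic point would lie on a second
component, which has codimension at least two. -/
theorem mem_sing₁ {x : PP n} : x ∈ A.sing₁ ↔ ∃ j, 2 ≤ A.mult j ∧ x ∈ A.comp j := by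
  have h0 : x ∈ A.sing₁ ↔ ∃ j, A.comp j ≤ A.sing ∧ x ∈ A.comp j := by
    change x ∈ ⋃ j ∈ {j | A.comp j ≤ A.sing}, (A.comp j : Set (PP n)) ↔ _
    simp
  rw [h0]
  refine exists_congr fun j => and_congr_left fun hx => ⟨fun h => ?_, fun h y hy => ?_⟩
  · obtain ⟨y, -, hy, hd⟩ := exists_isEdge_comp (A := A) (a := j) (one_le_of_mem_comp hx)
    have hyj := (hy y).1 le_rfl
    obtain ⟨a, b, hab, ha, hb⟩ := mem_sing.1 (h hyj)
    by_cases haj : a = j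
    · by_cases hbj : b = j
      · exact haj ▸ hab (haj.trans hbj.symm)
      · have := dim_le_of_mem_comp_comp hbj hb hyj
        omega
    · have := dim_le_of_mem_comp_comp haj ha hyj
      omega
  · exact mem_sing.2 ⟨j, j, fun _ => h, hy, hy⟩

namespace IsEdge
variable {x : PP n}

theorem lin_edge (hx : A.IsEdge x) (y : PP n) : y ≤ x ↔ y ∈ lin (A.edge {j | x ∈ A.comp j}) := by
  rw [mem_lin_edge]
  exact ⟨fun h j hj => mem_of_le hj h, hx y⟩

theorem dim_add_finrank (hx : A.IsEdge x) :
    dim x + Module.finrank ℂ (A.edge {j | x ∈ A.comp j}) = n := by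
  obtain ⟨y, -, hy, hd⟩ := exists_isEdge (A := A) (finrank_edge_le_of_mem (x := x) fun j hj => hj)
  have h1 : x = y := eq_of_le_of_le ((hy x).2 fun j hj => hj) (hx y ((hy y).1 le_rfl))
  rwa [← h1] at hd

theorem coheight_add_dim (hx : A.IsEdge x) {i : ℕ} (h : Order.coheight x = i) :
    i + dim x = n := by
  rw [coheight_eq hx.lin_edge hx.dim_add_finrank] at h
  have := hx.dim_add_finrank
  have : Module.finrank ℂ (A.edge {j | x ∈ A.comp j}) = i := by exact_mod_cast h
  omega

theorem coheight_eq_of_add (hx : A.IsEdge x) {i : ℕ} (h : i + dim x = n) :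
    Order.coheight x = i := by
  rw [coheight_eq hx.lin_edge hx.dim_add_finrank]
  have := hx.dim_add_finrank
  congr 1
  omega

/-- The general hyperplane contains no edge, so it misses the generic point of every edge. Removing
it thus changes neither the closures nor the codimensions of strata. -/
theorem notMem_zeros (hx : A.IsEdge x) (hl : A.IsGeneral l) : x ∉ zeros {l} := by
  intro h
  refine hl.2 {j | x ∈ A.comp j} ⟨x, Set.mem_iInter₂.2 fun j hj => hj⟩ fun y hy => ?_
  exact mem_of_le h (hx y fun j hj => Set.mem_iInter₂.1 hy j hj)

end IsEdge

variable (A l) in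
/-- The stratum of a point. -/
def stratum (x : PP n) : Set (PP n) :=
  {y | (∀ j, y ∈ A.comp j ↔ x ∈ A.comp j) ∧ y ∉ zeros {l}}

namespace IsEdge
variable {x : PP n}

theorem mem_stratum (hx : A.IsEdge x) (hl : A.IsGeneral l) : x ∈ A.stratum l x :=
  ⟨fun _ => Iff.rfl, hx.notMem_zeros hl⟩

theorem le_of_mem_stratum (hx : A.IsEdge x) {y : PP n} (hy : y ∈ A.stratum l x) : y ≤ x :=
  hx y fun j hj => (hy.1 j).2 hj

theorem closure_stratum (hx : A.IsEdge x) (hl : A.IsGeneral l) :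
    closure (A.stratum l x) = closure {x} :=
  (closure_minimal (fun _ hy => mem_closure_iff_le.2 (hx.le_of_mem_stratum hy))
    isClosed_closure).antisymm
      (closure_mono (Set.singleton_subset_iff.2 (hx.mem_stratum hl)))

theorem codim_stratum (hx : A.IsEdge x) (hl : A.IsGeneral l) :
    Chow.codim (A.stratum l x) = Order.coheight x :=
  le_antisymm (iInf₂_le x (hx.mem_stratum hl))
    (le_iInf₂ fun _ hy => Order.coheight_anti (hx.le_of_mem_stratum hy))

theorem stratum_subset (hx : A.IsEdge x) {Z : Closeds (PP n)} (h : x ∈ Z) :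
    A.stratum l x ⊆ Z := fun _ hy => mem_of_le h (hx.le_of_mem_stratum hy)

theorem stratum_mem_strata (hx : A.IsEdge x) (hl : A.IsGeneral l) (h : x ∈ A.sing) :
    A.stratum l x ∈ A.strata l := by
  have hI : A.indexSet (A.stratum l x) = {j | x ∈ A.comp j} := by
    ext j
    exact ⟨fun hj => hj (hx.mem_stratum hl), fun hj => hx.stratum_subset hj⟩
  refine ⟨⟨x, hx.mem_stratum hl⟩, hx.stratum_subset h, ?_⟩
  rw [hI]
  ext y
  simp only [Set.mem_sdiff, Set.mem_iInter, Set.mem_union, Set.mem_iUnion, not_or, not_exists,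
    Set.mem_compl_iff, Set.mem_ofPred_eq, SetLike.mem_coe, stratum]
  rw [← and_assoc]
  refine and_congr_left fun _ => ?_
  constructor
  · exact fun hy => ⟨fun j hj => (hy j).2 hj, fun j hj hyj => hj ((hy j).1 hyj)⟩
  · exact fun hy j => ⟨fun hyj => by_contra fun hj => hy.2 j hj hyj, hy.1 j⟩

end IsEdge

/-- Every stratum has a generic point. -/
theorem exists_eq_stratum {S : Set (PP n)} (hS : S ∈ A.strata l) (hl : A.IsGeneral l) :
    ∃ x, A.IsEdge x ∧ x ∈ A.sing ∧ S = A.stratum l x := by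
  obtain ⟨⟨y, hy⟩, hsing, hS⟩ := hS
  have hyI : ∀ j ∈ A.indexSet S, y ∈ A.comp j := fun j hj => hj hy
  obtain ⟨x, hx, hx', -⟩ := exists_isEdge (A := A) (finrank_edge_le_of_mem hyI)
  -- A component through the generic point `x` contains every specialization of `x`, hence all of
  -- `S`.
  have hI : ∀ j, x ∈ A.comp j ↔ j ∈ A.indexSet S := fun j =>
    ⟨fun hj z hz => mem_of_le hj ((hx' z).2 fun i hi => hi hz), fun hj => (hx' x).1 le_rfl j hj⟩
  have hSx : S = A.stratum l x := by
    rw [hS]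
    ext z
    simp only [Set.mem_sdiff, Set.mem_iInter, Set.mem_union, Set.mem_iUnion, not_or, not_exists,
      Set.mem_compl_iff, Set.mem_ofPred_eq, SetLike.mem_coe, stratum, hI]
    rw [← and_assoc]
    refine and_congr_left fun _ => ?_
    constructor
    · exact fun hz j => ⟨fun hzj => by_contra fun hj => hz.2 j hj hzj, hz.1 j⟩
    · exact fun hz => ⟨fun j hj => (hz j).2 hj, fun j hj hzj => hj ((hz j).1 hzj)⟩
  exact ⟨x, hx, hsing (hSx ▸ hx.mem_stratum hl), hSx⟩

end Arrangement
end

/-! ### Chow groups of X, Σ₁ and Σ. -/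

noncomputable section

attribute [local instance] MvPolynomial.gradedAlgebra
open MvPolynomial HilbertFn

namespace Arrangement
open PP
variable {n r k : ℕ} {A : Arrangement n r} {l : MvPolynomial (Fin (n + 1)) ℂ}

theorem IsEdge.eq_of_stratum_eq {x y : PP n} (hx : A.IsEdge x) (hy : A.IsEdge y)
    (hl : A.IsGeneral l) (h : A.stratum l x = A.stratum l y) : x = y :=
  eq_of_le_of_le (hy.le_of_mem_stratum (h ▸ hx.mem_stratum hl))
    (hx.le_of_mem_stratum (h ▸ hy.mem_stratum hl))

theorem IsEdge.closure_stratum_eq_lin {x : PP n} (hx : A.IsEdge x) (hl : A.IsGeneral l) :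
    Closeds.closure (A.stratum l x) = lin (A.edge {j | x ∈ A.comp j}) := by
  ext y
  change y ∈ closure (A.stratum l x) ↔ _
  rw [hx.closure_stratum hl, mem_closure_iff_le, hx.lin_edge]
  rfl

theorem IsEdge.degree_closure_stratum_bijective {x : PP n} (hx : A.IsEdge x) (hl : A.IsGeneral l)
    (hk : k ≤ dim x) : Function.Bijective (degree k (Closeds.closure (A.stratum l x))) := by
  rw [hx.closure_stratum_eq_lin hl]
  have := hx.dim_add_finrank
  exact degree_lin_bijective (by omega)

/-- The generic points of the strata of codimension `i`. -/
theorem exists_of_mem_strataCodim {i : ℕ} {S : Set (PP n)} (hS : S ∈ A.strataCodim l i)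
    (hl : A.IsGeneral l) :
    ∃ x, A.IsEdge x ∧ x ∈ A.sing ∧ i + dim x = n ∧ S = A.stratum l x := by
  obtain ⟨x, hx, hs, rfl⟩ := exists_eq_stratum hS.1 hl
  exact ⟨x, hx, hs, hx.coheight_add_dim (hx.codim_stratum hl ▸ hS.2), rfl⟩

theorem IsEdge.stratum_mem_strataCodim {i : ℕ} {x : PP n} (hx : A.IsEdge x) (hl : A.IsGeneral l)
    (hs : x ∈ A.sing) (hi : i + dim x = n) : A.stratum l x ∈ A.strataCodim l i :=
  ⟨hx.stratum_mem_strata hl hs, by rw [hx.codim_stratum hl, hx.coheight_eq_of_add hi]⟩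

/-- Translates the splitting of `linearIndependent_isCompl` from generic points to strata: sending a
stratum to its generic point is a bijection from `T` to `V`. -/
theorem linearIndependent_isCompl_strata {i : ℕ} {T : Set (Set (PP n))} (hl : A.IsGeneral l)
    (hki : k + i = n) (hT : T ⊆ A.strataCodim l i) {V : Set (Chow.Subvariety k A.sing)}
    (hTV : ∀ z : Chow.Subvariety k A.sing, A.IsEdge z.1 → A.stratum l z.1 ∈ T → z ∈ V)
    (hVT : ∀ z ∈ V, A.IsEdge z.1 ∧ A.stratum l z.1 ∈ T)
    (hV : ∀ z ∈ V, ∀ w : Chow.Subvariety (k + 1) A.sing, ¬ z.1 ≤ w.1) :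
    LinearIndependent ℚ (fun S : T => Chow.cls k A.sing (closure S.1)) ∧
      IsCompl (Submodule.span ℚ (Set.range fun S : T => Chow.cls k A.sing (closure S.1)))
        (Submodule.span ℚ (pt '' Vᶜ)) := by
  have hex : ∀ S : T, ∃ z : Chow.Subvariety k A.sing, A.IsEdge z.1 ∧ S.1 = A.stratum l z.1 := by
    intro S
    obtain ⟨x, hx, hs, hd, hS⟩ := exists_of_mem_strataCodim (hT S.2) hl
    exact ⟨subvariety hs (by omega), hx, hS⟩
  choose f hf hfS using hex
  have hcls : (fun S : T => Chow.cls k A.sing (closure S.1)) = fun S => pt (f S) := by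
    funext S
    refine cls_eq_pt _ ?_
    change closure {(f S).1} = closure S.1
    rw [hfS S, (hf S).closure_stratum hl]
  have hrange : Set.range f = V := by
    ext z
    constructor
    · rintro ⟨S, rfl⟩
      exact hTV _ (hf S) (hfS S ▸ S.2)
    · intro hz
      obtain ⟨h1, h2⟩ := hVT z hz
      exact ⟨⟨_, h2⟩, Subtype.ext ((hf _).eq_of_stratum_eq h1 hl (hfS ⟨_, h2⟩).symm)⟩
  rw [hcls, ← hrange]
  refine linearIndependent_isCompl (fun S S' h => Subtype.ext ?_) fun S => ?_
  · rw [hfS S, hfS S', h]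
  · exact hV _ (hrange ▸ Set.mem_range_self S)

theorem exists_mem_comp_of_dim {x : PP n} (hx : x ∈ A.sing) (hd : n ≤ dim x + 1) :
    ∃ a, 2 ≤ A.mult a ∧ x ∈ A.comp a := by
  obtain ⟨a, b, hab, ha, hb⟩ := mem_sing.1 hx
  refine ⟨a, hab (by_contra fun h => ?_), ha⟩
  have := dim_le_of_mem_comp_comp h ha hb
  omega

theorem dim_add_one_le_of_mem_sing {x : PP n} (hx : x ∈ A.sing) : dim x + 1 ≤ n := by
  obtain ⟨a, -, -, ha, -⟩ := mem_sing.1 hx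
  exact dim_le_of_mem_comp ha

theorem isEdge_of_mem_comp {a : Fin r} {x : PP n} (hx : x ∈ A.comp a) (hd : n ≤ dim x + 1) :
    A.IsEdge x := by
  obtain ⟨y, hy, hy', hyd⟩ := exists_isEdge_comp (A := A) (a := a) (one_le_of_mem_comp hx)
  rwa [eq_of_le_of_dim_eq ((hy' x).2 hx) (by omega)]

theorem isEdge_of_mem_comp_comp {a b : Fin r} (hab : a ≠ b) {x : PP n} (ha : x ∈ A.comp a)
    (hb : x ∈ A.comp b) (hd : n ≤ dim x + 2) : A.IsEdge x := by
  obtain ⟨y, hy, hy', hyd⟩ := exists_isEdge_inter (A := A) hab (two_le_of_mem_comp hab ha hb)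
  rwa [eq_of_le_of_dim_eq ((hy' x).2 ⟨ha, hb⟩) (by omega)]

/-- The classes of the components form a basis of `CH_{n-1}(X)`. -/
theorem basis_X (A : Arrangement n r) (hk : k + 1 = n) :
    LinearIndependent ℚ (fun j => Chow.cls k A.X (A.comp j : Set (PP n))) ∧
      Submodule.span ℚ (Set.range fun j => Chow.cls k A.X (A.comp j : Set (PP n))) = ⊤ := by
  have hex : ∀ j : Fin r, ∃ z : Chow.Subvariety k A.X, ∀ y, y ≤ z.1 ↔ y ∈ A.comp j := by
    intro j
    obtain ⟨x, -, hx, hd⟩ := exists_isEdge_comp (A := A) (a := j) (by omega)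
    exact ⟨subvariety (mem_X.2 ⟨j, (hx x).1 le_rfl⟩) (by omega), hx⟩
  choose f hf using hex
  have hfm : ∀ j, (f j).1 ∈ A.comp j := fun j => (hf j _).1 le_rfl
  have hcls : (fun j => Chow.cls k A.X (A.comp j : Set (PP n))) = fun j => pt (f j) := by
    funext j
    refine cls_eq_pt _ ?_
    ext y
    rw [mem_closure_iff_le, hf]
    rfl
  have hsurj : Function.Surjective f := by
    intro z
    obtain ⟨j, hj⟩ := mem_X.1 z.2.1
    exact ⟨j, (Subtype.ext (eq_of_le_of_dim_eq ((hf j _).2 hj) (by rw [dim_eq, dim_eq]))).symm⟩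
  rw [hcls]
  have := linearIndependent_isCompl (f := f) (fun i j h => ?_) fun j w => ?_
  · refine ⟨this.1, ?_⟩
    have h2 := this.2.sup_eq_top
    rwa [hsurj.range_eq, Set.compl_univ, Set.image_empty, Submodule.span_empty, sup_bot_eq] at h2
  -- Two indices with the same generic point would place it on two distinct components, in
  -- codimension two.
  · by_contra hij
    have := dim_le_of_mem_comp_comp hij (hfm i) (h ▸ hfm j)
    rw [dim_eq] at this
    omega
  · obtain ⟨i, hi⟩ := mem_X.1 w.2.1
    have := dim_le_of_mem_comp hi
    rw [dim_eq] at this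
    omega

/-- Any two of the hyperplanes meet in dimension at least n-2, so all `k`-dimensional classes are
proportional to one in a fixed hyperplane. -/
theorem degree_X_bijective (hr : 0 < r) (A : Arrangement n r) (hk : k + 2 ≤ n) :
    Function.Bijective (degree k A.X) := by
  have hle : ∀ a, lin (A.edge {a}) ≤ A.X := fun a x hx => mem_X.2 ⟨a, mem_lin_edge.1 hx a rfl⟩
  obtain ⟨x, hx, hd⟩ := exists_mem_lin_dim_eq (k := k) (U := A.edge {⟨0, hr⟩})
    (by rw [A.finrank_edge_singleton]; omega)
  refine degree_bijective (subvariety (hle _ hx) hd) fun z => ?_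
  obtain ⟨a, ha⟩ := mem_X.1 z.2.1
  refine pt_mem_span_of_lin_lin ?_ (hle a) (hle _) (mem_lin_edge.2 (by simpa using ha)) hx
  rw [← edge_union, Set.singleton_union]
  have := A.finrank_edge_pair_le a ⟨0, hr⟩
  omega

theorem degree_sing₁_bijective (hne : (A.sing₁ : Set (PP n)).Nonempty) (hk : k + 2 ≤ n) :
    Function.Bijective (degree k A.sing₁) := by
  obtain ⟨y, hy⟩ := hne
  obtain ⟨b, hb, -⟩ := mem_sing₁.1 hy
  have hle : ∀ a, 2 ≤ A.mult a → lin (A.edge {a}) ≤ A.sing₁ := fun a ha x hx =>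
    mem_sing₁.2 ⟨a, ha, mem_lin_edge.1 hx a rfl⟩
  obtain ⟨x, hx, hd⟩ := exists_mem_lin_dim_eq (k := k) (U := A.edge {b})
    (by rw [A.finrank_edge_singleton]; omega)
  refine degree_bijective (subvariety (hle b hb hx) hd) fun z => ?_
  obtain ⟨a, ha, hza⟩ := mem_sing₁.1 z.2.1
  refine pt_mem_span_of_lin_lin ?_ (hle a ha) (hle b hb) (mem_lin_edge.2 (by simpa using hza)) hx
  rw [← edge_union, Set.singleton_union]
  have := A.finrank_edge_pair_le a b
  omega

/-- Pieces X_a ∩ X_b and X_a ∩ X_c are cut out together by three forms, so they meet in dimension at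
least n-3. Taking a = b covers the multiple hyperplanes. -/
theorem degree_sing_bijective (hne : (A.sing : Set (PP n)).Nonempty) (hk : k + 3 ≤ n) :
    Function.Bijective (degree k A.sing) := by
  obtain ⟨y, hy⟩ := hne
  obtain ⟨c, d, hcd, -⟩ := mem_sing.1 hy
  have hle : ∀ a b, (a = b → 2 ≤ A.mult a) → lin (A.edge {a, b}) ≤ A.sing := fun a b hab x hx =>
    mem_sing.2 ⟨a, b, hab, mem_lin_edge.1 hx a (by simp), mem_lin_edge.1 hx b (by simp)⟩
  have hrank : ∀ a b c : Fin r,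
      Module.finrank ℂ (A.edge {a, b} ⊔ A.edge {a, c} : Submodule ℂ (Lin n)) + k ≤ n := by
    intro a b c
    have h1 := A.finrank_edge_le {a, b, c}
    have h2 := Finset.card_le_three (a := a) (b := b) (c := c)
    have h3 : ({a, b} ∪ {a, c} : Set (Fin r)) = (({a, b, c} : Finset (Fin r)) : Set (Fin r)) := by
      ext j
      simp
      tauto
    rw [← edge_union, h3]
    omega
  have hpair : ∀ a b : Fin r, Module.finrank ℂ (A.edge {a, b}) + k ≤ n := fun a b => by
    have := A.finrank_edge_pair_le a b
    omega
  obtain ⟨x, hx, hd⟩ := exists_mem_lin_dim_eq (k := k) (hpair c d)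
  refine degree_bijective (subvariety (hle c d hcd hx) hd) fun z => ?_
  obtain ⟨a, b, hab, ha, hb⟩ := mem_sing.1 z.2.1
  have hz : z.1 ∈ lin (A.edge {a, b}) := mem_lin_edge.2 (by simpa using ⟨ha, hb⟩)
  by_cases hac : a = c
  · subst hac
    exact pt_mem_span_of_lin_lin (hrank a b d) (hle a b hab) (hle a d hcd) hz hx
  -- For `a ≠ c` the piece X_a ∩ X_c lies in Σ and shares a hyperplane with each of the two pieces,
  -- so it links them.
  · obtain ⟨w, hw, hwd⟩ := exists_mem_lin_dim_eq (k := k) (hpair a c)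
    have hle' := hle a c fun h => absurd h hac
    refine pt_mem_span_trans (y := subvariety (hle' hw) hwd)
      (pt_mem_span_of_lin_lin (hrank a b c) (hle a b hab) hle' hz hw) ?_
    refine pt_mem_span_of_lin_lin ?_ hle' (hle c d hcd) hw hx
    rw [Set.pair_comm a c]
    exact hrank c a d

/-- The classes of the closures of the strata of codimension one form a basis of
`CH_{n-1}(Σ)`. -/
theorem basis_sing (hl : A.IsGeneral l) (hk : k + 1 = n) :
    LinearIndependent ℚ (fun S : A.strata₁ l 1 => Chow.cls k A.sing (closure S.1)) ∧
      Submodule.span ℚ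
        (Set.range fun S : A.strata₁ l 1 => Chow.cls k A.sing (closure S.1)) = ⊤ := by
  have := linearIndependent_isCompl_strata (A := A) (T := A.strata₁ l 1)
    (V := Set.univ) hl hk (fun S hS => hS.1) (fun _ _ _ => trivial) (fun z _ => ?_) fun z _ w => ?_
  · refine ⟨this.1, ?_⟩
    have h2 := this.2.sup_eq_top
    rwa [Set.compl_univ, Set.image_empty, Submodule.span_empty, sup_bot_eq] at h2
  · have hd := dim_eq z
    obtain ⟨a, ha, hza⟩ := exists_mem_comp_of_dim z.2.1 (by omega)
    have hz := isEdge_of_mem_comp hza (by omega)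
    exact ⟨hz, hz.stratum_mem_strataCodim hl z.2.1 (by omega),
      hz.stratum_subset (mem_sing₁.2 ⟨a, ha, hza⟩)⟩
  · have := dim_add_one_le_of_mem_sing w.2.1
    rw [dim_eq] at this
    omega

/-- Σ₂ lies in the finite, hence closed, union of those X_a ∩ X_b not contained in Σ₁. A point of it
of dimension at least n-2 is generic in such an intersection, which would lie in Σ₁ if the point
did. -/
theorem notMem_sing₁_of_mem_sing₂ {x : PP n} (hx : x ∈ A.sing₂) (hd : n ≤ dim x + 2) :
    x ∉ A.sing₁ := by
  let J : Set (Fin r × Fin r) :=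
    {p | p.1 ≠ p.2 ∧ ¬ ((A.comp p.1 ∩ A.comp p.2 : Set (PP n)) ⊆ A.sing₁)}
  have hclosed : IsClosed (⋃ p ∈ J, (A.comp p.1 ∩ A.comp p.2 : Set (PP n))) :=
    (Set.toFinite J).isClosed_biUnion fun p _ => (A.comp p.1).isClosed.inter (A.comp p.2).isClosed
  have hsub : (A.sing : Set (PP n)) \ A.sing₁ ⊆ ⋃ p ∈ J, (A.comp p.1 ∩ A.comp p.2 : Set (PP n)) := by
    rintro y ⟨hy, hy'⟩
    obtain ⟨a, b, hab, ha, hb⟩ := mem_sing.1 hy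
    refine Set.mem_iUnion₂.2 ⟨(a, b), ⟨fun h => hy' ?_, fun h => hy' (h ⟨ha, hb⟩)⟩, ha, hb⟩
    exact mem_sing₁.2 ⟨a, hab h, ha⟩
  obtain ⟨⟨a, b⟩, ⟨hab, hJ⟩, ha, hb⟩ := Set.mem_iUnion₂.1 (closure_minimal hsub hclosed hx)
  obtain ⟨y, -, hy, hyd⟩ := exists_isEdge_inter (A := A) hab (two_le_of_mem_comp hab ha hb)
  have hxy : x = y := eq_of_le_of_dim_eq ((hy x).2 ⟨ha, hb⟩) (by omega)
  exact fun h => hJ fun z hz => mem_of_le h (hxy ▸ (hy z).2 hz)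

/-- The closures of the strata of codimension two in `Σ₂` generate a direct complement of the
image of `CH_{n-2}(Σ₁)`. -/
theorem linearIndependent_isCompl_sing (hl : A.IsGeneral l) (hk : k + 2 = n) :
    LinearIndependent ℚ (fun S : A.strata₂ l 2 => Chow.cls k A.sing (closure S.1)) ∧
      IsCompl (Submodule.span ℚ
          (Set.range fun S : A.strata₂ l 2 => Chow.cls k A.sing (closure S.1)))
        (LinearMap.range (Chow.pushforward k A.sing₁_le)) := by
  have := linearIndependent_isCompl_strata (A := A) (T := A.strata₂ l 2)
    (V := {z : Chow.Subvariety k A.sing | z.1 ∉ A.sing₁}) hl hk (fun S hS => hS.1)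
    (fun z hz hzT => ?_) (fun z hz => ?_) fun z hz w hzw => ?_
  · rw [range_pushforward]
    convert this using 4
    ext z
    exact not_not.symm
  · have hd := dim_eq z
    exact notMem_sing₁_of_mem_sing₂ (hzT.2 (hz.mem_stratum hl)) (by omega)
  · have hd := dim_eq z
    obtain ⟨a, b, hab, ha, hb⟩ := mem_sing.1 z.2.1
    have hne : a ≠ b := fun h => hz (mem_sing₁.2 ⟨a, hab h, ha⟩)
    have hze := isEdge_of_mem_comp_comp hne ha hb (by omega)
    refine ⟨hze, hze.stratum_mem_strataCodim hl z.2.1 (by omega), hze.stratum_subset ?_⟩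
    exact subset_closure ⟨z.2.1, hz⟩
  · have hd := dim_eq w
    -- A subvariety of Σ of dimension n-1 lies in a multiple component, hence in Σ₁, and cannot
    -- contain a point outside Σ₁.
    obtain ⟨a, ha, hwa⟩ := exists_mem_comp_of_dim w.2.1 (by omega)
    exact hz (mem_of_le (mem_sing₁.2 ⟨a, ha, hwa⟩) hzw)

end Arrangement
end

open Chow in
theorem proposition3p6 {n r : ℕ} (hr : 0 < r) (A : Arrangement n r)
    (l : MvPolynomial (Fin (n + 1)) ℂ) (hl : A.IsGeneral l) :
    -- `CH_{n-1}(X)` has the basis `[X_j]`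
    (∀ k, k + 1 = n →
      LinearIndependent ℚ (fun j => cls k A.X (A.comp j : Set (PP n))) ∧
      Submodule.span ℚ (Set.range fun j => cls k A.X (A.comp j : Set (PP n))) = ⊤) ∧
    -- `CH_k(X) = ℚ` for `k ≤ n - 2`
    (∀ k, k + 2 ≤ n → Nonempty (CH k A.X ≃ₗ[ℚ] ℚ)) ∧
    -- `CH_{n-1}(Σ)`
    (∀ k, k + 1 = n →
      LinearIndependent ℚ (fun S : A.strata₁ l 1 => cls k A.sing (closure S.1)) ∧
      Submodule.span ℚ (Set.range fun S : A.strata₁ l 1 => cls k A.sing (closure S.1)) = ⊤) ∧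
    -- `CH_{n-2}(Σ)` if `Σ₁ ≠ ∅`; the summand `ℚ` is the image of `CH_{n-2}(Σ₁)`
    (∀ k, k + 2 = n → (A.sing₁ : Set (PP n)).Nonempty →
      LinearIndependent ℚ (fun S : A.strata₂ l 2 => cls k A.sing (closure S.1)) ∧
      IsCompl (Submodule.span ℚ (Set.range fun S : A.strata₂ l 2 => cls k A.sing (closure S.1)))
        (LinearMap.range (pushforward k A.sing₁_le)) ∧
      Nonempty (LinearMap.range (pushforward k A.sing₁_le) ≃ₗ[ℚ] ℚ) ∧
      Function.Injective (pushforward k A.sing₁_le) ∧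
      Function.Bijective (pushforward k (le_top : A.sing₁ ≤ ⊤))) ∧
    -- `CH_{n-2}(Σ)` if `Σ₁ = ∅`
    (∀ k, k + 2 = n → (A.sing₁ : Set (PP n)) = ∅ →
      LinearIndependent ℚ (fun S : A.strata₂ l 2 => cls k A.sing (closure S.1)) ∧
      Submodule.span ℚ (Set.range fun S : A.strata₂ l 2 => cls k A.sing (closure S.1)) = ⊤) ∧
    -- `CH_k(Σ) = ℚ` for `k ≤ n - 3`
    (∀ k, k + 3 ≤ n → (A.sing : Set (PP n)).Nonempty → Nonempty (CH k A.sing ≃ₗ[ℚ] ℚ)) ∧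
    -- canonical isomorphisms for edges of codimension at least `3`
    (∀ i, 3 ≤ i → ∀ S (hS : S ∈ A.strataCodim l i),
      topologicalKrullDim (closure S) + 3 ≤ n ∧
      ∀ k : ℕ, (k : WithBot ℕ∞) ≤ topologicalKrullDim (closure S) →
        Function.Bijective (pushforward k (Arrangement.closure_le_sing hS)) ∧
        Function.Bijective (pushforward k (le_top : A.sing ≤ ⊤))) ∧
    -- canonical isomorphisms for edges of codimension `2` contained in `Σ₁`
    (∀ k, k + 2 = n → ∀ S (hS : S ∈ A.strata₁ l 2),
      Function.Bijective (pushforward k (Arrangement.closure_le_sing₁ hS)) ∧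
      Function.Bijective (pushforward k (le_top : A.sing₁ ≤ ⊤))) := by
  refine ⟨fun k hk => A.basis_X hk,
    fun k hk => ⟨LinearEquiv.ofBijective _ (A.degree_X_bijective hr hk)⟩,
    fun k hk => Arrangement.basis_sing hl hk, fun k hk hne => ?_, fun k hk he => ?_,
    fun k hk hne => ⟨LinearEquiv.ofBijective _ (Arrangement.degree_sing_bijective hne hk)⟩,
    fun i hi S hS => ?_, fun k hk S hS => ?_⟩
  · obtain ⟨h1, h2⟩ := Arrangement.linearIndependent_isCompl_sing hl hk
    have hb := Arrangement.degree_sing₁_bijective hne hk.le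
    -- The degree on Σ₁ is injective and factors through the push-forward.
    have hinj : Function.Injective (pushforward k A.sing₁_le) := by
      intro x y hxy
      refine hb.1 ?_
      rw [← PP.degree_pushforward A.sing₁_le, hxy, PP.degree_pushforward]
    exact ⟨h1, h2, ⟨(LinearEquiv.ofInjective _ hinj).symm ≪≫ₗ LinearEquiv.ofBijective _ hb⟩, hinj,
      PP.pushforward_bijective _ hb (PP.degree_top_bijective (by omega))⟩
  · obtain ⟨h1, h2⟩ := Arrangement.linearIndependent_isCompl_sing hl hk
    refine ⟨h1, ?_⟩
    have hempty : {z : Subvariety k A.sing | z.1 ∈ A.sing₁} = ∅ :=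
      Set.eq_empty_of_forall_notMem fun z hz => (he ▸ hz : z.1 ∈ (∅ : Set (PP n)))
    have h3 := h2.sup_eq_top
    rwa [PP.range_pushforward, hempty, Set.image_empty, Submodule.span_empty, sup_bot_eq] at h3
  · obtain ⟨x, hx, hs, hd, rfl⟩ := Arrangement.exists_of_mem_strataCodim hS hl
    -- An upper bound on the Krull dimension suffices for both the bound by n-3 and the range of
    -- `k`.
    have hdim := PP.topologicalKrullDim_closure_le (hx.closure_stratum hl)
    refine ⟨(add_le_add_left hdim 3).trans ?_, fun k hk => ?_⟩
    · exact_mod_cast (by omega : PP.dim x + 3 ≤ n)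
    · have hkx : k ≤ PP.dim x := by exact_mod_cast hk.trans hdim
      have hb := Arrangement.degree_sing_bijective (k := k) ⟨x, hs⟩ (by omega)
      exact ⟨PP.pushforward_bijective _ (hx.degree_closure_stratum_bijective hl hkx) hb,
        PP.pushforward_bijective _ hb (PP.degree_top_bijective (by omega))⟩
  · obtain ⟨x, hx, hs, hd, rfl⟩ := Arrangement.exists_of_mem_strataCodim hS.1 hl
    have hb := Arrangement.degree_sing₁_bijective (k := k) ⟨x, hS.2 (hx.mem_stratum hl)⟩ hk.le
    exact ⟨PP.pushforward_bijective _ (hx.degree_closure_stratum_bijective hl (by omega)) hb,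
      PP.pushforward_bijective _ hb (PP.degree_top_bijective (by omega))⟩
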